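/- Let $(M,g)$ be a smooth four-dimensional spacetime of signature $(-,+,+,+)$ and let $\Phi:\mathbb{R}\times\mathbb{S}^2\to M$ be a smooth embedding onto a null hypersurface such that the vector $n=e_1=d\Phi(\partial_{\xi^1})$ is normal to it. For local coordinates $\xi^M$ ($M=2,3$) on $\mathbb{S}^2$ put $e_M=d\Phi(\partial_{\xi^M})$ and $q_{MN}=g(e_M,e_N)$, with Levi-Civita connection $D$ and scalar curvature $\mathcal R$. Let $\ell$ be the smooth rigging with $g(\ell,\ell)=0$, $g(\ell,n)=1$, $g(\ell,e_M)=0$, and define $\kappa,\Omega_M,\Xi_{MN}$ by $\tfrac12\mathcal L_\ell g(n,n)=-\kappa$, $\tfrac12\mathcal L_\ell g(n,e_M)=-\Omega_M$, $\tfrac12\mathcal L_\ell g(e_M,e_N)=\Xi_{MN}$. Suppose that the hypersurface is a non-expanding horizon ($\theta=\tfrac12q^{MN}\partial_nq_{MN}=0$) on which the vacuum equations $R_{\mu\nu}=0$ hold. Set $$\Sigma^0_{MN}=\tfrac12(D_M\Omega_N+D_N\Omega_M)+\Omega_M\Omega_N+\kappa\,\Xi_{MN},$$ with trace $\theta^0$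 and traceless part $\sigma^0_{MN}$, and suppose that the horizon is generic and that the gauge $\kappa=\kappa_0$ with $\kappa_0>0$ constant, $\partial_n\theta^0=0$ has been imposed. Let $\eta$ be a smooth potential of the rotation one-form, i.e. $\partial_n\eta=\kappa_0$ and $\Omega_M=\Omega^e_M+\Omega^0_M$ with $\Omega^e_M=\partial_M\eta$ and $D^M\Omega^0_M=0$. Then $\eta=\kappa_0\xi^1+h(\xi^M)$; let $H(\eta,\xi^M)=(\eta-h(\xi^M))/\kappa_0$ be the value of $\xi^1$ expressed in terms of $\eta$, and set $$s_{MN}(\eta,\xi^M)=\sigma^0_{MN}(H(\eta,\xi^M),\xi^M),\qquad Ds=D^Ms_{M2}+\Omega^{0|M}s_{M2}-\mathrm i\,(D^Ms_{M3}+\Omega^{0|M}s_{M3}),$$ where $D$ acts on $s_{MN}$ at fixed $\eta$. With a null tetrad $\{n,\ell,m,\overline m\}$, $m=\tfrac1{\sqrt2}(\hat e_2+\mathrm i\hat e_3)$, where $(\hat e_2,\hat e_3)$ is a $q$-orthonormal frame of the sections with the orientation of $(e_2,e_3)$ that equals $(e_2,e_3)$ wherever $q_{MN}=\delta_{MN}$,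 let $$\Psi_2=C_{\sigma\rho\mu\nu}n^\sigma m^\rho\ell^\mu\overline m^\nu,\qquad \Psi_3=C_{\sigma\rho\mu\nu}n^\sigma\ell^\rho\overline m^\mu\ell^\nu,$$ where $C$ is the Weyl tensor, and let $\Psi_n^c(\eta,\xi^M)=\Psi_n(H(\eta,\xi^M),\xi^M)$ be the gauge-corrected Weyl scalars. Then, at every point $\xi^M_0$ of the sphere and in any coordinates $\xi^M$ with $q_{MN}(\xi_0)=\delta_{MN}$, the function $\Psi_2^c(\eta,\cdot)$ is differentiable at $\xi_0$ and, for all real $\eta$ and $\eta_0$, $$\Psi_3^c=\frac1{\kappa_0\sqrt2}\Big[Ds|_{\eta_0}\,e^{-(\eta-\eta_0)}+\hat D\Psi_2^c+3\,\hat\Omega^0\,\Psi_2^c+3\,\hat\Omega^e\,\Psi_2^c\Big],$$ where $\hat D=\partial_2-\mathrm i\,\partial_3$ (at fixed $\eta$) and $\hat\Omega=\Omega_2-\mathrm i\,\Omega_3$. -/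

import Mathlib

open scoped Manifold ContDiff

/-! ## Levi-Civita calculus of a metric given by its components on `ℝⁿ` -/

/-- The partial derivative `∂ᵢ f` at `x`. -/
noncomputable def pd {n : ℕ} {F : Type*} [NormedAddCommGroup F] [NormedSpace ℝ F]
    (f : EuclideanSpace ℝ (Fin n) → F) (i : Fin n) (x : EuclideanSpace ℝ (Fin n)) : F :=
  fderiv ℝ f x (EuclideanSpace.single i 1)

/-- The Christoffel symbol `Γᵏᵢⱼ` of the metric with component functions `G`. -/
noncomputable def christoffel {n : ℕ} (G : EuclideanSpace ℝ (Fin n) → Matrix (Fin n) (Fin n) ℝ)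
    (x : EuclideanSpace ℝ (Fin n)) (k i j : Fin n) : ℝ :=
  (1 / 2) * ∑ l, (G x)⁻¹ k l *
    (pd (fun x' => G x' j l) i x + pd (fun x' => G x' i l) j x - pd (fun x' => G x' i j) l x)

/-- The Riemann tensor `R^s_{r m n}`, with `∇_m ∇_n V^s - ∇_n ∇_m V^s = R^s_{r m n} V^r`. -/
noncomputable def riemannUp {d : ℕ} (G : EuclideanSpace ℝ (Fin d) → Matrix (Fin d) (Fin d) ℝ)
    (x : EuclideanSpace ℝ (Fin d)) (s r m n : Fin d) : ℝ :=
  pd (fun x' => christoffel G x' s n r) m x - pd (fun x' => christoffel G x' s m r) n x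
    + ∑ l, (christoffel G x s m l * christoffel G x l n r
        - christoffel G x s n l * christoffel G x l m r)

/-- The Riemann tensor `R_{s r m n}` with all indices lowered. -/
noncomputable def riemannLow {d : ℕ} (G : EuclideanSpace ℝ (Fin d) → Matrix (Fin d) (Fin d) ℝ)
    (x : EuclideanSpace ℝ (Fin d)) (s r m n : Fin d) : ℝ :=
  ∑ a, G x s a * riemannUp G x a r m n

/-- The Ricci tensor `R_{m n} = R^s_{m s n}`. -/
noncomputable def ricci {d : ℕ} (G : EuclideanSpace ℝ (Fin d) → Matrix (Fin d) (Fin d) ℝ)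
    (x : EuclideanSpace ℝ (Fin d)) (m n : Fin d) : ℝ :=
  ∑ s, riemannUp G x s m s n

/-- The scalar curvature `R = g^{m n} R_{m n}`. -/
noncomputable def scalarCurv {d : ℕ} (G : EuclideanSpace ℝ (Fin d) → Matrix (Fin d) (Fin d) ℝ)
    (x : EuclideanSpace ℝ (Fin d)) : ℝ :=
  ∑ m, ∑ n, (G x)⁻¹ m n * ricci G x m n

/-- The Schouten tensor of a four-dimensional metric, `S_{m n} = R_{m n} - (1/6) R g_{m n}`. -/
noncomputable def schouten (G : EuclideanSpace ℝ (Fin 4) → Matrix (Fin 4) (Fin 4) ℝ)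
    (x : EuclideanSpace ℝ (Fin 4)) (m n : Fin 4) : ℝ :=
  ricci G x m n - (1 / 6) * scalarCurv G x * G x m n

/-- The Weyl tensor `C_{s r m n}` of a four-dimensional metric. -/
noncomputable def weyl (G : EuclideanSpace ℝ (Fin 4) → Matrix (Fin 4) (Fin 4) ℝ)
    (x : EuclideanSpace ℝ (Fin 4)) (s r m n : Fin 4) : ℝ :=
  riemannLow G x s r m n - (1 / 2) *
    ((G x s m * schouten G x n r - G x s n * schouten G x m r)
      - (G x r m * schouten G x n s - G x r n * schouten G x m s))

/-- The covariant derivative `D_i w_j` of a one-form. -/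
noncomputable def covOneForm {n : ℕ} (G : EuclideanSpace ℝ (Fin n) → Matrix (Fin n) (Fin n) ℝ)
    (w : EuclideanSpace ℝ (Fin n) → Fin n → ℝ) (x : EuclideanSpace ℝ (Fin n)) (i j : Fin n) : ℝ :=
  pd (fun x' => w x' j) i x - ∑ l, christoffel G x l i j * w x l

/-- The divergence `D^i w_i` of a one-form. -/
noncomputable def divOneForm {n : ℕ} (G : EuclideanSpace ℝ (Fin n) → Matrix (Fin n) (Fin n) ℝ)
    (w : EuclideanSpace ℝ (Fin n) → Fin n → ℝ) (x : EuclideanSpace ℝ (Fin n)) : ℝ :=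
  ∑ i, ∑ j, (G x)⁻¹ i j * covOneForm G w x i j

/-- The covariant derivative `D_k t_{i j}` of a covariant two-tensor. -/
noncomputable def covTwoTensor {n : ℕ} (G : EuclideanSpace ℝ (Fin n) → Matrix (Fin n) (Fin n) ℝ)
    (t : EuclideanSpace ℝ (Fin n) → Matrix (Fin n) (Fin n) ℝ) (x : EuclideanSpace ℝ (Fin n))
    (k i j : Fin n) : ℝ :=
  pd (fun x' => t x' i j) k x - ∑ l, christoffel G x l k i * t x l j
    - ∑ l, christoffel G x l k j * t x i l

/-- The divergence `D^i t_{i j}` of a covariant two-tensor. -/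
noncomputable def divTwoTensor {n : ℕ} (G : EuclideanSpace ℝ (Fin n) → Matrix (Fin n) (Fin n) ℝ)
    (t : EuclideanSpace ℝ (Fin n) → Matrix (Fin n) (Fin n) ℝ) (x : EuclideanSpace ℝ (Fin n))
    (j : Fin n) : ℝ :=
  ∑ k, ∑ i, (G x)⁻¹ k i * covTwoTensor G t x k i j

/-! ## Spacetime -/

/-- A smooth metric of signature `(-,+,+,+)` on the four-manifold `M`. -/
structure LorentzMetric (M : Type*) [TopologicalSpace M]
    [ChartedSpace (EuclideanSpace ℝ (Fin 4)) M] where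
  val : ∀ p : M, TangentSpace (𝓡 4) p →ₗ[ℝ] TangentSpace (𝓡 4) p →ₗ[ℝ] ℝ
  symm : ∀ (p : M) (v w : TangentSpace (𝓡 4) p), val p v w = val p w v
  signature : ∀ p : M, ∃ b : Module.Basis (Fin 4) ℝ (TangentSpace (𝓡 4) p),
    ∀ i j, val p (b i) (b j) = if i = j then (if i = 0 then -1 else 1) else 0
  smooth : ∀ φ ∈ IsManifold.maximalAtlas (𝓡 4) ∞ M, ∀ a b : EuclideanSpace ℝ (Fin 4),
    ContDiffOn ℝ ∞ (fun x => val (φ.symm x) (mfderiv (𝓡 4) (𝓡 4) φ.symm x a)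
      (mfderiv (𝓡 4) (𝓡 4) φ.symm x b)) φ.target

section Spacetime

variable {M : Type*} [TopologicalSpace M] [ChartedSpace (EuclideanSpace ℝ (Fin 4)) M]

/-- The metric, written in the chart `φ` at the coordinate point `x`, on coordinate vectors. -/
noncomputable def LorentzMetric.inChart (g : LorentzMetric M)
    (φ : OpenPartialHomeomorph M (EuclideanSpace ℝ (Fin 4)))
    (x a b : EuclideanSpace ℝ (Fin 4)) : ℝ :=
  g.val (φ.symm x) (mfderiv (𝓡 4) (𝓡 4) φ.symm x a) (mfderiv (𝓡 4) (𝓡 4) φ.symm x b)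

/-- The components of the metric in the chart `φ`. -/
noncomputable def LorentzMetric.comp (g : LorentzMetric M)
    (φ : OpenPartialHomeomorph M (EuclideanSpace ℝ (Fin 4)))
    (x : EuclideanSpace ℝ (Fin 4)) : Matrix (Fin 4) (Fin 4) ℝ :=
  Matrix.of fun m n => g.inChart φ x (EuclideanSpace.single m 1) (EuclideanSpace.single n 1)

/-- The components of the Ricci tensor at `p`, in the preferred chart at `p`. -/
noncomputable def LorentzMetric.ricciAt (g : LorentzMetric M) (p : M) (m n : Fin 4) : ℝ :=
  ricci (g.comp (chartAt (EuclideanSpace ℝ (Fin 4)) p)) (chartAt (EuclideanSpace ℝ (Fin 4)) p p) m n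

/-- The components of a tangent vector at `p` in the chart `φ`. -/
noncomputable def vecInChart (φ : OpenPartialHomeomorph M (EuclideanSpace ℝ (Fin 4))) (p : M)
    (v : TangentSpace (𝓡 4) p) : EuclideanSpace ℝ (Fin 4) :=
  mfderiv (𝓡 4) (𝓡 4) φ p v

/-- The contraction `C_{s r m n} a^s b^r c^m d^n` of the Weyl tensor at `p` with complex vectors,
all given by their components in the preferred chart at `p`. -/
noncomputable def LorentzMetric.weylAt (g : LorentzMetric M) (p : M)
    (a b c d : Fin 4 → ℂ) : ℂ :=
  ∑ s, ∑ r, ∑ m, ∑ n,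
    (weyl (g.comp (chartAt (EuclideanSpace ℝ (Fin 4)) p))
      (chartAt (EuclideanSpace ℝ (Fin 4)) p p) s r m n : ℂ) * a s * b r * c m * d n

/-- The components of a tangent vector at `p` in the preferred chart at `p`, as complex numbers. -/
noncomputable def complexComp (p : M) (v : TangentSpace (𝓡 4) p) : Fin 4 → ℂ :=
  fun m => ((vecInChart (chartAt (EuclideanSpace ℝ (Fin 4)) p) p v m : ℝ) : ℂ)

end Spacetime

/-! ## Null hypersurfaces with topology `ℝ × S²` and their data -/

instance factFinrankThree : Fact (Module.finrank ℝ (EuclideanSpace ℝ (Fin 3)) = 2 + 1) :=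
  ⟨by simp⟩

/-- The two-sphere. -/
abbrev S2 : Type := Metric.sphere (0 : EuclideanSpace ℝ (Fin 3)) 1

/-- The charts of the sphere. -/
abbrev S2Chart : Type := OpenPartialHomeomorph S2 (EuclideanSpace ℝ (Fin 2))

/-- `ψ` belongs to the smooth structure of the sphere. -/
def IsSmoothChart (ψ : S2Chart) : Prop := ψ ∈ IsManifold.maximalAtlas (𝓡 2) ∞ S2

/-- A null hypersurface of `(M, g)`: a smooth embedding `emb` of `ℝ × S²` such that the coordinate
vector `n` along `ℝ` is normal (hence null), together with the rigging `ℓ`, the transverse null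
vector field with `g(ℓ, n) = 1` that is orthogonal to the sections `{ξ¹} × S²`. -/
structure NullHypersurface {M : Type*} [TopologicalSpace M]
    [ChartedSpace (EuclideanSpace ℝ (Fin 4)) M] [IsManifold (𝓡 4) ∞ M] (g : LorentzMetric M) where
  emb : ℝ × S2 → M
  emb_smooth : ContMDiff (𝓘(ℝ, ℝ).prod (𝓡 2)) (𝓡 4) ∞ emb
  emb_embedding : Topology.IsEmbedding emb
  emb_immersion : ∀ ξ, Function.Injective (mfderiv (𝓘(ℝ, ℝ).prod (𝓡 2)) (𝓡 4) emb ξ)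
  rig : ∀ ξ : ℝ × S2, TangentSpace (𝓡 4) (emb ξ)
  rig_smooth : ContMDiff (𝓘(ℝ, ℝ).prod (𝓡 2)) (𝓡 4).tangent ∞
    (fun ξ => (⟨emb ξ, rig ξ⟩ : TangentBundle (𝓡 4) M))
  normal : ∀ (ξ : ℝ × S2) (v : TangentSpace (𝓘(ℝ, ℝ).prod (𝓡 2)) ξ),
    g.val (emb ξ) (mfderiv (𝓘(ℝ, ℝ).prod (𝓡 2)) (𝓡 4) emb ξ
        ((1, 0) : ℝ × EuclideanSpace ℝ (Fin 2)))
      (mfderiv (𝓘(ℝ, ℝ).prod (𝓡 2)) (𝓡 4) emb ξ v) = 0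
  rig_null : ∀ ξ, g.val (emb ξ) (rig ξ) (rig ξ) = 0
  rig_normal : ∀ ξ, g.val (emb ξ) (rig ξ) (mfderiv (𝓘(ℝ, ℝ).prod (𝓡 2)) (𝓡 4) emb ξ
    ((1, 0) : ℝ × EuclideanSpace ℝ (Fin 2))) = 1
  rig_section : ∀ (ξ : ℝ × S2) (w : EuclideanSpace ℝ (Fin 2)),
    g.val (emb ξ) (rig ξ) (mfderiv (𝓘(ℝ, ℝ).prod (𝓡 2)) (𝓡 4) emb ξ
      ((0, w) : ℝ × EuclideanSpace ℝ (Fin 2))) = 0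

namespace NullHypersurface

variable {M : Type*} [TopologicalSpace M] [ChartedSpace (EuclideanSpace ℝ (Fin 4)) M]
  [IsManifold (𝓡 4) ∞ M] {g : LorentzMetric M} (𝓗 : NullHypersurface g)

/-! Below, `ψ` is a chart of the sphere, and `z = (ξ¹, y)` are the induced coordinates on
`ℝ × S²`; the values `0, 1 : Fin 2` stand for the usual index values `2, 3`. -/

/-- The hypersurface, parametrised by the coordinates `(ξ¹, y)`. -/
noncomputable def param (ψ : S2Chart) (z : ℝ × EuclideanSpace ℝ (Fin 2)) : M :=
  𝓗.emb (z.1, ψ.symm z.2)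

/-- The rigging at the point with coordinates `z`. -/
noncomputable def rigAt (ψ : S2Chart) (z : ℝ × EuclideanSpace ℝ (Fin 2)) :
    TangentSpace (𝓡 4) (𝓗.param ψ z) :=
  𝓗.rig (z.1, ψ.symm z.2)

/-- The tangent vector of the hypersurface with components `v` in the coordinates `(ξ¹, y)`. -/
noncomputable def push (ψ : S2Chart) (z v : ℝ × EuclideanSpace ℝ (Fin 2)) :
    TangentSpace (𝓡 4) (𝓗.param ψ z) :=
  mfderiv 𝓘(ℝ, ℝ × EuclideanSpace ℝ (Fin 2)) (𝓡 4) (𝓗.param ψ) z v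

/-- The null normal `n = e₁`. -/
noncomputable def nVec (ψ : S2Chart) (z : ℝ × EuclideanSpace ℝ (Fin 2)) :
    TangentSpace (𝓡 4) (𝓗.param ψ z) :=
  𝓗.push ψ z (1, 0)

/-- The coordinate vectors `e_M` of the sections. -/
noncomputable def eVec (ψ : S2Chart) (z : ℝ × EuclideanSpace ℝ (Fin 2)) (i : Fin 2) :
    TangentSpace (𝓡 4) (𝓗.param ψ z) :=
  𝓗.push ψ z (0, EuclideanSpace.single i 1)

/-- The induced metric `q_{MN}` of the sections. -/
noncomputable def q (ψ : S2Chart) (z : ℝ × EuclideanSpace ℝ (Fin 2)) : Matrix (Fin 2) (Fin 2) ℝ :=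
  Matrix.of fun i j => g.val (𝓗.param ψ z) (𝓗.eVec ψ z i) (𝓗.eVec ψ z j)

/-- The rigging in the spacetime chart `φ`, as a function of the coordinates `z`. -/
noncomputable def rigInChart (ψ : S2Chart)
    (φ : OpenPartialHomeomorph M (EuclideanSpace ℝ (Fin 4)))
    (z : ℝ × EuclideanSpace ℝ (Fin 2)) : EuclideanSpace ℝ (Fin 4) :=
  vecInChart φ (𝓗.param ψ z) (𝓗.rigAt ψ z)

/-- The tensor `½ (ℒ_ℓ g)(v, w)` for `v`, `w` tangent to the hypersurface, computed in the
spacetime chart `φ` from `(ℒ_ℓ g)(v, w) = (∂_ℓ g)(v, w) + g(∂_v ℓ, w) + g(v, ∂_w ℓ)`. -/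
noncomputable def YInChart (ψ : S2Chart)
    (φ : OpenPartialHomeomorph M (EuclideanSpace ℝ (Fin 4)))
    (z v w : ℝ × EuclideanSpace ℝ (Fin 2)) : ℝ :=
  (1 / 2) *
    (fderiv ℝ (fun x => g.inChart φ x (vecInChart φ (𝓗.param ψ z) (𝓗.push ψ z v))
        (vecInChart φ (𝓗.param ψ z) (𝓗.push ψ z w)))
        (φ (𝓗.param ψ z)) (𝓗.rigInChart ψ φ z)
      + g.inChart φ (φ (𝓗.param ψ z)) (fderiv ℝ (𝓗.rigInChart ψ φ) z v)
        (vecInChart φ (𝓗.param ψ z) (𝓗.push ψ z w))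
      + g.inChart φ (φ (𝓗.param ψ z)) (vecInChart φ (𝓗.param ψ z) (𝓗.push ψ z v))
        (fderiv ℝ (𝓗.rigInChart ψ φ) z w))

/-- The tensor `Y = ½ ℒ_ℓ g` pulled back to the hypersurface. -/
noncomputable def Y (ψ : S2Chart) (z v w : ℝ × EuclideanSpace ℝ (Fin 2)) : ℝ :=
  𝓗.YInChart ψ (chartAt (EuclideanSpace ℝ (Fin 4)) (𝓗.param ψ z)) z v w

/-- The surface gravity `κ = -Y_{nn}`. -/
noncomputable def kappa (ψ : S2Chart) (z : ℝ × EuclideanSpace ℝ (Fin 2)) : ℝ :=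
  -𝓗.Y ψ z (1, 0) (1, 0)

/-- The Hajicek one-form `Ω_M = -Y_{nM}`. -/
noncomputable def Omega (ψ : S2Chart) (z : ℝ × EuclideanSpace ℝ (Fin 2)) (i : Fin 2) : ℝ :=
  -𝓗.Y ψ z (1, 0) (0, EuclideanSpace.single i 1)

/-- The transverse connection `Ξ_{MN} = Y_{MN}`. -/
noncomputable def Xi (ψ : S2Chart) (z : ℝ × EuclideanSpace ℝ (Fin 2)) (i j : Fin 2) : ℝ :=
  𝓗.Y ψ z (0, EuclideanSpace.single i 1) (0, EuclideanSpace.single j 1)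

/-- The second fundamental form `Θ_{MN} = ½ ∂_n q_{MN}`. -/
noncomputable def secondFF (ψ : S2Chart) (z : ℝ × EuclideanSpace ℝ (Fin 2)) (i j : Fin 2) : ℝ :=
  (1 / 2) * deriv (fun t => 𝓗.q ψ (t, z.2) i j) z.1

/-- The expansion `θ = q^{MN} Θ_{MN}`. -/
noncomputable def expansion (ψ : S2Chart) (z : ℝ × EuclideanSpace ℝ (Fin 2)) : ℝ :=
  ∑ i, ∑ j, (𝓗.q ψ z)⁻¹ i j * 𝓗.secondFF ψ z i j

/-- A non-expanding horizon: a null hypersurface with vanishing expansion. -/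
def IsNonExpanding : Prop :=
  ∀ ψ, IsSmoothChart ψ → ∀ u, ∀ y ∈ ψ.target, 𝓗.expansion ψ (u, y) = 0

/-- The vacuum equations `R_{μν} = 0` hold at the points of the hypersurface. -/
def IsVacuum : Prop := ∀ ξ m n, g.ricciAt (𝓗.emb ξ) m n = 0

/-- `Σ⁰_{MN} = ½ (D_M Ω_N + D_N Ω_M) + Ω_M Ω_N + κ Ξ_{MN}`. -/
noncomputable def Sigma0 (ψ : S2Chart) (z : ℝ × EuclideanSpace ℝ (Fin 2)) (i j : Fin 2) : ℝ :=
  (1 / 2) * (covOneForm (fun y => 𝓗.q ψ (z.1, y)) (fun y => 𝓗.Omega ψ (z.1, y)) z.2 i j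
      + covOneForm (fun y => 𝓗.q ψ (z.1, y)) (fun y => 𝓗.Omega ψ (z.1, y)) z.2 j i)
    + 𝓗.Omega ψ z i * 𝓗.Omega ψ z j + 𝓗.kappa ψ z * 𝓗.Xi ψ z i j

/-- The trace `θ⁰` of `Σ⁰_{MN}`. -/
noncomputable def theta0 (ψ : S2Chart) (z : ℝ × EuclideanSpace ℝ (Fin 2)) : ℝ :=
  ∑ i, ∑ j, (𝓗.q ψ z)⁻¹ i j * 𝓗.Sigma0 ψ z i j

/-- The traceless part `σ⁰_{MN}` of `Σ⁰_{MN}`. -/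
noncomputable def sigma0 (ψ : S2Chart) (z : ℝ × EuclideanSpace ℝ (Fin 2)) :
    Matrix (Fin 2) (Fin 2) ℝ :=
  Matrix.of fun i j => 𝓗.Sigma0 ψ z i j - (1 / 2) * 𝓗.theta0 ψ z * 𝓗.q ψ z i j

/-- First gauge condition: the surface gravity is the positive constant `κ₀`. -/
def GaugeKappa (κ₀ : ℝ) : Prop :=
  0 < κ₀ ∧ ∀ ψ, IsSmoothChart ψ → ∀ u, ∀ y ∈ ψ.target, 𝓗.kappa ψ (u, y) = κ₀

/-- Second gauge condition: `∂_n θ⁰ = 0`. -/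
def GaugeTheta : Prop :=
  ∀ ψ, IsSmoothChart ψ → ∀ u, ∀ y ∈ ψ.target, deriv (fun t => 𝓗.theta0 ψ (t, y)) u = 0

/-! ### The potential of the rotation one-form and the Hodge decomposition of `Ω_M` -/

/-- The exact part `Ωᵉ_M = ∂_M η` of the Hajicek one-form, for a potential `η`. -/
noncomputable def OmegaE (η : ℝ × S2 → ℝ) (ψ : S2Chart) (z : ℝ × EuclideanSpace ℝ (Fin 2))
    (i : Fin 2) : ℝ :=
  pd (fun y => η (z.1, ψ.symm y)) i z.2

/-- The divergence free part `Ω⁰_M = Ω_M - ∂_M η` of the Hajicek one-form. -/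
noncomputable def Omega0 (η : ℝ × S2 → ℝ) (ψ : S2Chart) (z : ℝ × EuclideanSpace ℝ (Fin 2))
    (i : Fin 2) : ℝ :=
  𝓗.Omega ψ z i - OmegaE η ψ z i

/-- `η` is a potential of the rotation one-form `(κ, Ω_M)`: it is smooth, `∂_n η = κ`, and
`Ω_M - ∂_M η` is divergence free on each section. -/
structure IsPotential (η : ℝ × S2 → ℝ) : Prop where
  smooth : ContMDiff (𝓘(ℝ, ℝ).prod (𝓡 2)) 𝓘(ℝ, ℝ) ∞ η
  null_deriv : ∀ ψ, IsSmoothChart ψ → ∀ u, ∀ y ∈ ψ.target,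
    deriv (fun t => η (t, ψ.symm y)) u = 𝓗.kappa ψ (u, y)
  div_free : ∀ ψ, IsSmoothChart ψ → ∀ u, ∀ y ∈ ψ.target,
    divOneForm (fun y' => 𝓗.q ψ (u, y')) (fun y' => 𝓗.Omega0 η ψ (u, y')) y = 0

/-- The function `H(τ, ·)`: since `η = κ₀ ξ¹ + h` with `h = η(0, ·)`, the value `τ` of `η` is
attained on the generator through `s` at `ξ¹ = (τ - h(s)) / κ₀`. -/
noncomputable def nullCoord (κ₀ : ℝ) (η : ℝ × S2 → ℝ) (τ : ℝ) (s : S2) : ℝ :=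
  (τ - η (0, s)) / κ₀

/-- The coordinates `(H(τ, y), y)` of the point of the section `η = τ` over `y`. -/
noncomputable def sectionPt (κ₀ : ℝ) (η : ℝ × S2 → ℝ) (ψ : S2Chart) (τ : ℝ)
    (y : EuclideanSpace ℝ (Fin 2)) : ℝ × EuclideanSpace ℝ (Fin 2) :=
  (nullCoord κ₀ η τ (ψ.symm y), y)

/-- `s_{MN}(τ, y) = σ⁰_{MN}(H(τ, y), y)`. -/
noncomputable def sTensor (κ₀ : ℝ) (η : ℝ × S2 → ℝ) (ψ : S2Chart) (τ : ℝ)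
    (y : EuclideanSpace ℝ (Fin 2)) : Matrix (Fin 2) (Fin 2) ℝ :=
  𝓗.sigma0 ψ (sectionPt κ₀ η ψ τ y)

/-- `D^M s_{MA} + Ω^{0|M} s_{MA}` on the section `η = τ`. -/
noncomputable def DsComp (κ₀ : ℝ) (η : ℝ × S2 → ℝ) (ψ : S2Chart) (τ : ℝ)
    (y : EuclideanSpace ℝ (Fin 2)) (a : Fin 2) : ℝ :=
  divTwoTensor (fun y' => 𝓗.q ψ (sectionPt κ₀ η ψ τ y')) (𝓗.sTensor κ₀ η ψ τ) y a
    + ∑ i, ∑ j, (𝓗.q ψ (sectionPt κ₀ η ψ τ y))⁻¹ i j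
        * 𝓗.Omega0 η ψ (sectionPt κ₀ η ψ τ y) i * 𝓗.sTensor κ₀ η ψ τ y j a

/-- The complex field `Ds = D^M s_{M2} + Ω^{0|M} s_{M2} - i (D^M s_{M3} + Ω^{0|M} s_{M3})`. -/
noncomputable def Ds (κ₀ : ℝ) (η : ℝ × S2 → ℝ) (ψ : S2Chart) (τ : ℝ)
    (y : EuclideanSpace ℝ (Fin 2)) : ℂ :=
  (𝓗.DsComp κ₀ η ψ τ y 0 : ℂ) - Complex.I * (𝓗.DsComp κ₀ η ψ τ y 1 : ℂ)

/-! ### Weyl scalars -/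

/-- The orthonormal frame of the section obtained from `(e₂, e₃)` by the Gram-Schmidt process; it
is `(e₂, e₃)` itself wherever `q_{MN} = δ_{MN}`. -/
noncomputable def frame (ψ : S2Chart) (z : ℝ × EuclideanSpace ℝ (Fin 2)) (i : Fin 2) :
    TangentSpace (𝓡 4) (𝓗.param ψ z) :=
  if i = 0 then (Real.sqrt (𝓗.q ψ z 0 0))⁻¹ • 𝓗.eVec ψ z 0
  else (Real.sqrt ((𝓗.q ψ z).det / 𝓗.q ψ z 0 0))⁻¹ •
    (𝓗.eVec ψ z 1 - (𝓗.q ψ z 0 1 / 𝓗.q ψ z 0 0) • 𝓗.eVec ψ z 0)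

/-- The components of `m = (e₂ + i e₃) / √2`, for the orthonormal frame above. -/
noncomputable def mVec (ψ : S2Chart) (z : ℝ × EuclideanSpace ℝ (Fin 2)) : Fin 4 → ℂ :=
  fun k => (complexComp _ (𝓗.frame ψ z 0) k + Complex.I * complexComp _ (𝓗.frame ψ z 1) k)
    / (Real.sqrt 2 : ℂ)

/-- The components of `m̄ = (e₂ - i e₃) / √2`, for the orthonormal frame above. -/
noncomputable def mBar (ψ : S2Chart) (z : ℝ × EuclideanSpace ℝ (Fin 2)) : Fin 4 → ℂ :=
  fun k => (complexComp _ (𝓗.frame ψ z 0) k - Complex.I * complexComp _ (𝓗.frame ψ z 1) k)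
    / (Real.sqrt 2 : ℂ)

/-- The Weyl scalar `Ψ₂ = C(n, m, ℓ, m̄)`. -/
noncomputable def Psi2 (ψ : S2Chart) (z : ℝ × EuclideanSpace ℝ (Fin 2)) : ℂ :=
  g.weylAt (𝓗.param ψ z) (complexComp _ (𝓗.nVec ψ z)) (𝓗.mVec ψ z)
    (complexComp _ (𝓗.rigAt ψ z)) (𝓗.mBar ψ z)

/-- The Weyl scalar `Ψ₃ = C(n, ℓ, m̄, ℓ)`. -/
noncomputable def Psi3 (ψ : S2Chart) (z : ℝ × EuclideanSpace ℝ (Fin 2)) : ℂ :=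
  g.weylAt (𝓗.param ψ z) (complexComp _ (𝓗.nVec ψ z)) (complexComp _ (𝓗.rigAt ψ z))
    (𝓗.mBar ψ z) (complexComp _ (𝓗.rigAt ψ z))

/-- The gauge corrected Weyl scalar `Ψ₂ᶜ(τ, y) = Ψ₂(H(τ, y), y)`. -/
noncomputable def Psi2c (κ₀ : ℝ) (η : ℝ × S2 → ℝ) (ψ : S2Chart) (τ : ℝ)
    (y : EuclideanSpace ℝ (Fin 2)) : ℂ :=
  𝓗.Psi2 ψ (sectionPt κ₀ η ψ τ y)

/-- The gauge corrected Weyl scalar `Ψ₃ᶜ(τ, y) = Ψ₃(H(τ, y), y)`. -/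
noncomputable def Psi3c (κ₀ : ℝ) (η : ℝ × S2 → ℝ) (ψ : S2Chart) (τ : ℝ)
    (y : EuclideanSpace ℝ (Fin 2)) : ℂ :=
  𝓗.Psi3 ψ (sectionPt κ₀ η ψ τ y)

end NullHypersurface

/-- The hat of a one-form with real components, `ŵ = w₂ - i w₃`. -/
noncomputable def hat (w : Fin 2 → ℝ) : ℂ := (w 0 : ℂ) - Complex.I * (w 1 : ℂ)

/-- The operator `D̂ f = ∂₂ f - i ∂₃ f` on complex functions. -/
noncomputable def DHat (f : EuclideanSpace ℝ (Fin 2) → ℂ) (y : EuclideanSpace ℝ (Fin 2)) : ℂ :=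
  pd f 0 y - Complex.I * pd f 1 y

/-! Every Weyl component in the statement is computed from the connection along the embedding. On
the horizon the vacuum equations turn the Weyl tensor into the Riemann tensor
(`weyl_eq_riemannLow`). Raychaudhuri's equation, vanishing expansion and positivity of `q` then kill
the whole second fundamental form (`fderiv_q_nDir`). So `q` does not depend on `ξ¹`, and `∇_n n = κ₀
n`, `∇_{e_i} n = Ω_i n`, `∇_{e_i} e_j = Γᵏ_{ij} e_k - Ξ_{ij} n`. Commuting these derivatives yields
`R(n, e_i)` and `R(e_i, e_j)` on tangent vectors.

The remaining Ricci equations, traced in a null frame, each have a meaning. `Ric(n, e_i) = 0` makes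
`Ω` constant along the generators (`IsShearFreeNear.deriv_Om`). `Ric(e_i, e_j) = 0` becomes `∂_n Ξ =
½ Ric(q) - Σ⁰` (`fderiv_Xi_nDir`). `Ric(e_i, ℓ) = 0` expresses `Ψ₃` through the Codazzi components
`curvC` (`Psi3_eq`). Likewise `Ψ₂ = -¼ R + (i/2) dΩ(ê₂, ê₃)`, with `R` the scalar curvature of `q`
(`Psi2_eq`).

With constant surface gravity, `∂_n Σ⁰ = κ₀ (½ Ric(q) - Σ⁰)`. The gauge `∂_n θ⁰ = 0` forces `R = 2
θ⁰`. As `Ric(q)` is pure trace in dimension two, the traceless part decays like `exp(-κ₀ ξ¹)`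
(`sigma0_eq_exp`). On the section `η = τ` this makes `s` equal to `exp(h - τ)` times a tensor
independent of `τ`. Differentiating `exp h` produces `∂h = Ωᵉ`, which completes `Ω⁰` to `Ω` in `Ds`
(`DsComp_eq`).

The core is the identity `div_traceless_source`: solve the definition of `Σ⁰` for `κ₀ Ξ` and insert
it into the traced Codazzi expression. The divergence of `σ⁰` gives `Ds`, and the derivatives of
`θ⁰` and `dΩ` give `D̂Ψ₂`. Commuting two derivatives of `Ω` contributes `-θ⁰ Ω`, the trace part of
`Σ⁰` another `-½ θ⁰ Ω`, and the products `Ω · DΩ` collapse to `-3/2` times `Ω` contracted with `dΩ`.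
As `Ψ₂ = -½ θ⁰ + (i/2) dΩ`, these terms are exactly `3 Ω̂ Ψ₂`. -/

/-! ## Covariant differentiation along a map -/

section CovariantDerivativeAlong

variable {Z E : Type*} [NormedAddCommGroup Z] [NormedSpace ℝ Z]
  [NormedAddCommGroup E] [NormedSpace ℝ E]

/-- The covariant derivative, in the direction `v`, of the vector field `V` along the map `p`, for
the connection with Christoffel symbols `Γ`. -/
noncomputable def covAlong (Γ : E → E →L[ℝ] E →L[ℝ] E) (p : Z → E) (v : Z) (V : Z → E) (z : Z) : E :=
  fderiv ℝ V z v + Γ (p z) (fderiv ℝ p z v) (V z)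

/-- The curvature operator `R(a, b) c` of the connection with Christoffel symbols `Γ`. -/
noncomputable def curvOp (Γ : E → E →L[ℝ] E →L[ℝ] E) (x a b c : E) : E :=
  fderiv ℝ Γ x a b c - fderiv ℝ Γ x b a c + Γ x a (Γ x b c) - Γ x b (Γ x a c)

theorem ContDiffAt.fderiv_const_apply {F : Type*} [NormedAddCommGroup F] [NormedSpace ℝ F]
    {f : Z → F} {z : Z} (hf : ContDiffAt ℝ ∞ f z) (v : Z) :
    ContDiffAt ℝ ∞ (fun x => fderiv ℝ f x v) z :=
  (hf.fderiv_right (m := ∞) (by simp)).clm_apply contDiffAt_const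

theorem ContDiffAt.differentiableAt_infty {F : Type*} [NormedAddCommGroup F] [NormedSpace ℝ F]
    {f : Z → F} {z : Z} (hf : ContDiffAt ℝ ∞ f z) : DifferentiableAt ℝ f z :=
  hf.differentiableAt (by simp)

theorem ContDiffAt.fderiv_fderiv_comm {F : Type*} [NormedAddCommGroup F] [NormedSpace ℝ F]
    {f : Z → F} {z : Z} (hf : ContDiffAt ℝ ∞ f z) (v w : Z) :
    fderiv ℝ (fun x => fderiv ℝ f x w) z v = fderiv ℝ (fun x => fderiv ℝ f x v) z w := by
  have hd : DifferentiableAt ℝ (fderiv ℝ f) z :=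
    (hf.fderiv_right (m := ∞) (by simp)).differentiableAt_infty
  have key : ∀ a b : Z, fderiv ℝ (fun x => fderiv ℝ f x b) z a = fderiv ℝ (fderiv ℝ f) z a b := by
    intro a b
    rw [fderiv_clm_apply hd (differentiableAt_const b)]
    simp
  rw [key, key]
  exact (hf.isSymmSndFDerivAt (n := ∞) (by simpa using WithTop.coe_le_coe.2 (le_top (a := (2 : ℕ∞))))) v w

variable {Γ : E → E →L[ℝ] E →L[ℝ] E} {p : Z → E} {V W : Z → E} {f : Z → ℝ} {z : Z}

theorem ContDiffAt.covAlong (hΓ : ContDiffAt ℝ ∞ Γ (p z)) (hp : ContDiffAt ℝ ∞ p z)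
    (hV : ContDiffAt ℝ ∞ V z) (v : Z) : ContDiffAt ℝ ∞ (covAlong Γ p v V) z :=
  (hV.fderiv_const_apply v).add
    (((hΓ.comp z hp).clm_apply (hp.fderiv_const_apply v)).clm_apply hV)

theorem covAlong_congr {V' : Z → E} (h : V =ᶠ[nhds z] V') (v : Z) :
    covAlong Γ p v V z = covAlong Γ p v V' z := by
  unfold covAlong
  rw [h.fderiv_eq, h.eq_of_nhds]

theorem covAlong_add (hV : DifferentiableAt ℝ V z) (hW : DifferentiableAt ℝ W z) (v : Z) :
    covAlong Γ p v (fun x => V x + W x) z = covAlong Γ p v V z + covAlong Γ p v W z := by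
  simp only [covAlong, fderiv_fun_add hV hW, map_add, _root_.add_apply]
  abel

theorem covAlong_smul (hf : DifferentiableAt ℝ f z) (hV : DifferentiableAt ℝ V z) (v : Z) :
    covAlong Γ p v (fun x => f x • V x) z = fderiv ℝ f z v • V z + f z • covAlong Γ p v V z := by
  simp only [covAlong, fderiv_fun_smul hf hV, map_smul, _root_.add_apply,
    _root_.smul_apply, ContinuousLinearMap.smulRight_apply, smul_add]
  abel

/-- Torsion-freeness along a map: constant directions commute, so symmetry of `Γ` and of the second
derivative of `p` suffices. -/
theorem covAlong_tangent_comm (hΓ : ∀ a b, Γ (p z) a b = Γ (p z) b a)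
    (hp : ContDiffAt ℝ ∞ p z) (v w : Z) :
    covAlong Γ p v (fun x => fderiv ℝ p x w) z = covAlong Γ p w (fun x => fderiv ℝ p x v) z := by
  rw [covAlong, covAlong, hp.fderiv_fderiv_comm v w, hΓ]

/-- The directions are constant, so no bracket term appears and the second derivatives of `p` and
`V` cancel. Only the values of `V` along `p` are needed, which suits fields such as the rigging that
are given only on the hypersurface. -/
theorem covAlong_covAlong_sub (hΓ : DifferentiableAt ℝ Γ (p z)) (hp : ContDiffAt ℝ ∞ p z)
    (hV : ContDiffAt ℝ ∞ V z) (v w : Z) :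
    covAlong Γ p v (covAlong Γ p w V) z - covAlong Γ p w (covAlong Γ p v V) z =
      curvOp Γ (p z) (fderiv ℝ p z v) (fderiv ℝ p z w) (V z) := by
  have hpd := hp.differentiableAt_infty
  have hVd := hV.differentiableAt_infty
  have hΓp : DifferentiableAt ℝ (fun x => Γ (p x)) z :=
    DifferentiableAt.comp (g := Γ) z hΓ hpd
  have key : ∀ a b : Z, fderiv ℝ (covAlong Γ p b V) z a =
      fderiv ℝ (fun x => fderiv ℝ V x b) z a
        + (fderiv ℝ Γ (p z) (fderiv ℝ p z a) (fderiv ℝ p z b) (V z)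
          + Γ (p z) (fderiv ℝ (fun x => fderiv ℝ p x b) z a) (V z)
          + Γ (p z) (fderiv ℝ p z b) (fderiv ℝ V z a)) := by
    intro a b
    have h1 : DifferentiableAt ℝ (fun x => fderiv ℝ V x b) z :=
      (hV.fderiv_const_apply b).differentiableAt_infty
    have h2 : DifferentiableAt ℝ (fun x => fderiv ℝ p x b) z :=
      (hp.fderiv_const_apply b).differentiableAt_infty
    have h3 : DifferentiableAt ℝ (fun x => Γ (p x) (fderiv ℝ p x b)) z := hΓp.clm_apply h2
    have h4 : fderiv ℝ (fun x => Γ (p x)) z = (fderiv ℝ Γ (p z)).comp (fderiv ℝ p z) :=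
      fderiv_comp (g := Γ) z hΓ hpd
    have h5 : covAlong Γ p b V = fun x => fderiv ℝ V x b + Γ (p x) (fderiv ℝ p x b) (V x) := rfl
    rw [h5, fderiv_fun_add h1 (h3.clm_apply hVd), fderiv_clm_apply h3 hVd,
      fderiv_clm_apply hΓp h2, h4]
    simp only [_root_.add_apply, ContinuousLinearMap.comp_apply,
      ContinuousLinearMap.flip_apply]
    abel
  have e : ∀ a b : Z, covAlong Γ p a (covAlong Γ p b V) z =
      fderiv ℝ (covAlong Γ p b V) z a + Γ (p z) (fderiv ℝ p z a) (covAlong Γ p b V z) :=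
    fun _ _ => rfl
  rw [e, e, key, key, hV.fderiv_fderiv_comm v w, hp.fderiv_fderiv_comm v w]
  simp only [covAlong, curvOp, map_add]
  abel

/-- The connection `Γ` preserves the metric `B` at `x`. -/
def IsMetricAt (B : E → E →L[ℝ] E →L[ℝ] ℝ) (Γ : E → E →L[ℝ] E →L[ℝ] E) (x : E) : Prop :=
  ∀ a b c, fderiv ℝ B x a b c = B x (Γ x a b) c + B x b (Γ x a c)

variable {B : E → E →L[ℝ] E →L[ℝ] ℝ}

theorem fderiv_metric_along (hB : DifferentiableAt ℝ B (p z)) (hm : IsMetricAt B Γ (p z))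
    (hp : DifferentiableAt ℝ p z) (hV : DifferentiableAt ℝ V z) (hW : DifferentiableAt ℝ W z)
    (v : Z) :
    fderiv ℝ (fun x => B (p x) (V x) (W x)) z v =
      B (p z) (covAlong Γ p v V z) (W z) + B (p z) (V z) (covAlong Γ p v W z) := by
  have hBp : DifferentiableAt ℝ (fun x => B (p x)) z :=
    DifferentiableAt.comp (g := B) z hB hp
  have h4 : fderiv ℝ (fun x => B (p x)) z = (fderiv ℝ B (p z)).comp (fderiv ℝ p z) :=
    fderiv_comp (g := B) z hB hp
  rw [fderiv_clm_apply (hBp.clm_apply hV) hW, fderiv_clm_apply hBp hV, h4]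
  simp only [_root_.add_apply, ContinuousLinearMap.comp_apply,
    ContinuousLinearMap.flip_apply, covAlong, map_add]
  rw [hm (fderiv ℝ p z v) (V z) (W z)]
  ring

theorem curvOp_antisymm_left (x a b c : E) : curvOp Γ x a b c = -curvOp Γ x b a c := by
  simp only [curvOp]; abel

theorem curvOp_bianchi {x : E} (hs : ∀ᶠ y in nhds x, ∀ a b, Γ y a b = Γ y b a)
    (hΓ : DifferentiableAt ℝ Γ x) (a b c : E) :
    curvOp Γ x a b c + curvOp Γ x b c a + curvOp Γ x c a b = 0 := by
  -- Symmetry of `Γ` holds on a neighbourhood, hence also for its derivative.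
  have hd : ∀ u v w, fderiv ℝ Γ x u v w = fderiv ℝ Γ x u w v := by
    intro u v w
    have h1 : ∀ v w, fderiv ℝ (fun y => Γ y v w) x u = fderiv ℝ Γ x u v w := by
      intro v w
      rw [fderiv_clm_apply (hΓ.clm_apply (differentiableAt_const v)) (differentiableAt_const w),
        fderiv_clm_apply hΓ (differentiableAt_const v)]
      simp
    have h2 : (fun y => Γ y v w) =ᶠ[nhds x] fun y => Γ y w v := hs.mono fun y hy => hy v w
    rw [← h1, ← h1, h2.fderiv_eq]
  have h0 := hs.self_of_nhds
  simp only [curvOp]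
  rw [hd a b c, hd b c a, hd c a b, h0 b c, h0 a c, h0 b a]
  abel

/-- Mixed partials of `y ↦ B y c d` commute. Metric compatibility expands them into covariant
derivatives of the constant fields `c` and `d`; the products of first derivatives are symmetric in
the two directions, and what remains is the curvature. -/
theorem curvOp_antisymm_right {x : E} (hm : ∀ᶠ y in nhds x, IsMetricAt B Γ y)
    (hΓ : ContDiffAt ℝ ∞ Γ x) (hB : ContDiffAt ℝ ∞ B x) (a b c d : E) :
    B x (curvOp Γ x a b c) d + B x c (curvOp Γ x a b d) = 0 := by
  have hBn : ∀ᶠ y in nhds x, DifferentiableAt ℝ B y :=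
    ((hB.of_le (m := 1) (by simp)).eventually (by simp)).mono fun y hy =>
      hy.differentiableAt (by simp)
  have hid : ∀ y : E, ContDiffAt ℝ ∞ (fun x : E => x) y := fun y => contDiffAt_id
  have hc : ∀ (e y : E), ContDiffAt ℝ ∞ (fun _ : E => e) y := fun e y => contDiffAt_const
  have hcov : ∀ v e, ContDiffAt ℝ ∞ (covAlong Γ (fun x => x) v (fun _ => e)) x := fun v e =>
    ContDiffAt.covAlong hΓ (hid x) (hc e x) v
  have hF : ContDiffAt ℝ ∞ (fun y => B y c d) x :=
    (hB.clm_apply contDiffAt_const).clm_apply contDiffAt_const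
  have key : ∀ v w : E, fderiv ℝ (fun y => fderiv ℝ (fun y => B y c d) y w) x v =
      B x (covAlong Γ (fun x => x) v (covAlong Γ (fun x => x) w (fun _ => c)) x) d
      + B x (covAlong Γ (fun x => x) w (fun _ => c) x) (covAlong Γ (fun x => x) v (fun _ => d) x)
      + (B x (covAlong Γ (fun x => x) v (fun _ => c) x) (covAlong Γ (fun x => x) w (fun _ => d) x)
      + B x c (covAlong Γ (fun x => x) v (covAlong Γ (fun x => x) w (fun _ => d)) x)) := by
    intro v w
    have h1 : (fun y => fderiv ℝ (fun y => B y c d) y w) =ᶠ[nhds x] fun y =>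
        B y (covAlong Γ (fun x => x) w (fun _ => c) y) d
          + B y c (covAlong Γ (fun x => x) w (fun _ => d) y) := by
      filter_upwards [hm, hBn] with y hy hBy
      exact fderiv_metric_along (p := fun x => x) hBy hy
        differentiableAt_fun_id (differentiableAt_const c) (differentiableAt_const d) w
    have hBd := hB.differentiableAt_infty
    have hcd := fun v e => (hcov v e).differentiableAt_infty
    rw [h1.fderiv_eq, fderiv_fun_add
      ((hBd.clm_apply (hcd w c)).clm_apply (differentiableAt_const d))
      ((hBd.clm_apply (differentiableAt_const c)).clm_apply (hcd w d)),
      _root_.add_apply,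
      fderiv_metric_along (p := fun x => x) hBd hm.self_of_nhds differentiableAt_fun_id (hcd w c)
        (differentiableAt_const d),
      fderiv_metric_along (p := fun x => x) hBd hm.self_of_nhds differentiableAt_fun_id
        (differentiableAt_const c) (hcd w d)]
  have hsymm := hF.fderiv_fderiv_comm a b
  rw [key, key] at hsymm
  have hR : ∀ e, curvOp Γ x a b e =
      covAlong Γ (fun x => x) a (covAlong Γ (fun x => x) b (fun _ => e)) x
      - covAlong Γ (fun x => x) b (covAlong Γ (fun x => x) a (fun _ => e)) x := by
    intro e
    have := covAlong_covAlong_sub (p := fun x : E => x) (V := fun _ => e)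
      hΓ.differentiableAt_infty (hid x) (hc e x) a b
    simpa using this.symm
  rw [hR, hR]
  simp only [map_sub, _root_.sub_apply]
  linarith

/-- Symmetry of the Riemann tensor under exchange of the two pairs of arguments. -/
theorem curvOp_pair_symm {x : E} (hm : ∀ᶠ y in nhds x, IsMetricAt B Γ y)
    (hs : ∀ᶠ y in nhds x, ∀ a b, Γ y a b = Γ y b a) (hBs : ∀ a b, B x a b = B x b a)
    (hΓ : ContDiffAt ℝ ∞ Γ x) (hB : ContDiffAt ℝ ∞ B x) (a b c d : E) :
    B x (curvOp Γ x a b c) d = B x (curvOp Γ x c d a) b := by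
  have A := curvOp_antisymm_right hm hΓ hB
  have hb := fun u v w t => congrArg (fun e => B x e t)
    (curvOp_bianchi hs hΓ.differentiableAt_infty u v w)
  simp only [map_add, _root_.add_apply, map_zero, _root_.zero_apply] at hb
  have L : ∀ u v w t, B x (curvOp Γ x u v w) t = -B x (curvOp Γ x v u w) t := by
    intro u v w t
    rw [curvOp_antisymm_left]; simp
  have A' : ∀ u v w t, B x (curvOp Γ x u v w) t = -B x (curvOp Γ x u v t) w := by
    intro u v w t
    have := A u v w t
    rw [hBs w] at this
    linarith
  -- Octahedron argument: the Bianchi identities for the four cyclic shifts of `a, b, c, d`, reduced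
  -- by the two antisymmetries, combine linearly to the pair symmetry.
  have b1 := hb a b c d
  have b2 := hb b c d a
  have b3 := hb c d a b
  have b4 := hb d a b c
  have e1 := A' b c a d
  have e2 := A' c a b d
  have e3 := A' c d b a
  have e4 := A' d b c a
  have e5 := A' d a c b
  have e6 := A' a c d b
  have e7 := A' a b d c
  have e8 := A' b d a c
  have l1 := L c a d b
  have l2 := L d b a c
  have l3 := L d a b c
  have l4 := L b c d a
  have l5 := L d b c a
  have l6 := L c a b d
  linarith

end CovariantDerivativeAlong

/-! ## The Levi-Civita connection of a metric given by its components -/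

section MatrixSmooth

variable {Z : Type*} [NormedAddCommGroup Z] [NormedSpace ℝ Z] {n : ℕ}
  {A : Z → Matrix (Fin n) (Fin n) ℝ} {z : Z}

theorem ContDiffAt.matrix_det (hA : ∀ i j, ContDiffAt ℝ ∞ (fun x => A x i j) z) :
    ContDiffAt ℝ ∞ (fun x => (A x).det) z := by
  simp only [Matrix.det_apply]
  exact ContDiffAt.sum fun σ _ => (contDiffAt_prod fun i _ => hA _ _).const_smul _

theorem ContDiffAt.matrix_inv (hA : ∀ i j, ContDiffAt ℝ ∞ (fun x => A x i j) z)
    (hd : IsUnit (A z).det) (i j : Fin n) : ContDiffAt ℝ ∞ (fun x => (A x)⁻¹ i j) z := by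
  simp only [Matrix.inv_def, Matrix.smul_apply, Ring.inverse_eq_inv', smul_eq_mul]
  refine ((ContDiffAt.matrix_det hA).inv hd.ne_zero).mul ?_
  -- Cramer's rule: an entry of the adjugate is the determinant of the matrix with one row replaced
  -- by a constant one.
  simp only [Matrix.adjugate_apply]
  refine ContDiffAt.matrix_det fun k l => ?_
  by_cases h : k = j
  · simp only [h, Matrix.updateRow_self]; exact contDiffAt_const
  · simp only [Matrix.updateRow_ne h]; exact hA k l

end MatrixSmooth

theorem ContDiffAt.smul_const_real {Z F : Type*} [NormedAddCommGroup Z] [NormedSpace ℝ Z]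
    [NormedAddCommGroup F] [NormedSpace ℝ F] {f : Z → ℝ} {z : Z} (hf : ContDiffAt ℝ ∞ f z) (c : F) :
    ContDiffAt ℝ ∞ (fun x => f x • c) z := hf.smul contDiffAt_const

theorem fderiv_clm_apply_apply {Z E F : Type*} [NormedAddCommGroup Z] [NormedSpace ℝ Z]
    [NormedAddCommGroup E] [NormedSpace ℝ E] [NormedAddCommGroup F] [NormedSpace ℝ F]
    {A : Z → E →L[ℝ] E →L[ℝ] F} {z : Z} (hA : DifferentiableAt ℝ A z) (L : F →L[ℝ] ℝ) (v : Z)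
    (b c : E) : fderiv ℝ (fun y => L (A y b c)) z v = L (fderiv ℝ A z v b c) := by
  have h3 := (hA.hasFDerivAt.clm_apply (hasFDerivAt_const b z)).clm_apply (hasFDerivAt_const c z)
  have h5 := (L.hasFDerivAt.comp z h3).fderiv
  have h6 : (fun y => L (A y b c)) = L ∘ fun y => A y b c := rfl
  rw [h6, h5]
  simp

section LeviCivita

variable {d : ℕ} {G : EuclideanSpace ℝ (Fin d) → Matrix (Fin d) (Fin d) ℝ}
  {x : EuclideanSpace ℝ (Fin d)}

/-- Near `x`, the matrix `G` consists of smooth functions and is symmetric and invertible. -/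
def IsSmoothMetricAt (G : EuclideanSpace ℝ (Fin d) → Matrix (Fin d) (Fin d) ℝ)
    (x : EuclideanSpace ℝ (Fin d)) : Prop :=
  ∀ᶠ y in nhds x, (∀ i j, ContDiffAt ℝ ∞ (fun y' => G y' i j) y) ∧ (G y).IsSymm ∧
    IsUnit (G y).det

/-- The bilinear form with components `G`. -/
noncomputable def metricForm (G : EuclideanSpace ℝ (Fin d) → Matrix (Fin d) (Fin d) ℝ)
    (x : EuclideanSpace ℝ (Fin d)) :
    EuclideanSpace ℝ (Fin d) →L[ℝ] EuclideanSpace ℝ (Fin d) →L[ℝ] ℝ :=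
  ∑ i, ∑ j, G x i j • ((EuclideanSpace.proj i : EuclideanSpace ℝ (Fin d) →L[ℝ] ℝ).smulRight
    (EuclideanSpace.proj j : EuclideanSpace ℝ (Fin d) →L[ℝ] ℝ))

/-- The Christoffel symbols as a bilinear map. -/
noncomputable def christoffelMap (G : EuclideanSpace ℝ (Fin d) → Matrix (Fin d) (Fin d) ℝ)
    (x : EuclideanSpace ℝ (Fin d)) :
    EuclideanSpace ℝ (Fin d) →L[ℝ] EuclideanSpace ℝ (Fin d) →L[ℝ] EuclideanSpace ℝ (Fin d) :=
  ∑ k, ∑ i, ∑ j, christoffel G x k i j •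
    ((EuclideanSpace.proj i : EuclideanSpace ℝ (Fin d) →L[ℝ] ℝ).smulRight
      ((EuclideanSpace.proj j : EuclideanSpace ℝ (Fin d) →L[ℝ] ℝ).smulRight
        (EuclideanSpace.single k (1 : ℝ))))

theorem metricForm_apply (a b : EuclideanSpace ℝ (Fin d)) :
    metricForm G x a b = ∑ i, ∑ j, G x i j * a i * b j := by
  simp [metricForm, mul_assoc]

theorem christoffelMap_apply (a b : EuclideanSpace ℝ (Fin d)) (k : Fin d) :
    christoffelMap G x a b k = ∑ i, ∑ j, christoffel G x k i j * a i * b j := by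
  simp [christoffelMap, mul_assoc, Pi.single_apply]

theorem fderiv_apply_eq_sum_pd {F : Type*} [NormedAddCommGroup F] [NormedSpace ℝ F]
    (f : EuclideanSpace ℝ (Fin d) → F) (x a : EuclideanSpace ℝ (Fin d)) :
    fderiv ℝ f x a = ∑ i, a i • pd f i x := by
  have : a = ∑ i, a i • EuclideanSpace.single i (1 : ℝ) := by
    ext k; simp [Pi.single_apply]
  conv_lhs => rw [this]
  simp [pd, map_sum]

theorem contDiffAt_metricForm (hG : ∀ i j, ContDiffAt ℝ ∞ (fun y => G y i j) x) :
    ContDiffAt ℝ ∞ (metricForm G) x := by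
  unfold metricForm
  exact ContDiffAt.sum fun i _ => ContDiffAt.sum fun j _ => (hG i j).smul_const_real _

theorem contDiffAt_christoffel (hG : ∀ i j, ContDiffAt ℝ ∞ (fun y => G y i j) x)
    (hd : IsUnit (G x).det) (k i j : Fin d) :
    ContDiffAt ℝ ∞ (fun y => christoffel G y k i j) x := by
  unfold christoffel pd
  refine contDiffAt_const.mul (ContDiffAt.sum fun l _ => (ContDiffAt.matrix_inv hG hd k l).mul ?_)
  exact (((hG j l).fderiv_const_apply _).add ((hG i l).fderiv_const_apply _)).sub
    ((hG i j).fderiv_const_apply _)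

theorem contDiffAt_christoffelMap
    (hC : ∀ k i j, ContDiffAt ℝ ∞ (fun y => christoffel G y k i j) x) :
    ContDiffAt ℝ ∞ (christoffelMap G) x := by
  unfold christoffelMap
  exact ContDiffAt.sum fun k _ => ContDiffAt.sum fun i _ => ContDiffAt.sum fun j _ =>
    (hC k i j).smul_const_real _

theorem IsSmoothMetricAt.eventually (h : IsSmoothMetricAt G x) :
    ∀ᶠ y in nhds x, IsSmoothMetricAt G y := eventually_eventually_nhds.2 h

theorem IsSmoothMetricAt.pd_comm (h : IsSmoothMetricAt G x) (i j k : Fin d) :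
    pd (fun y => G y i j) k x = pd (fun y => G y j i) k x := by
  have : (fun y => G y i j) =ᶠ[nhds x] fun y => G y j i :=
    h.mono fun y hy => (hy.2.1.apply j i)
  rw [pd, this.fderiv_eq, pd]

theorem IsSmoothMetricAt.christoffel_comm (h : IsSmoothMetricAt G x) (k i j : Fin d) :
    christoffel G x k i j = christoffel G x k j i := by
  unfold christoffel
  congr 1
  refine Finset.sum_congr rfl fun l _ => ?_
  rw [h.pd_comm j i]; ring

/-- The Christoffel symbols of the first kind. -/
theorem IsSmoothMetricAt.sum_mul_christoffel (h : IsSmoothMetricAt G x) (m i j : Fin d) :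
    ∑ k, G x m k * christoffel G x k i j =
      (1 / 2) * (pd (fun y => G y j m) i x + pd (fun y => G y i m) j x
        - pd (fun y => G y i j) m x) := by
  have hinv : G x * (G x)⁻¹ = 1 := Matrix.mul_nonsing_inv _ h.self_of_nhds.2.2
  set c : Fin d → ℝ := fun l => (1 / 2) * (pd (fun y => G y j l) i x + pd (fun y => G y i l) j x
        - pd (fun y => G y i j) l x) with hc
  have h1 : ∀ k, christoffel G x k i j = ((G x)⁻¹.mulVec c) k := by
    intro k
    simp only [christoffel, Matrix.mulVec, dotProduct, hc, Finset.mul_sum]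
    exact Finset.sum_congr rfl fun l _ => by ring
  have h2 : ∑ k, G x m k * christoffel G x k i j = ((G x).mulVec ((G x)⁻¹.mulVec c)) m := by
    simp only [h1]; rfl
  rw [h2, Matrix.mulVec_mulVec, hinv, Matrix.one_mulVec]

theorem IsSmoothMetricAt.christoffelMap_comm (h : IsSmoothMetricAt G x)
    (a b : EuclideanSpace ℝ (Fin d)) : christoffelMap G x a b = christoffelMap G x b a := by
  ext k
  rw [christoffelMap_apply, christoffelMap_apply, Finset.sum_comm]
  refine Finset.sum_congr rfl fun i _ => Finset.sum_congr rfl fun j _ => ?_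
  rw [h.christoffel_comm]; ring

theorem IsSmoothMetricAt.metricForm_comm (h : IsSmoothMetricAt G x)
    (a b : EuclideanSpace ℝ (Fin d)) : metricForm G x a b = metricForm G x b a := by
  rw [metricForm_apply, metricForm_apply, Finset.sum_comm]
  refine Finset.sum_congr rfl fun i _ => Finset.sum_congr rfl fun j _ => ?_
  rw [h.self_of_nhds.2.1.apply i j]; ring

theorem fderiv_metricForm_apply (hG' : ∀ i j, ContDiffAt ℝ ∞ (fun y => G y i j) x)
    (a b c : EuclideanSpace ℝ (Fin d)) :
    fderiv ℝ (metricForm G) x a b c =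
      ∑ i, ∑ j, fderiv ℝ (fun y => G y i j) x a * b i * c j := by
  have hd : DifferentiableAt ℝ (metricForm G) x := by
    have hc := contDiffAt_metricForm hG'
    exact hc.differentiableAt_infty
  have h1 : fderiv ℝ (fun y => metricForm G y b c) x a = fderiv ℝ (metricForm G) x a b c :=
    fderiv_clm_apply_apply hd (ContinuousLinearMap.id ℝ ℝ) a b c
  rw [← h1]
  simp only [metricForm_apply]
  have hG := fun i j => (hG' i j).differentiableAt_infty
  have h2 : ∀ i j, DifferentiableAt ℝ (fun y => G y i j * b i * c j) x := fun i j =>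
    ((hG i j).mul_const _).mul_const _
  rw [fderiv_fun_sum fun i _ => DifferentiableAt.fun_sum fun j _ => h2 i j,
    _root_.sum_apply]
  refine Finset.sum_congr rfl fun i _ => ?_
  rw [fderiv_fun_sum fun j _ => h2 i j, _root_.sum_apply]
  refine Finset.sum_congr rfl fun j _ => ?_
  rw [fderiv_mul_const ((hG i j).mul_const _), fderiv_mul_const (hG i j)]
  simp only [_root_.smul_apply, smul_eq_mul]
  ring

theorem fderiv_christoffelMap_apply
    (hC' : ∀ k i j, ContDiffAt ℝ ∞ (fun y => christoffel G y k i j) x)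
    (a b c : EuclideanSpace ℝ (Fin d)) (k : Fin d) :
    fderiv ℝ (christoffelMap G) x a b c k =
      ∑ i, ∑ j, fderiv ℝ (fun y => christoffel G y k i j) x a * b i * c j := by
  have hd : DifferentiableAt ℝ (christoffelMap G) x := by
    have hc := contDiffAt_christoffelMap hC'
    exact hc.differentiableAt_infty
  have h1 : fderiv ℝ (fun y => christoffelMap G y b c k) x a =
      fderiv ℝ (christoffelMap G) x a b c k :=
    fderiv_clm_apply_apply hd (EuclideanSpace.proj k : EuclideanSpace ℝ (Fin d) →L[ℝ] ℝ) a b c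
  rw [← h1]
  simp only [christoffelMap_apply]
  have hC := fun k i j => (hC' k i j).differentiableAt_infty
  have h2 : ∀ i j, DifferentiableAt ℝ (fun y => christoffel G y k i j * b i * c j) x := fun i j =>
    ((hC k i j).mul_const _).mul_const _
  rw [fderiv_fun_sum fun i _ => DifferentiableAt.fun_sum fun j _ => h2 i j,
    _root_.sum_apply]
  refine Finset.sum_congr rfl fun i _ => ?_
  rw [fderiv_fun_sum fun j _ => h2 i j, _root_.sum_apply]
  refine Finset.sum_congr rfl fun j _ => ?_
  rw [fderiv_mul_const ((hC k i j).mul_const _), fderiv_mul_const (hC k i j)]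
  simp only [_root_.smul_apply, smul_eq_mul]
  ring

/-- After lowering the index, the two terms are Christoffel symbols of the first kind, and `Γ_{k,ij}
+ Γ_{j,ik} = ∂_i G_{jk}` because the other partial derivatives cancel in pairs. The `calc` chains
only permute summations. -/
theorem IsSmoothMetricAt.isMetricAt (h : IsSmoothMetricAt G x) :
    IsMetricAt (metricForm G) (christoffelMap G) x := by
  intro a b c
  have hG := h.self_of_nhds.1
  rw [fderiv_metricForm_apply hG, metricForm_apply,
    metricForm_apply]
  have e1 : ∑ i, ∑ j, G x i j * christoffelMap G x a b i * c j =
      ∑ i, ∑ j, ∑ k, (1 / 2) * (pd (fun y => G y j k) i x + pd (fun y => G y i k) j x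
        - pd (fun y => G y i j) k x) * (a i * b j * c k) := by
    have : ∀ i j k, (1 / 2) * (pd (fun y => G y j k) i x + pd (fun y => G y i k) j x
        - pd (fun y => G y i j) k x) = ∑ l, G x l k * christoffel G x l i j := by
      intro i j k
      rw [← h.sum_mul_christoffel k i j]
      exact Finset.sum_congr rfl fun l _ => by rw [h.self_of_nhds.2.1.apply l k]
    simp only [this, christoffelMap_apply, Finset.mul_sum, Finset.sum_mul]
    rw [Finset.sum_comm]
    calc _ = ∑ k, ∑ i, ∑ l, ∑ j, G x l k * (christoffel G x l i j * a i * b j) * c k :=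
          Finset.sum_congr rfl fun k _ => Finset.sum_comm
      _ = ∑ i, ∑ k, ∑ l, ∑ j, G x l k * (christoffel G x l i j * a i * b j) * c k :=
          Finset.sum_comm
      _ = ∑ i, ∑ k, ∑ j, ∑ l, G x l k * (christoffel G x l i j * a i * b j) * c k :=
          Finset.sum_congr rfl fun k _ => Finset.sum_congr rfl fun k _ => Finset.sum_comm
      _ = ∑ i, ∑ j, ∑ k, ∑ l, G x l k * (christoffel G x l i j * a i * b j) * c k :=
          Finset.sum_congr rfl fun k _ => Finset.sum_comm
      _ = _ := Finset.sum_congr rfl fun i _ => Finset.sum_congr rfl fun j _ =>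
          Finset.sum_congr rfl fun k _ => Finset.sum_congr rfl fun l _ => by ring
  have e2 : ∑ i, ∑ j, G x i j * b i * christoffelMap G x a c j =
      ∑ i, ∑ j, ∑ k, (1 / 2) * (pd (fun y => G y k j) i x + pd (fun y => G y i j) k x
        - pd (fun y => G y i k) j x) * (a i * b j * c k) := by
    have : ∀ i j k, (1 / 2) * (pd (fun y => G y k j) i x + pd (fun y => G y i j) k x
        - pd (fun y => G y i k) j x) = ∑ l, G x j l * christoffel G x l i k := by
      intro i j k
      rw [← h.sum_mul_christoffel j i k]
    simp only [this, christoffelMap_apply, Finset.mul_sum, Finset.sum_mul]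
    calc _ = ∑ j, ∑ i, ∑ l, ∑ k, G x j l * b j * (christoffel G x l i k * a i * c k) :=
          Finset.sum_congr rfl fun k _ => Finset.sum_comm
      _ = ∑ i, ∑ j, ∑ l, ∑ k, G x j l * b j * (christoffel G x l i k * a i * c k) :=
          Finset.sum_comm
      _ = ∑ i, ∑ j, ∑ k, ∑ l, G x j l * b j * (christoffel G x l i k * a i * c k) :=
          Finset.sum_congr rfl fun k _ => Finset.sum_congr rfl fun k _ => Finset.sum_comm
      _ = _ := Finset.sum_congr rfl fun i _ => Finset.sum_congr rfl fun j _ =>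
          Finset.sum_congr rfl fun k _ => Finset.sum_congr rfl fun l _ => by ring
  rw [e1, e2]
  simp only [fderiv_apply_eq_sum_pd, smul_eq_mul, Finset.sum_mul, ← Finset.sum_add_distrib]
  calc _ = ∑ j, ∑ i, ∑ k, a i * pd (fun y => G y j k) i x * b j * c k :=
          Finset.sum_congr rfl fun k _ => Finset.sum_comm
      _ = ∑ i, ∑ j, ∑ k, a i * pd (fun y => G y j k) i x * b j * c k := Finset.sum_comm
      _ = _ := Finset.sum_congr rfl fun i _ => Finset.sum_congr rfl fun j _ =>
          Finset.sum_congr rfl fun k _ => by rw [h.pd_comm k j i]; ring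

/-- Ties the operator `R(a, b) c` to the index convention of `riemannUp`: `c` fills the second slot,
`a` and `b` the last two. -/
theorem curvOp_christoffelMap_apply
    (hC' : ∀ k i j, ContDiffAt ℝ ∞ (fun y => christoffel G y k i j) x)
    (a b c : EuclideanSpace ℝ (Fin d)) (s : Fin d) :
    curvOp (christoffelMap G) x a b c s =
      ∑ m, ∑ n, ∑ r, riemannUp G x s r m n * a m * b n * c r := by
  simp only [curvOp, PiLp.add_apply, PiLp.sub_apply, fderiv_christoffelMap_apply hC',
    christoffelMap_apply, fderiv_apply_eq_sum_pd, smul_eq_mul, Finset.sum_mul, Finset.mul_sum,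
    riemannUp, add_mul, sub_mul, Finset.sum_add_distrib, Finset.sum_sub_distrib]
  have t1 : ∑ n, ∑ r, ∑ m, a m * pd (fun y => christoffel G y s n r) m x * b n * c r =
      ∑ m, ∑ n, ∑ r, pd (fun y => christoffel G y s n r) m x * a m * b n * c r := by
    rw [Finset.sum_congr rfl fun n _ => Finset.sum_comm, Finset.sum_comm]
    exact Finset.sum_congr rfl fun i _ => Finset.sum_congr rfl fun j _ =>
          Finset.sum_congr rfl fun k _ => by ring
  have t2 : ∑ m, ∑ r, ∑ n, b n * pd (fun y => christoffel G y s m r) n x * a m * c r =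
      ∑ m, ∑ n, ∑ r, pd (fun y => christoffel G y s m r) n x * a m * b n * c r := by
    rw [Finset.sum_congr rfl fun n _ => Finset.sum_comm]
    exact Finset.sum_congr rfl fun i _ => Finset.sum_congr rfl fun j _ =>
          Finset.sum_congr rfl fun k _ => by ring
  have t3 : ∑ m, ∑ l, ∑ n, ∑ r, christoffel G x s m l * a m * (christoffel G x l n r * b n * c r) =
      ∑ m, ∑ n, ∑ r, ∑ l, christoffel G x s m l * christoffel G x l n r * a m * b n * c r := by
    refine Finset.sum_congr rfl fun m _ => ?_
    rw [Finset.sum_comm]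
    refine Finset.sum_congr rfl fun n _ => ?_
    rw [Finset.sum_comm]
    exact Finset.sum_congr rfl fun i _ => Finset.sum_congr rfl fun j _ => by ring
  have t4 : ∑ n, ∑ l, ∑ m, ∑ r, christoffel G x s n l * b n * (christoffel G x l m r * a m * c r) =
      ∑ m, ∑ n, ∑ r, ∑ l, christoffel G x s n l * christoffel G x l m r * a m * b n * c r := by
    rw [Finset.sum_congr rfl fun n _ => Finset.sum_comm, Finset.sum_comm]
    refine Finset.sum_congr rfl fun m _ => Finset.sum_congr rfl fun n _ => ?_
    rw [Finset.sum_comm]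
    exact Finset.sum_congr rfl fun i _ => Finset.sum_congr rfl fun j _ => by ring
  rw [t1, t2, t3, t4]
  ring

end LeviCivita

/-! ### Components and traces of the curvature. -/

section CurvatureComponents

variable {d : ℕ} {G : EuclideanSpace ℝ (Fin d) → Matrix (Fin d) (Fin d) ℝ}
  {x : EuclideanSpace ℝ (Fin d)}

theorem IsSmoothMetricAt.contDiffAt_christoffel (h : IsSmoothMetricAt G x) (k i j : Fin d) :
    ContDiffAt ℝ ∞ (fun y => christoffel G y k i j) x :=
  _root_.contDiffAt_christoffel h.self_of_nhds.1 h.self_of_nhds.2.2 k i j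

theorem IsSmoothMetricAt.contDiffAt_christoffelMap (h : IsSmoothMetricAt G x) :
    ContDiffAt ℝ ∞ (christoffelMap G) x :=
  _root_.contDiffAt_christoffelMap h.contDiffAt_christoffel

theorem IsSmoothMetricAt.contDiffAt_metricForm (h : IsSmoothMetricAt G x) :
    ContDiffAt ℝ ∞ (metricForm G) x :=
  _root_.contDiffAt_metricForm h.self_of_nhds.1

theorem IsSmoothMetricAt.curvOp_antisymm_right (h : IsSmoothMetricAt G x)
    (a b c e : EuclideanSpace ℝ (Fin d)) :
    metricForm G x (curvOp (christoffelMap G) x a b c) e =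
      -metricForm G x (curvOp (christoffelMap G) x a b e) c := by
  have := _root_.curvOp_antisymm_right (h.eventually.mono fun _ hy => hy.isMetricAt)
    h.contDiffAt_christoffelMap h.contDiffAt_metricForm a b c e
  rw [h.metricForm_comm c] at this
  linarith

theorem IsSmoothMetricAt.curvOp_pair_symm (h : IsSmoothMetricAt G x)
    (a b c e : EuclideanSpace ℝ (Fin d)) :
    metricForm G x (curvOp (christoffelMap G) x a b c) e =
      metricForm G x (curvOp (christoffelMap G) x c e a) b :=
  _root_.curvOp_pair_symm (h.eventually.mono fun _ hy => hy.isMetricAt)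
    (h.eventually.mono fun _ hy => hy.christoffelMap_comm) h.metricForm_comm
    h.contDiffAt_christoffelMap h.contDiffAt_metricForm a b c e

theorem IsSmoothMetricAt.metricForm_curvOp (h : IsSmoothMetricAt G x)
    (a b c e : EuclideanSpace ℝ (Fin d)) :
    metricForm G x (curvOp (christoffelMap G) x a b c) e =
      ∑ s, ∑ r, ∑ m, ∑ n, riemannLow G x s r m n * e s * c r * a m * b n := by
  rw [h.metricForm_comm, metricForm_apply]
  refine Finset.sum_congr rfl fun s _ => ?_
  simp only [curvOp_christoffelMap_apply h.contDiffAt_christoffel, riemannLow, Finset.mul_sum,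
    Finset.sum_mul]
  calc _ = ∑ l, ∑ m, ∑ r, ∑ n, G x s l * e s * (riemannUp G x l r m n * a m * b n * c r) :=
        Finset.sum_congr rfl fun _ _ => Finset.sum_congr rfl fun _ _ => Finset.sum_comm
    _ = ∑ l, ∑ r, ∑ m, ∑ n, G x s l * e s * (riemannUp G x l r m n * a m * b n * c r) :=
        Finset.sum_congr rfl fun _ _ => Finset.sum_comm
    _ = ∑ r, ∑ l, ∑ m, ∑ n, G x s l * e s * (riemannUp G x l r m n * a m * b n * c r) :=
        Finset.sum_comm
    _ = ∑ r, ∑ m, ∑ l, ∑ n, G x s l * e s * (riemannUp G x l r m n * a m * b n * c r) :=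
        Finset.sum_congr rfl fun _ _ => Finset.sum_comm
    _ = ∑ r, ∑ m, ∑ n, ∑ l, G x s l * e s * (riemannUp G x l r m n * a m * b n * c r) :=
        Finset.sum_congr rfl fun _ _ => Finset.sum_congr rfl fun _ _ => Finset.sum_comm
    _ = _ := Finset.sum_congr rfl fun _ _ => Finset.sum_congr rfl fun _ _ =>
        Finset.sum_congr rfl fun _ _ => Finset.sum_congr rfl fun _ _ => by ring

/-- The Ricci contraction pairs the upper index with the slot of `a` in `R(a, b) c`, so it is the
trace of `a ↦ R(a, b) c`. In this form it can be evaluated in any basis, in particular in a null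
frame. -/
theorem sum_ricci_eq_trace (h : IsSmoothMetricAt G x) (b c : EuclideanSpace ℝ (Fin d)) :
    ∑ m, ∑ n, ricci G x m n * c m * b n =
      ∑ s, curvOp (christoffelMap G) x (EuclideanSpace.single s 1) b c s := by
  simp only [curvOp_christoffelMap_apply h.contDiffAt_christoffel, ricci, Finset.sum_mul]
  simp only [PiLp.single_apply, mul_ite, mul_one, mul_zero, ite_mul, zero_mul,
    Finset.sum_ite_irrel, Finset.sum_const_zero, Finset.sum_ite_eq', Finset.mem_univ, if_true]
  calc _ = ∑ m, ∑ s, ∑ n, riemannUp G x s m s n * c m * b n :=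
        Finset.sum_congr rfl fun _ _ => Finset.sum_comm
    _ = ∑ s, ∑ m, ∑ n, riemannUp G x s m s n * c m * b n := Finset.sum_comm
    _ = ∑ s, ∑ n, ∑ m, riemannUp G x s m s n * c m * b n :=
        Finset.sum_congr rfl fun _ _ => Finset.sum_comm
    _ = _ := Finset.sum_congr rfl fun _ _ => Finset.sum_congr rfl fun _ _ =>
        Finset.sum_congr rfl fun _ _ => by ring

theorem metricForm_nondegenerate (h : IsUnit (G x).det) {a : EuclideanSpace ℝ (Fin d)}
    (ha : ∀ b, metricForm G x a b = 0) : a = 0 := by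
  have h1 : Matrix.vecMul (WithLp.ofLp a) (G x) = 0 := by
    ext j
    have := ha (EuclideanSpace.single j 1)
    rw [metricForm_apply] at this
    simp only [PiLp.single_apply, mul_ite, mul_one, mul_zero, Finset.sum_ite_eq',
      Finset.mem_univ, if_true] at this
    simpa [Matrix.vecMul, dotProduct, mul_comm] using this
  have h2 : WithLp.ofLp a = 0 := by
    have h3 := congrArg (fun v => Matrix.vecMul v (G x)⁻¹) h1
    simpa [Matrix.vecMul_vecMul, Matrix.mul_nonsing_inv _ h] using h3
  ext i
  exact congrFun h2 i

end CurvatureComponents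

/-! ### Null frames adapted to the hypersurface. -/

section AdaptedFrame

variable {G : EuclideanSpace ℝ (Fin 4) → Matrix (Fin 4) (Fin 4) ℝ}
  {x : EuclideanSpace ℝ (Fin 4)}

/-- A frame `n, e₀, e₁, ℓ` at `x` adapted to a null hypersurface with rigging `ℓ`. -/
structure IsAdaptedFrame (G : EuclideanSpace ℝ (Fin 4) → Matrix (Fin 4) (Fin 4) ℝ)
    (x n l : EuclideanSpace ℝ (Fin 4)) (e : Fin 2 → EuclideanSpace ℝ (Fin 4))
    (q : Matrix (Fin 2) (Fin 2) ℝ) : Prop where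
  nn : metricForm G x n n = 0
  ne : ∀ i, metricForm G x n (e i) = 0
  ll : metricForm G x l l = 0
  ln : metricForm G x l n = 1
  le : ∀ i, metricForm G x l (e i) = 0
  ee : ∀ i j, metricForm G x (e i) (e j) = q i j
  det : IsUnit q.det

variable {n l : EuclideanSpace ℝ (Fin 4)} {e : Fin 2 → EuclideanSpace ℝ (Fin 4)}
  {q : Matrix (Fin 2) (Fin 2) ℝ}

/-- Pairing a linear relation with `ℓ` isolates the coefficient of `n`, and pairing with `n` that of
`ℓ`. Pairing with the `e i` then leaves `q` applied to the other two coefficients, and `q` is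
invertible. -/
theorem IsAdaptedFrame.linearIndependent (hF : IsAdaptedFrame G x n l e q)
    (h : IsSmoothMetricAt G x) : LinearIndependent ℝ ![n, l, e 0, e 1] := by
  rw [Fintype.linearIndependent_iff]
  intro c hc
  simp only [Fin.sum_univ_four, Matrix.cons_val_zero, Matrix.cons_val_one, Matrix.cons_val] at hc
  have hp := fun b => congrArg (fun a => metricForm G x b a) hc
  simp only [map_add, map_smul, map_zero, smul_eq_mul] at hp
  have nl : metricForm G x n l = 1 := by rw [h.metricForm_comm, hF.ln]
  have c0 := hp l
  simp only [hF.ln, hF.ll, hF.le] at c0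
  have c1 := hp n
  simp only [hF.nn, hF.ne, nl] at c1
  have h0 : c 0 = 0 := by linarith
  have h1 : c 1 = 0 := by linarith
  have hq : q.mulVec ![c 2, c 3] = 0 := by
    ext i
    have := hp (e i)
    rw [h0, h1] at this
    simp only [hF.ee] at this
    simp only [Matrix.mulVec, dotProduct, Fin.sum_univ_two, Matrix.cons_val_zero,
      Matrix.cons_val_one, Pi.zero_apply]
    linarith
  have hz := congrArg (fun v => q⁻¹.mulVec v) hq
  simp only [Matrix.mulVec_mulVec, Matrix.nonsing_inv_mul _ hF.det, Matrix.one_mulVec,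
    Matrix.mulVec_zero] at hz
  have h2 : c 2 = 0 := congrFun hz 0
  have h3 : c 3 = 0 := congrFun hz 1
  intro i
  fin_cases i <;> assumption

theorem IsAdaptedFrame.eq_zero (hF : IsAdaptedFrame G x n l e q) (h : IsSmoothMetricAt G x)
    {a : EuclideanSpace ℝ (Fin 4)} (hn : metricForm G x n a = 0) (hl : metricForm G x l a = 0)
    (he : ∀ i, metricForm G x (e i) a = 0) : a = 0 := by
  let b := basisOfLinearIndependentOfCardEqFinrank (hF.linearIndependent h) (by simp)
  have hb : ⇑b = ![n, l, e 0, e 1] := coe_basisOfLinearIndependentOfCardEqFinrank _ _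
  have h0 : (metricForm G x a).toLinearMap = 0 := by
    refine b.ext fun i => ?_
    rw [hb]
    fin_cases i
    · simpa [h.metricForm_comm a] using hn
    · simpa [h.metricForm_comm a] using hl
    · simpa [h.metricForm_comm a] using he 0
    · simpa [h.metricForm_comm a] using he 1
  exact metricForm_nondegenerate h.self_of_nhds.2.2 fun c => by
    simpa using congrArg (fun f => f c) h0

/-- `n` and `ℓ` are dual to each other, so each reads off the coefficient of the other. Both sides
then have equal products with the whole frame. -/
theorem IsAdaptedFrame.expansion (hF : IsAdaptedFrame G x n l e q) (h : IsSmoothMetricAt G x)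
    (a : EuclideanSpace ℝ (Fin 4)) :
    a = metricForm G x l a • n + metricForm G x n a • l
      + ∑ i, (∑ j, q⁻¹ i j * metricForm G x (e j) a) • e i := by
  have nl : metricForm G x n l = 1 := by rw [h.metricForm_comm, hF.ln]
  have el : ∀ i, metricForm G x (e i) l = 0 := fun i => by rw [h.metricForm_comm, hF.le]
  have en : ∀ i, metricForm G x (e i) n = 0 := fun i => by rw [h.metricForm_comm, hF.ne]
  rw [← sub_eq_zero]
  refine hF.eq_zero h ?_ ?_ fun k => ?_
  · simp [map_sub, map_add, hF.nn, hF.ne, nl]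
  · simp [map_sub, map_add, hF.ln, hF.ll, hF.le]
  · simp only [map_sub, map_add, map_sum, map_smul, hF.ee, el, en, smul_eq_mul, mul_zero, zero_add]
    have h1 : q.mulVec (q⁻¹.mulVec fun j => metricForm G x (e j) a) k = metricForm G x (e k) a := by
      rw [Matrix.mulVec_mulVec, Matrix.mul_nonsing_inv _ hF.det, Matrix.one_mulVec]
    rw [← h1]
    simp only [Matrix.mulVec, dotProduct]
    rw [sub_eq_zero]
    exact Finset.sum_congr rfl fun i _ => mul_comm _ _

theorem IsAdaptedFrame.sum_apply_single (hF : IsAdaptedFrame G x n l e q)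
    (h : IsSmoothMetricAt G x) (T : EuclideanSpace ℝ (Fin 4) →ₗ[ℝ] EuclideanSpace ℝ (Fin 4)) :
    ∑ s, T (EuclideanSpace.single s 1) s =
      metricForm G x l (T n) + metricForm G x n (T l)
        + ∑ i, ∑ j, q⁻¹ i j * metricForm G x (e j) (T (e i)) := by
  have key : ∀ u v : EuclideanSpace ℝ (Fin 4),
      ∑ s, metricForm G x u (EuclideanSpace.single s 1) * v s = metricForm G x u v := by
    intro u v
    have : v = ∑ i, v i • EuclideanSpace.single i (1 : ℝ) := by
      ext k; simp [Pi.single_apply]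
    conv_rhs => rw [this]
    simp [map_sum, mul_comm]
  have h1 : ∀ s, T (EuclideanSpace.single s 1) s =
      metricForm G x l (EuclideanSpace.single s 1) * T n s
      + metricForm G x n (EuclideanSpace.single s 1) * T l s
      + ∑ i, ∑ j, q⁻¹ i j * (metricForm G x (e j) (EuclideanSpace.single s 1) * T (e i) s) := by
    intro s
    conv_lhs => rw [hF.expansion h (EuclideanSpace.single s 1)]
    simp [map_add]
    ring
  simp only [h1, Finset.sum_add_distrib, key]
  congr 1
  rw [Finset.sum_comm]
  refine Finset.sum_congr rfl fun i _ => ?_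
  rw [Finset.sum_comm]
  refine Finset.sum_congr rfl fun j _ => ?_
  rw [← Finset.mul_sum, key]

/-- The operator `a ↦ R(a, b) c`. -/
noncomputable def curvLin (G : EuclideanSpace ℝ (Fin 4) → Matrix (Fin 4) (Fin 4) ℝ)
    (x b c : EuclideanSpace ℝ (Fin 4)) :
    EuclideanSpace ℝ (Fin 4) →ₗ[ℝ] EuclideanSpace ℝ (Fin 4) where
  toFun a := curvOp (christoffelMap G) x a b c
  map_add' a a' := by simp only [curvOp, map_add, _root_.add_apply]; abel
  map_smul' r a := by
    simp only [curvOp, map_smul, _root_.smul_apply, RingHom.id_apply, smul_sub, smul_add]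

/-- Each Ricci equation on the horizon is evaluated through this null-frame trace, with `b` and `c`
chosen among `n`, `e_i`, `ℓ`. -/
theorem IsAdaptedFrame.ricci_eq (hF : IsAdaptedFrame G x n l e q) (h : IsSmoothMetricAt G x)
    (b c : EuclideanSpace ℝ (Fin 4)) :
    ∑ m, ∑ k, ricci G x m k * c m * b k =
      metricForm G x l (curvOp (christoffelMap G) x n b c)
        + metricForm G x n (curvOp (christoffelMap G) x l b c)
        + ∑ i, ∑ j, q⁻¹ i j * metricForm G x (e j) (curvOp (christoffelMap G) x (e i) b c) := by
  rw [sum_ricci_eq_trace h]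
  exact hF.sum_apply_single h (curvLin G x b c)

end AdaptedFrame

/-! ## Structure equations of a rigged null hypersurface -/

/-- The coordinate direction of the null normal. -/
noncomputable def nDir : ℝ × EuclideanSpace ℝ (Fin 2) := (1, 0)

/-- The coordinate directions of the sections. -/
noncomputable def eDir (i : Fin 2) : ℝ × EuclideanSpace ℝ (Fin 2) := (0, EuclideanSpace.single i 1)

theorem pd_slice {F : Type*} [NormedAddCommGroup F] [NormedSpace ℝ F]
    {f : ℝ × EuclideanSpace ℝ (Fin 2) → F} {z : ℝ × EuclideanSpace ℝ (Fin 2)}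
    (hf : DifferentiableAt ℝ f z) (i : Fin 2) :
    pd (fun y => f (z.1, y)) i z.2 = fderiv ℝ f z (eDir i) := by
  have h1 : HasFDerivAt (fun y : EuclideanSpace ℝ (Fin 2) => (z.1, y))
      (ContinuousLinearMap.inr ℝ ℝ (EuclideanSpace ℝ (Fin 2))) z.2 := hasFDerivAt_prodMk_right z.1 z.2
  have h2 := (HasFDerivAt.comp (g := f) z.2 (by exact hf.hasFDerivAt) h1).fderiv
  have h3 : (fun y => f (z.1, y)) = f ∘ fun y => (z.1, y) := rfl
  rw [pd, h3, h2]
  simp [eDir]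

theorem deriv_slice {f : ℝ × EuclideanSpace ℝ (Fin 2) → ℝ} {z : ℝ × EuclideanSpace ℝ (Fin 2)}
    (hf : DifferentiableAt ℝ f z) :
    HasDerivAt (fun t => f (t, z.2)) (fderiv ℝ f z nDir) z.1 := by
  have h1 : HasFDerivAt (fun t : ℝ => (t, z.2))
      (ContinuousLinearMap.inl ℝ ℝ (EuclideanSpace ℝ (Fin 2))) z.1 := hasFDerivAt_prodMk_left z.1 z.2
  have h2 := (HasFDerivAt.comp (g := f) z.1 (by exact hf.hasFDerivAt) h1).hasDerivAt
  have h3 : HasDerivAt (fun t => f (t, z.2)) _ z.1 := h2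
  convert h3 using 1
  simp [nDir]

section RiggedMap

variable (G : EuclideanSpace ℝ (Fin 4) → Matrix (Fin 4) (Fin 4) ℝ)
  (p L : ℝ × EuclideanSpace ℝ (Fin 2) → EuclideanSpace ℝ (Fin 4))

/-- The tensor `g(∇_v ℓ, w)` on the hypersurface. -/
noncomputable def rigY (z v w : ℝ × EuclideanSpace ℝ (Fin 2)) : ℝ :=
  metricForm G (p z) (covAlong (christoffelMap G) p v L z) (fderiv ℝ p z w)

/-- At `z`, the map `p` parametrises a null hypersurface with rigging `L`, section metric `q`,
surface gravity `κ`, Hajicek one-form `Om` and transverse connection `Xi`. -/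
structure IsRiggedAt (q : ℝ × EuclideanSpace ℝ (Fin 2) → Matrix (Fin 2) (Fin 2) ℝ)
    (κ : ℝ × EuclideanSpace ℝ (Fin 2) → ℝ)
    (Om : ℝ × EuclideanSpace ℝ (Fin 2) → Fin 2 → ℝ)
    (Xi : ℝ × EuclideanSpace ℝ (Fin 2) → Fin 2 → Fin 2 → ℝ)
    (z : ℝ × EuclideanSpace ℝ (Fin 2)) : Prop where
  metric : IsSmoothMetricAt G (p z)
  map_smooth : ContDiffAt ℝ ∞ p z
  rig_smooth : ContDiffAt ℝ ∞ L z
  frame : IsAdaptedFrame G (p z) (fderiv ℝ p z nDir) (L z) (fun i => fderiv ℝ p z (eDir i)) (q z)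
  kappa_eq : κ z = -rigY G p L z nDir nDir
  Om_eq : ∀ i, Om z i = -rigY G p L z nDir (eDir i)
  Xi_eq : ∀ i j, Xi z i j = rigY G p L z (eDir i) (eDir j)

variable {G p L}
variable {q : ℝ × EuclideanSpace ℝ (Fin 2) → Matrix (Fin 2) (Fin 2) ℝ}
    {κ : ℝ × EuclideanSpace ℝ (Fin 2) → ℝ}
    {Om : ℝ × EuclideanSpace ℝ (Fin 2) → Fin 2 → ℝ}
    {Xi : ℝ × EuclideanSpace ℝ (Fin 2) → Fin 2 → Fin 2 → ℝ}
    {z : ℝ × EuclideanSpace ℝ (Fin 2)}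

theorem IsRiggedAt.fderiv_form (h : IsRiggedAt G p L q κ Om Xi z)
    {V W : ℝ × EuclideanSpace ℝ (Fin 2) → EuclideanSpace ℝ (Fin 4)}
    (hV : ContDiffAt ℝ ∞ V z) (hW : ContDiffAt ℝ ∞ W z) (v : ℝ × EuclideanSpace ℝ (Fin 2)) :
    fderiv ℝ (fun x => metricForm G (p x) (V x) (W x)) z v =
      metricForm G (p z) (covAlong (christoffelMap G) p v V z) (W z)
        + metricForm G (p z) (V z) (covAlong (christoffelMap G) p v W z) :=
  fderiv_metric_along h.metric.contDiffAt_metricForm.differentiableAt_infty h.metric.isMetricAt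
    h.map_smooth.differentiableAt_infty hV.differentiableAt_infty hW.differentiableAt_infty v

theorem IsRiggedAt.tangent_smooth (h : IsRiggedAt G p L q κ Om Xi z)
    (v : ℝ × EuclideanSpace ℝ (Fin 2)) : ContDiffAt ℝ ∞ (fun x => fderiv ℝ p x v) z :=
  h.map_smooth.fderiv_const_apply v

theorem IsRiggedAt.cov_comm (h : IsRiggedAt G p L q κ Om Xi z)
    (v w : ℝ × EuclideanSpace ℝ (Fin 2)) :
    covAlong (christoffelMap G) p v (fun x => fderiv ℝ p x w) z =
      covAlong (christoffelMap G) p w (fun x => fderiv ℝ p x v) z :=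
  covAlong_tangent_comm h.metric.christoffelMap_comm h.map_smooth v w

theorem IsRiggedAt.cov_smooth (h : IsRiggedAt G p L q κ Om Xi z)
    {V : ℝ × EuclideanSpace ℝ (Fin 2) → EuclideanSpace ℝ (Fin 4)} (hV : ContDiffAt ℝ ∞ V z)
    (v : ℝ × EuclideanSpace ℝ (Fin 2)) : ContDiffAt ℝ ∞ (covAlong (christoffelMap G) p v V) z :=
  ContDiffAt.covAlong h.metric.contDiffAt_christoffelMap h.map_smooth hV v

theorem IsRiggedAt.form_smooth (h : IsRiggedAt G p L q κ Om Xi z)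
    {V W : ℝ × EuclideanSpace ℝ (Fin 2) → EuclideanSpace ℝ (Fin 4)}
    (hV : ContDiffAt ℝ ∞ V z) (hW : ContDiffAt ℝ ∞ W z) :
    ContDiffAt ℝ ∞ (fun x => metricForm G (p x) (V x) (W x)) z :=
  ((h.metric.contDiffAt_metricForm.comp z h.map_smooth).clm_apply hV).clm_apply hW

theorem IsRiggedAt.rigY_smooth (h : IsRiggedAt G p L q κ Om Xi z)
    (v w : ℝ × EuclideanSpace ℝ (Fin 2)) : ContDiffAt ℝ ∞ (fun x => rigY G p L x v w) z :=
  h.form_smooth (h.cov_smooth h.rig_smooth v) (h.tangent_smooth w)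

variable (hev : ∀ᶠ x in nhds z, IsRiggedAt G p L q κ Om Xi x)
include hev

theorem rigged_q_smooth (i j : Fin 2) : ContDiffAt ℝ ∞ (fun x => q x i j) z :=
  (hev.self_of_nhds.form_smooth (hev.self_of_nhds.tangent_smooth (eDir i))
    (hev.self_of_nhds.tangent_smooth (eDir j))).congr_of_eventuallyEq
    (hev.mono fun _ hx => (hx.frame.ee i j).symm)

theorem rigged_Om_smooth (i : Fin 2) : ContDiffAt ℝ ∞ (fun x => Om x i) z :=
  (hev.self_of_nhds.rigY_smooth nDir (eDir i)).neg.congr_of_eventuallyEq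
    (hev.mono fun _ hx => hx.Om_eq i)

theorem rigged_kappa_smooth : ContDiffAt ℝ ∞ κ z :=
  (hev.self_of_nhds.rigY_smooth nDir nDir).neg.congr_of_eventuallyEq
    (hev.mono fun _ hx => hx.kappa_eq)

theorem rigged_Xi_smooth (i j : Fin 2) : ContDiffAt ℝ ∞ (fun x => Xi x i j) z :=
  (hev.self_of_nhds.rigY_smooth (eDir i) (eDir j)).congr_of_eventuallyEq
    (hev.mono fun _ hx => hx.Xi_eq i j)

theorem rigged_form_const {V W : ℝ × EuclideanSpace ℝ (Fin 2) → EuclideanSpace ℝ (Fin 4)}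
    (hV : ContDiffAt ℝ ∞ V z) (hW : ContDiffAt ℝ ∞ W z) {c : ℝ}
    (hc : ∀ x, IsRiggedAt G p L q κ Om Xi x → metricForm G (p x) (V x) (W x) = c)
    (v : ℝ × EuclideanSpace ℝ (Fin 2)) :
    metricForm G (p z) (covAlong (christoffelMap G) p v V z) (W z) =
      -metricForm G (p z) (V z) (covAlong (christoffelMap G) p v W z) := by
  have h1 := hev.self_of_nhds.fderiv_form hV hW v
  have h2 : (fun x => metricForm G (p x) (V x) (W x)) =ᶠ[nhds z] fun _ => c :=
    hev.mono fun x hx => hc x hx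
  rw [h2.fderiv_eq] at h1
  simp only [fderiv_fun_const, Pi.zero_apply, _root_.zero_apply] at h1
  linarith

/-- The products of `ℓ` with the coordinate fields are constant, `1` for `n` and `0` for `e_i`, so
the derivative moves from the coordinate field to `ℓ` with a sign. -/
theorem rigged_rig_cov (v w : ℝ × EuclideanSpace ℝ (Fin 2)) (hw : w = nDir ∨ ∃ i, w = eDir i) :
    metricForm G (p z) (L z) (covAlong (christoffelMap G) p v (fun x => fderiv ℝ p x w) z) =
      -rigY G p L z v w := by
  have h := hev.self_of_nhds
  rw [rigY]
  rcases hw with rfl | ⟨i, rfl⟩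
  · rw [rigged_form_const hev h.rig_smooth (h.tangent_smooth nDir) (fun x hx => hx.frame.ln) v,
      neg_neg]
  · rw [rigged_form_const hev h.rig_smooth (h.tangent_smooth (eDir i)) (fun x hx => hx.frame.le i) v,
      neg_neg]

/-- Torsion-freeness paired with `ℓ`. Hence `g(∇_v ℓ, w)` is already symmetric on these directions
and agrees there with `½ ℒ_ℓ g`. -/
theorem rigged_rigY_comm (v w : ℝ × EuclideanSpace ℝ (Fin 2)) (hv : v = nDir ∨ ∃ i, v = eDir i)
    (hw : w = nDir ∨ ∃ i, w = eDir i) : rigY G p L z v w = rigY G p L z w v := by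
  have h1 := rigged_rig_cov hev v w hw
  have h2 := rigged_rig_cov hev w v hv
  rw [hev.self_of_nhds.cov_comm] at h1
  linarith

theorem rigged_n_cov_n (v : ℝ × EuclideanSpace ℝ (Fin 2)) :
    metricForm G (p z) (fderiv ℝ p z nDir)
      (covAlong (christoffelMap G) p v (fun x => fderiv ℝ p x nDir) z) = 0 := by
  have h := hev.self_of_nhds
  have := rigged_form_const hev (h.tangent_smooth nDir) (h.tangent_smooth nDir)
    (fun x hx => hx.frame.nn) v
  rw [h.metric.metricForm_comm] at this
  linarith

theorem rigged_n_cov_e (v : ℝ × EuclideanSpace ℝ (Fin 2)) (i : Fin 2) :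
    metricForm G (p z) (fderiv ℝ p z nDir)
      (covAlong (christoffelMap G) p v (fun x => fderiv ℝ p x (eDir i)) z) =
    -metricForm G (p z) (fderiv ℝ p z (eDir i))
      (covAlong (christoffelMap G) p v (fun x => fderiv ℝ p x nDir) z) := by
  have h := hev.self_of_nhds
  have := rigged_form_const hev (h.tangent_smooth nDir) (h.tangent_smooth (eDir i))
    (fun x hx => hx.frame.ne i) v
  rw [h.metric.metricForm_comm] at this
  linarith

/-- `∇_n n = κ n`. -/
theorem rigged_cov_n_n :
    covAlong (christoffelMap G) p nDir (fun x => fderiv ℝ p x nDir) z = κ z • fderiv ℝ p z nDir := by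
  have h := hev.self_of_nhds
  rw [h.frame.expansion h.metric (covAlong _ _ _ _ _)]
  -- The generators are pregeodesic: `g(e_i, ∇_n n) = -g(n, ∇_n e_i) = -g(n, ∇_{e_i} n) = 0`, since
  -- `n` is null on the whole hypersurface near `z`.
  have e : ∀ i, metricForm G (p z) (fderiv ℝ p z (eDir i))
      (covAlong (christoffelMap G) p nDir (fun x => fderiv ℝ p x nDir) z) = 0 := by
    intro i
    have h1 := rigged_n_cov_e hev nDir i
    rw [h.cov_comm, rigged_n_cov_n hev] at h1
    linarith
  simp only [e, rigged_n_cov_n hev, rigged_rig_cov hev nDir nDir (Or.inl rfl), h.kappa_eq]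
  simp

/-- The second fundamental form is `½ ∂_n q`. -/
theorem rigged_secondFF (i j : Fin 2) :
    metricForm G (p z) (fderiv ℝ p z (eDir i))
      (covAlong (christoffelMap G) p (eDir j) (fun x => fderiv ℝ p x nDir) z) =
    (1 / 2) * fderiv ℝ (fun x => q x i j) z nDir := by
  have h := hev.self_of_nhds
  have h1 := h.fderiv_form (h.tangent_smooth (eDir i)) (h.tangent_smooth (eDir j)) nDir
  have h2 : (fun x => metricForm G (p x) (fderiv ℝ p x (eDir i)) (fderiv ℝ p x (eDir j)))
      =ᶠ[nhds z] fun x => q x i j := hev.mono fun x hx => hx.frame.ee i j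
  rw [h2.fderiv_eq, h.cov_comm nDir (eDir i), h.cov_comm nDir (eDir j), h.metric.metricForm_comm]
    at h1
  have h3 := rigged_n_cov_e hev (eDir j) i
  have h4 := rigged_n_cov_e hev (eDir i) j
  rw [h.cov_comm] at h3
  linarith

/-- `∇_{e_i} n = Ω_i n + Θ_i^j e_j`. -/
theorem rigged_cov_e_n (i : Fin 2) :
    covAlong (christoffelMap G) p (eDir i) (fun x => fderiv ℝ p x nDir) z =
      Om z i • fderiv ℝ p z nDir + ∑ j, (∑ k, (q z)⁻¹ j k *
        ((1 / 2) * fderiv ℝ (fun x => q x k i) z nDir)) • fderiv ℝ p z (eDir j) := by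
  have h := hev.self_of_nhds
  rw [h.frame.expansion h.metric (covAlong _ _ _ _ _)]
  simp only [rigged_secondFF hev, rigged_n_cov_n hev,
    rigged_rig_cov hev (eDir i) nDir (Or.inl rfl), h.Om_eq,
    rigged_rigY_comm hev nDir (eDir i) (Or.inl rfl) (Or.inr ⟨i, rfl⟩)]
  simp

/-- The Gauss formula `∇_{e_i} e_j = Γ^k_{ij} e_k - Ξ_{ij} n` of a section, if `Θ = 0`. -/
theorem rigged_cov_e_e (hΘ : ∀ i j, fderiv ℝ (fun x => q x i j) z nDir = 0) (i j : Fin 2) :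
    covAlong (christoffelMap G) p (eDir i) (fun x => fderiv ℝ p x (eDir j)) z =
      (-Xi z i j) • fderiv ℝ p z nDir
        + ∑ k, christoffel (fun y => q (z.1, y)) z.2 k i j • fderiv ℝ p z (eDir k) := by
  have h := hev.self_of_nhds
  have h0 : metricForm G (p z) (fderiv ℝ p z nDir)
      (covAlong (christoffelMap G) p (eDir i) (fun x => fderiv ℝ p x (eDir j)) z) = 0 := by
    rw [rigged_n_cov_e hev, rigged_secondFF hev, hΘ]; simp
  have hq : ∀ a b c, fderiv ℝ (fun x => q x b c) z (eDir a) =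
      metricForm G (p z) (fderiv ℝ p z (eDir c))
        (covAlong (christoffelMap G) p (eDir a) (fun x => fderiv ℝ p x (eDir b)) z)
      + metricForm G (p z) (fderiv ℝ p z (eDir b))
        (covAlong (christoffelMap G) p (eDir a) (fun x => fderiv ℝ p x (eDir c)) z) := by
    intro a b c
    have h1 := h.fderiv_form (h.tangent_smooth (eDir b)) (h.tangent_smooth (eDir c)) (eDir a)
    have h2 : (fun x => metricForm G (p x) (fderiv ℝ p x (eDir b)) (fderiv ℝ p x (eDir c)))
        =ᶠ[nhds z] fun x => q x b c := hev.mono fun x hx => hx.frame.ee b c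
    rw [h2.fderiv_eq, h.metric.metricForm_comm] at h1
    exact h1
  -- Koszul's formula for the pulled-back metric, obtained from three tangential derivatives of `q`
  -- and torsion-freeness.
  have he : ∀ l, metricForm G (p z) (fderiv ℝ p z (eDir l))
        (covAlong (christoffelMap G) p (eDir i) (fun x => fderiv ℝ p x (eDir j)) z) =
      (1 / 2) * (pd (fun y => q (z.1, y) j l) i z.2 + pd (fun y => q (z.1, y) i l) j z.2
        - pd (fun y => q (z.1, y) i j) l z.2) := by
    intro l
    have hs := fun a b => (rigged_q_smooth hev a b).differentiableAt_infty
    rw [pd_slice (hs j l), pd_slice (hs i l), pd_slice (hs i j), hq, hq, hq,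
      h.cov_comm (eDir j) (eDir i), h.cov_comm (eDir l) (eDir i), h.cov_comm (eDir l) (eDir j)]
    ring
  rw [h.frame.expansion h.metric (covAlong _ _ _ _ _)]
  simp only [h0, he, rigged_rig_cov hev (eDir i) (eDir j) (Or.inr ⟨j, rfl⟩), h.Xi_eq, christoffel,
    zero_smul, add_zero, Finset.mul_sum]
  congr 1
  refine Finset.sum_congr rfl fun k _ => ?_
  congr 1
  exact Finset.sum_congr rfl fun l _ => by ring

end RiggedMap

/-! ### Curvature along the hypersurface and Raychaudhuri's equation. -/

section RiggedCurvature

variable {G : EuclideanSpace ℝ (Fin 4) → Matrix (Fin 4) (Fin 4) ℝ}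
  {p L : ℝ × EuclideanSpace ℝ (Fin 2) → EuclideanSpace ℝ (Fin 4)}
  {q : ℝ × EuclideanSpace ℝ (Fin 2) → Matrix (Fin 2) (Fin 2) ℝ}
  {κ : ℝ × EuclideanSpace ℝ (Fin 2) → ℝ}
  {Om : ℝ × EuclideanSpace ℝ (Fin 2) → Fin 2 → ℝ}
  {Xi : ℝ × EuclideanSpace ℝ (Fin 2) → Fin 2 → Fin 2 → ℝ}
  {z : ℝ × EuclideanSpace ℝ (Fin 2)}

theorem IsRiggedAt.curvature (h : IsRiggedAt G p L q κ Om Xi z)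
    {V : ℝ × EuclideanSpace ℝ (Fin 2) → EuclideanSpace ℝ (Fin 4)} (hV : ContDiffAt ℝ ∞ V z)
    (v w : ℝ × EuclideanSpace ℝ (Fin 2)) :
    curvOp (christoffelMap G) (p z) (fderiv ℝ p z v) (fderiv ℝ p z w) (V z) =
      covAlong (christoffelMap G) p v (covAlong (christoffelMap G) p w V) z
        - covAlong (christoffelMap G) p w (covAlong (christoffelMap G) p v V) z := by
  have h1 := h.metric.contDiffAt_christoffelMap
  have h2 : DifferentiableAt ℝ (christoffelMap G) (p z) := h1.differentiableAt_infty
  rw [covAlong_covAlong_sub h2 h.map_smooth hV v w]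

theorem IsRiggedAt.cov_smul (h : IsRiggedAt G p L q κ Om Xi z)
    {f : ℝ × EuclideanSpace ℝ (Fin 2) → ℝ} (hf : ContDiffAt ℝ ∞ f z)
    (u v : ℝ × EuclideanSpace ℝ (Fin 2)) :
    covAlong (christoffelMap G) p v (fun x => f x • fderiv ℝ p x u) z =
      fderiv ℝ f z v • fderiv ℝ p z u
        + f z • covAlong (christoffelMap G) p v (fun x => fderiv ℝ p x u) z :=
  covAlong_smul hf.differentiableAt_infty (h.tangent_smooth u).differentiableAt_infty v

theorem IsRiggedAt.cov_comb (h : IsRiggedAt G p L q κ Om Xi z)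
    {a b c : ℝ × EuclideanSpace ℝ (Fin 2) → ℝ} (ha : ContDiffAt ℝ ∞ a z)
    (hb : ContDiffAt ℝ ∞ b z) (hc : ContDiffAt ℝ ∞ c z) (v : ℝ × EuclideanSpace ℝ (Fin 2)) :
    covAlong (christoffelMap G) p v (fun x => a x • fderiv ℝ p x nDir
        + (b x • fderiv ℝ p x (eDir 0) + c x • fderiv ℝ p x (eDir 1))) z =
      (fderiv ℝ a z v • fderiv ℝ p z nDir
        + a z • covAlong (christoffelMap G) p v (fun x => fderiv ℝ p x nDir) z)
      + ((fderiv ℝ b z v • fderiv ℝ p z (eDir 0)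
        + b z • covAlong (christoffelMap G) p v (fun x => fderiv ℝ p x (eDir 0)) z)
      + (fderiv ℝ c z v • fderiv ℝ p z (eDir 1)
        + c z • covAlong (christoffelMap G) p v (fun x => fderiv ℝ p x (eDir 1)) z)) := by
  have d : ∀ {f : ℝ × EuclideanSpace ℝ (Fin 2) → ℝ} (u : ℝ × EuclideanSpace ℝ (Fin 2)),
      ContDiffAt ℝ ∞ f z → DifferentiableAt ℝ (fun x => f x • fderiv ℝ p x u) z := fun u hf =>
    hf.differentiableAt_infty.smul (h.tangent_smooth u).differentiableAt_infty
  rw [covAlong_add (d nDir ha) ((d (eDir 0) hb).fun_add (d (eDir 1) hc)),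
    covAlong_add (d (eDir 0) hb) (d (eDir 1) hc), h.cov_smul ha, h.cov_smul hb, h.cov_smul hc]

/-- In the null-frame trace of `Ric(n, n)` the `R(n, n)` term vanishes and `g(n, R(ℓ, n) n)` is zero
by antisymmetry, so only the trace over the section survives. -/
theorem IsRiggedAt.ricci_n_n (h : IsRiggedAt G p L q κ Om Xi z)
    (hvac : ∀ m n, ricci G (p z) m n = 0) :
    ∑ i, ∑ j, (q z)⁻¹ i j * metricForm G (p z) (fderiv ℝ p z (eDir j))
      (curvOp (christoffelMap G) (p z) (fderiv ℝ p z (eDir i)) (fderiv ℝ p z nDir)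
        (fderiv ℝ p z nDir)) = 0 := by
  have h1 := h.frame.ricci_eq h.metric (fderiv ℝ p z nDir) (fderiv ℝ p z nDir)
  simp only [hvac, zero_mul, Finset.sum_const_zero] at h1
  have h2 : metricForm G (p z) (L z) (curvOp (christoffelMap G) (p z) (fderiv ℝ p z nDir)
      (fderiv ℝ p z nDir) (fderiv ℝ p z nDir)) = 0 := by
    have : curvOp (christoffelMap G) (p z) (fderiv ℝ p z nDir)
      (fderiv ℝ p z nDir) (fderiv ℝ p z nDir) = 0 := by simp [curvOp]
    rw [this, map_zero]
  have h3 : metricForm G (p z) (fderiv ℝ p z nDir) (curvOp (christoffelMap G) (p z) (L z)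
      (fderiv ℝ p z nDir) (fderiv ℝ p z nDir)) = 0 := by
    have := h.metric.curvOp_antisymm_right (L z) (fderiv ℝ p z nDir) (fderiv ℝ p z nDir)
      (fderiv ℝ p z nDir)
    rw [h.metric.metricForm_comm]
    linarith
  rw [h2, h3] at h1
  linarith

/-- The Raychaudhuri equation. -/
theorem rigged_raychaudhuri (hev : ∀ᶠ x in nhds z, IsRiggedAt G p L q κ Om Xi x)
    (hvac : ∀ m n, ricci G (p z) m n = 0) :
    ∑ i, ∑ j, (q z)⁻¹ i j * (κ z * ((1 / 2) * fderiv ℝ (fun x => q x j i) z nDir)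
      - (1 / 2) * fderiv ℝ (fun x => fderiv ℝ (fun x' => q x' j i) x nDir) z nDir
      + ∑ k, ∑ l, (q z)⁻¹ k l * ((1 / 2) * fderiv ℝ (fun x => q x l j) z nDir)
        * ((1 / 2) * fderiv ℝ (fun x => q x k i) z nDir)) = 0 := by
  have h := hev.self_of_nhds
  have hev2 := eventually_eventually_nhds.2 hev
  rw [← h.ricci_n_n hvac]
  refine Finset.sum_congr rfl fun i _ => Finset.sum_congr rfl fun j _ => ?_
  congr 1
  -- `R(e_i, n) n = ∇_{e_i}(κ n) - ∇_n ∇_{e_i} n`. The derivative of `κ` multiplies `n`, which is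
  -- orthogonal to `e_j`; the last term is exchanged for `∂_n Θ` by the Leibniz rule `h1`.
  have hn : covAlong (christoffelMap G) p nDir (fun x => fderiv ℝ p x nDir) =ᶠ[nhds z]
      fun x => κ x • fderiv ℝ p x nDir := hev2.mono fun x hx => rigged_cov_n_n hx
  have hcs := h.cov_smooth (h.tangent_smooth nDir) (eDir i)
  have h1 := h.fderiv_form (h.tangent_smooth (eDir j)) hcs nDir
  have h2 : (fun x => metricForm G (p x) (fderiv ℝ p x (eDir j))
      (covAlong (christoffelMap G) p (eDir i) (fun x => fderiv ℝ p x nDir) x)) =ᶠ[nhds z]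
      fun x => (1 / 2) * fderiv ℝ (fun x' => q x' j i) x nDir :=
    hev2.mono fun x hx => rigged_secondFF hx j i
  have hq := ((rigged_q_smooth hev j i).fderiv_const_apply nDir).differentiableAt_infty
  rw [h2.fderiv_eq, fderiv_const_mul hq, h.cov_comm nDir (eDir j), rigged_cov_e_n hev j] at h1
  have h3 := h.curvature (h.tangent_smooth nDir) (eDir i) nDir
  rw [h3, covAlong_congr hn, h.cov_smul (rigged_kappa_smooth hev), map_sub, map_add, map_smul,
    map_smul, rigged_secondFF hev, h.metric.metricForm_comm (fderiv ℝ p z (eDir j)), h.frame.ne]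
  simp only [map_add, map_sum, map_smul, _root_.add_apply, _root_.sum_apply, _root_.smul_apply,
    smul_eq_mul, rigged_secondFF hev, rigged_n_cov_n hev, Finset.sum_mul] at h1 ⊢
  linarith

end RiggedCurvature

/-! ### Structure equations when the second fundamental form vanishes. -/

section ShearFree

variable {G : EuclideanSpace ℝ (Fin 4) → Matrix (Fin 4) (Fin 4) ℝ}
  {p L : ℝ × EuclideanSpace ℝ (Fin 2) → EuclideanSpace ℝ (Fin 4)}
  {q : ℝ × EuclideanSpace ℝ (Fin 2) → Matrix (Fin 2) (Fin 2) ℝ}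
  {κ : ℝ × EuclideanSpace ℝ (Fin 2) → ℝ}
  {Om : ℝ × EuclideanSpace ℝ (Fin 2) → Fin 2 → ℝ}
  {Xi : ℝ × EuclideanSpace ℝ (Fin 2) → Fin 2 → Fin 2 → ℝ}
  {z : ℝ × EuclideanSpace ℝ (Fin 2)}
  {Q : EuclideanSpace ℝ (Fin 2) → Matrix (Fin 2) (Fin 2) ℝ} {κ₀ : ℝ}

theorem fderiv_comp_snd_nDir {F : Type*} [NormedAddCommGroup F] [NormedSpace ℝ F]
    {f : EuclideanSpace ℝ (Fin 2) → F} (hf : DifferentiableAt ℝ f z.2) :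
    fderiv ℝ (fun x : ℝ × EuclideanSpace ℝ (Fin 2) => f x.2) z nDir = 0 := by
  have h1 := (HasFDerivAt.comp (g := f) z hf.hasFDerivAt
    (hasFDerivAt_snd (𝕜 := ℝ) (E := ℝ) (F := EuclideanSpace ℝ (Fin 2)))).fderiv
  have h2 : (fun x : ℝ × EuclideanSpace ℝ (Fin 2) => f x.2) = f ∘ Prod.snd := rfl
  rw [h2, h1]
  simp [nDir]

theorem fderiv_comp_snd_eDir {F : Type*} [NormedAddCommGroup F] [NormedSpace ℝ F]
    {f : EuclideanSpace ℝ (Fin 2) → F} (hf : DifferentiableAt ℝ f z.2) (i : Fin 2) :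
    fderiv ℝ (fun x : ℝ × EuclideanSpace ℝ (Fin 2) => f x.2) z (eDir i) = pd f i z.2 := by
  have h1 := (HasFDerivAt.comp (g := f) z hf.hasFDerivAt
    (hasFDerivAt_snd (𝕜 := ℝ) (E := ℝ) (F := EuclideanSpace ℝ (Fin 2)))).fderiv
  have h2 : (fun x : ℝ × EuclideanSpace ℝ (Fin 2) => f x.2) = f ∘ Prod.snd := rfl
  rw [h2, h1]
  simp [eDir, pd]

/-- Near `z`, the section metric is independent of `ξ¹` and the surface gravity is constant. -/
structure IsShearFreeNear (G : EuclideanSpace ℝ (Fin 4) → Matrix (Fin 4) (Fin 4) ℝ)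
    (p L : ℝ × EuclideanSpace ℝ (Fin 2) → EuclideanSpace ℝ (Fin 4))
    (q : ℝ × EuclideanSpace ℝ (Fin 2) → Matrix (Fin 2) (Fin 2) ℝ)
    (κ : ℝ × EuclideanSpace ℝ (Fin 2) → ℝ)
    (Om : ℝ × EuclideanSpace ℝ (Fin 2) → Fin 2 → ℝ)
    (Xi : ℝ × EuclideanSpace ℝ (Fin 2) → Fin 2 → Fin 2 → ℝ)
    (Q : EuclideanSpace ℝ (Fin 2) → Matrix (Fin 2) (Fin 2) ℝ) (κ₀ : ℝ)
    (z : ℝ × EuclideanSpace ℝ (Fin 2)) : Prop where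
  rigged : ∀ᶠ x in nhds z, IsRiggedAt G p L q κ Om Xi x
  q_eq : ∀ᶠ x in nhds z, q x = Q x.2
  kappa_eq : ∀ᶠ x in nhds z, κ x = κ₀
  q_smooth : IsSmoothMetricAt Q z.2

theorem IsShearFreeNear.eventually (h : IsShearFreeNear G p L q κ Om Xi Q κ₀ z) :
    ∀ᶠ x in nhds z, IsShearFreeNear G p L q κ Om Xi Q κ₀ x := by
  filter_upwards [eventually_eventually_nhds.2 h.rigged, eventually_eventually_nhds.2 h.q_eq,
    eventually_eventually_nhds.2 h.kappa_eq,
    continuousAt_snd.eventually h.q_smooth.eventually] with x h1 h2 h3 h4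
  exact ⟨h1, h2, h3, h4⟩

theorem IsShearFreeNear.theta (h : IsShearFreeNear G p L q κ Om Xi Q κ₀ z) (i j : Fin 2) :
    fderiv ℝ (fun x => q x i j) z nDir = 0 := by
  have h1 : (fun x => q x i j) =ᶠ[nhds z] fun x => Q x.2 i j := h.q_eq.mono fun x hx => by
    simp only [hx]
  rw [h1.fderiv_eq]
  exact fderiv_comp_snd_nDir (f := fun y => Q y i j)
    (h.q_smooth.self_of_nhds.1 i j).differentiableAt_infty

theorem christoffel_congr {d : ℕ} {A B : EuclideanSpace ℝ (Fin d) → Matrix (Fin d) (Fin d) ℝ}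
    {y : EuclideanSpace ℝ (Fin d)} (h : A =ᶠ[nhds y] B) (k i j : Fin d) :
    christoffel A y k i j = christoffel B y k i j := by
  have h1 : ∀ a b c, pd (fun y' => A y' a b) c y = pd (fun y' => B y' a b) c y := by
    intro a b c
    have : (fun y' => A y' a b) =ᶠ[nhds y] fun y' => B y' a b := h.mono fun x hx => by
      simp only [hx]
    rw [pd, this.fderiv_eq, pd]
  simp only [christoffel, h1, h.eq_of_nhds]

theorem IsShearFreeNear.slice (h : IsShearFreeNear G p L q κ Om Xi Q κ₀ z) :
    (fun y => q (z.1, y)) =ᶠ[nhds z.2] Q := by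
  have h1 : ContinuousAt (fun y : EuclideanSpace ℝ (Fin 2) => (z.1, y)) z.2 := by fun_prop
  exact h1.eventually (p := fun x => q x = Q x.2) h.q_eq

theorem IsShearFreeNear.cov_n_n (h : IsShearFreeNear G p L q κ Om Xi Q κ₀ z) :
    covAlong (christoffelMap G) p nDir (fun x => fderiv ℝ p x nDir) z =
      κ₀ • fderiv ℝ p z nDir := by
  rw [rigged_cov_n_n h.rigged, h.kappa_eq.self_of_nhds]

theorem IsShearFreeNear.cov_e_n (h : IsShearFreeNear G p L q κ Om Xi Q κ₀ z) (i : Fin 2) :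
    covAlong (christoffelMap G) p (eDir i) (fun x => fderiv ℝ p x nDir) z =
      Om z i • fderiv ℝ p z nDir := by
  rw [rigged_cov_e_n h.rigged]
  simp [h.theta]

theorem IsShearFreeNear.cov_n_e (h : IsShearFreeNear G p L q κ Om Xi Q κ₀ z) (i : Fin 2) :
    covAlong (christoffelMap G) p nDir (fun x => fderiv ℝ p x (eDir i)) z =
      Om z i • fderiv ℝ p z nDir := by
  rw [h.rigged.self_of_nhds.cov_comm, h.cov_e_n]

theorem IsShearFreeNear.cov_e_e (h : IsShearFreeNear G p L q κ Om Xi Q κ₀ z) (i j : Fin 2) :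
    covAlong (christoffelMap G) p (eDir i) (fun x => fderiv ℝ p x (eDir j)) z =
      (-Xi z i j) • fderiv ℝ p z nDir + (christoffel Q z.2 0 i j • fderiv ℝ p z (eDir 0)
        + christoffel Q z.2 1 i j • fderiv ℝ p z (eDir 1)) := by
  rw [rigged_cov_e_e h.rigged h.theta, Fin.sum_univ_two, christoffel_congr h.slice,
    christoffel_congr h.slice]

theorem IsShearFreeNear.christoffel_smooth (h : IsShearFreeNear G p L q κ Om Xi Q κ₀ z)
    (k i j : Fin 2) : ContDiffAt ℝ ∞
      (fun x : ℝ × EuclideanSpace ℝ (Fin 2) => christoffel Q x.2 k i j) z :=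
  ContDiffAt.comp (g := fun y => christoffel Q y k i j) z (h.q_smooth.contDiffAt_christoffel k i j)
    contDiffAt_snd

/-- The curvature `R(n, e_i) n`. -/
theorem IsShearFreeNear.curv_n_e_n (h : IsShearFreeNear G p L q κ Om Xi Q κ₀ z) (i : Fin 2) :
    curvOp (christoffelMap G) (p z) (fderiv ℝ p z nDir) (fderiv ℝ p z (eDir i))
      (fderiv ℝ p z nDir) = fderiv ℝ (fun x => Om x i) z nDir • fderiv ℝ p z nDir := by
  have hr := h.rigged.self_of_nhds
  have e1 : covAlong (christoffelMap G) p (eDir i) (fun x => fderiv ℝ p x nDir) =ᶠ[nhds z]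
    fun x => Om x i • fderiv ℝ p x nDir := h.eventually.mono fun x hx => hx.cov_e_n i
  have e2 : covAlong (christoffelMap G) p nDir (fun x => fderiv ℝ p x nDir) =ᶠ[nhds z]
    fun x => κ₀ • fderiv ℝ p x nDir := h.eventually.mono fun x hx => hx.cov_n_n
  rw [hr.curvature (hr.tangent_smooth nDir), covAlong_congr e1, covAlong_congr e2,
    hr.cov_smul (rigged_Om_smooth h.rigged i), hr.cov_smul contDiffAt_const, h.cov_n_n, h.cov_e_n]
  simp only [fderiv_fun_const, Pi.zero_apply, _root_.zero_apply]
  module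

/-- The curvature `R(e_i, e_j) n`. -/
theorem IsShearFreeNear.curv_e_e_n (h : IsShearFreeNear G p L q κ Om Xi Q κ₀ z) (i j : Fin 2) :
    curvOp (christoffelMap G) (p z) (fderiv ℝ p z (eDir i)) (fderiv ℝ p z (eDir j))
      (fderiv ℝ p z nDir) = (fderiv ℝ (fun x => Om x j) z (eDir i)
        - fderiv ℝ (fun x => Om x i) z (eDir j)) • fderiv ℝ p z nDir := by
  have hr := h.rigged.self_of_nhds
  have e1 : ∀ i, covAlong (christoffelMap G) p (eDir i) (fun x => fderiv ℝ p x nDir) =ᶠ[nhds z]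
    fun x => Om x i • fderiv ℝ p x nDir := fun i => h.eventually.mono fun x hx => hx.cov_e_n i
  rw [hr.curvature (hr.tangent_smooth nDir), covAlong_congr (e1 i), covAlong_congr (e1 j),
    hr.cov_smul (rigged_Om_smooth h.rigged i), hr.cov_smul (rigged_Om_smooth h.rigged j),
    h.cov_e_n, h.cov_e_n]
  module

/-- The curvature `R(n, e_i) e_j`. -/
theorem IsShearFreeNear.curv_n_e_e (h : IsShearFreeNear G p L q κ Om Xi Q κ₀ z) (i j : Fin 2) :
    curvOp (christoffelMap G) (p z) (fderiv ℝ p z nDir) (fderiv ℝ p z (eDir i))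
      (fderiv ℝ p z (eDir j)) = (-(fderiv ℝ (fun x => Xi x i j) z nDir + κ₀ * Xi z i j
        + (fderiv ℝ (fun x => Om x j) z (eDir i) - ∑ k, christoffel Q z.2 k i j * Om z k)
        + Om z i * Om z j)) • fderiv ℝ p z nDir := by
  have hr := h.rigged.self_of_nhds
  have e1 : covAlong (christoffelMap G) p (eDir i) (fun x => fderiv ℝ p x (eDir j)) =ᶠ[nhds z]
    fun x => (-Xi x i j) • fderiv ℝ p x nDir + (christoffel Q x.2 0 i j • fderiv ℝ p x (eDir 0)
        + christoffel Q x.2 1 i j • fderiv ℝ p x (eDir 1)) :=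
    h.eventually.mono fun x hx => hx.cov_e_e i j
  have e2 : covAlong (christoffelMap G) p nDir (fun x => fderiv ℝ p x (eDir j)) =ᶠ[nhds z]
    fun x => Om x j • fderiv ℝ p x nDir := h.eventually.mono fun x hx => hx.cov_n_e j
  -- The Christoffel symbols of the sections do not depend on `ξ¹`, so they contribute no normal
  -- derivative.
  have hc := fun k => fderiv_comp_snd_nDir (f := fun y => christoffel Q y k i j)
    (h.q_smooth.contDiffAt_christoffel k i j).differentiableAt_infty
  rw [hr.curvature (hr.tangent_smooth (eDir j)), covAlong_congr e1, covAlong_congr e2,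
    hr.cov_smul (rigged_Om_smooth h.rigged j), hr.cov_comb (rigged_Xi_smooth h.rigged i j).neg
      (h.christoffel_smooth 0 i j) (h.christoffel_smooth 1 i j), h.cov_n_n, h.cov_e_n, h.cov_n_e,
      h.cov_n_e, hc, hc, fderiv_fun_neg, Fin.sum_univ_two]
  simp only [_root_.neg_apply]
  module

/-- The curvature `R(e_i, e_j) e_k`. -/
theorem IsShearFreeNear.curv_e_e_e (h : IsShearFreeNear G p L q κ Om Xi Q κ₀ z) (i j k : Fin 2) :
    curvOp (christoffelMap G) (p z) (fderiv ℝ p z (eDir i)) (fderiv ℝ p z (eDir j))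
      (fderiv ℝ p z (eDir k)) = (-(fderiv ℝ (fun x => Xi x j k) z (eDir i)
          - fderiv ℝ (fun x => Xi x i k) z (eDir j)
          + ∑ m, christoffel Q z.2 m j k * Xi z i m - ∑ m, christoffel Q z.2 m i k * Xi z j m
          + Om z i * Xi z j k - Om z j * Xi z i k)) • fderiv ℝ p z nDir
        + ∑ m, riemannUp Q z.2 m k i j • fderiv ℝ p z (eDir m) := by
  have hr := h.rigged.self_of_nhds
  have e1 : ∀ i j, covAlong (christoffelMap G) p (eDir i) (fun x => fderiv ℝ p x (eDir j))
    =ᶠ[nhds z] fun x => (-Xi x i j) • fderiv ℝ p x nDir +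
      (christoffel Q x.2 0 i j • fderiv ℝ p x (eDir 0)
        + christoffel Q x.2 1 i j • fderiv ℝ p x (eDir 1)) :=
    fun i j => h.eventually.mono fun x hx => hx.cov_e_e i j
  have hc := fun m i j l => fderiv_comp_snd_eDir (f := fun y => christoffel Q y m i j)
    (h.q_smooth.contDiffAt_christoffel m i j).differentiableAt_infty l
  have hn : ∀ i j v, fderiv ℝ (fun x => -Xi x i j) z v = -fderiv ℝ (fun x => Xi x i j) z v := by
    intro i j v
    rw [fderiv_fun_neg]; rfl
  rw [hr.curvature (hr.tangent_smooth (eDir k)), covAlong_congr (e1 j k), covAlong_congr (e1 i k),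
    hr.cov_comb (rigged_Xi_smooth h.rigged j k).neg
      (h.christoffel_smooth 0 j k) (h.christoffel_smooth 1 j k),
    hr.cov_comb (rigged_Xi_smooth h.rigged i k).neg
      (h.christoffel_smooth 0 i k) (h.christoffel_smooth 1 i k)]
  simp only [h.cov_e_n, h.cov_e_e, hc, hn, Fin.sum_univ_two, riemannUp]
  module

end ShearFree

/-! ### The Ricci equations of the horizon. -/

section VacuumConsequences

variable {G : EuclideanSpace ℝ (Fin 4) → Matrix (Fin 4) (Fin 4) ℝ}
  {p L : ℝ × EuclideanSpace ℝ (Fin 2) → EuclideanSpace ℝ (Fin 4)}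
  {q : ℝ × EuclideanSpace ℝ (Fin 2) → Matrix (Fin 2) (Fin 2) ℝ}
  {κ : ℝ × EuclideanSpace ℝ (Fin 2) → ℝ}
  {Om : ℝ × EuclideanSpace ℝ (Fin 2) → Fin 2 → ℝ}
  {Xi : ℝ × EuclideanSpace ℝ (Fin 2) → Fin 2 → Fin 2 → ℝ}
  {z : ℝ × EuclideanSpace ℝ (Fin 2)}
  {Q : EuclideanSpace ℝ (Fin 2) → Matrix (Fin 2) (Fin 2) ℝ} {κ₀ : ℝ}

/-- The curvature component `-g(ℓ, R(n, e_i) e_j)` in terms of the hypersurface data. -/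
noncomputable def curvW (Q : EuclideanSpace ℝ (Fin 2) → Matrix (Fin 2) (Fin 2) ℝ) (κ₀ : ℝ)
    (Om : ℝ × EuclideanSpace ℝ (Fin 2) → Fin 2 → ℝ)
    (Xi : ℝ × EuclideanSpace ℝ (Fin 2) → Fin 2 → Fin 2 → ℝ)
    (z : ℝ × EuclideanSpace ℝ (Fin 2)) (i j : Fin 2) : ℝ :=
  fderiv ℝ (fun x => Xi x i j) z nDir + κ₀ * Xi z i j
    + (fderiv ℝ (fun x => Om x j) z (eDir i) - ∑ k, christoffel Q z.2 k i j * Om z k)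
    + Om z i * Om z j

/-- The curvature component `-g(ℓ, R(e_i, e_j) e_k)` in terms of the hypersurface data. -/
noncomputable def curvC (Q : EuclideanSpace ℝ (Fin 2) → Matrix (Fin 2) (Fin 2) ℝ)
    (Om : ℝ × EuclideanSpace ℝ (Fin 2) → Fin 2 → ℝ)
    (Xi : ℝ × EuclideanSpace ℝ (Fin 2) → Fin 2 → Fin 2 → ℝ)
    (z : ℝ × EuclideanSpace ℝ (Fin 2)) (i j k : Fin 2) : ℝ :=
  fderiv ℝ (fun x => Xi x j k) z (eDir i) - fderiv ℝ (fun x => Xi x i k) z (eDir j)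
    + ∑ m, christoffel Q z.2 m j k * Xi z i m - ∑ m, christoffel Q z.2 m i k * Xi z j m
    + Om z i * Xi z j k - Om z j * Xi z i k

theorem IsShearFreeNear.rig_curv_n_e_e (h : IsShearFreeNear G p L q κ Om Xi Q κ₀ z)
    (i j : Fin 2) :
    metricForm G (p z) (L z) (curvOp (christoffelMap G) (p z) (fderiv ℝ p z nDir)
      (fderiv ℝ p z (eDir i)) (fderiv ℝ p z (eDir j))) = -curvW Q κ₀ Om Xi z i j := by
  rw [h.curv_n_e_e, map_smul, h.rigged.self_of_nhds.frame.ln, smul_eq_mul, mul_one, curvW]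

theorem IsShearFreeNear.rig_curv_e_e_e (h : IsShearFreeNear G p L q κ Om Xi Q κ₀ z)
    (i j k : Fin 2) :
    metricForm G (p z) (L z) (curvOp (christoffelMap G) (p z) (fderiv ℝ p z (eDir i))
      (fderiv ℝ p z (eDir j)) (fderiv ℝ p z (eDir k))) = -curvC Q Om Xi z i j k := by
  have hf := h.rigged.self_of_nhds.frame
  rw [h.curv_e_e_e, map_add, map_smul, hf.ln, map_sum, smul_eq_mul, mul_one, curvC]
  simp only [map_smul, hf.le, smul_zero, Finset.sum_const_zero, add_zero]

/-- This is `Ric(n, e_i) = 0`. In the null-frame trace the `ℓ` term vanishes by antisymmetry and the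
section terms because `R(e_j, e_i) n` is parallel to `n`; only `g(ℓ, R(n, e_i) n) = ∂_n Ω_i` is
left. -/
theorem IsShearFreeNear.deriv_Om (h : IsShearFreeNear G p L q κ Om Xi Q κ₀ z)
    (hvac : ∀ m n, ricci G (p z) m n = 0) (i : Fin 2) :
    fderiv ℝ (fun x => Om x i) z nDir = 0 := by
  have hr := h.rigged.self_of_nhds
  have h1 := hr.frame.ricci_eq hr.metric (fderiv ℝ p z (eDir i)) (fderiv ℝ p z nDir)
  have h2 := hr.metric.curvOp_antisymm_right (L z) (fderiv ℝ p z (eDir i)) (fderiv ℝ p z nDir)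
    (fderiv ℝ p z nDir)
  have h3 : metricForm G (p z) (fderiv ℝ p z nDir) (curvOp (christoffelMap G) (p z) (L z)
      (fderiv ℝ p z (eDir i)) (fderiv ℝ p z nDir)) = 0 := by
    rw [hr.metric.metricForm_comm]; linarith
  have h4 : ∀ j, metricForm G (p z) (fderiv ℝ p z (eDir j)) (fderiv ℝ p z nDir) = 0 := fun j => by
    rw [hr.metric.metricForm_comm, hr.frame.ne]
  rw [h3, h.curv_n_e_n, map_smul, hr.frame.ln] at h1
  simp only [hvac, zero_mul, Finset.sum_const_zero, h.curv_e_e_n, map_smul, h4,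
    mul_zero, add_zero, smul_eq_mul, mul_one] at h1
  exact h1.symm

/-- Derivatives in the direction `ℓ` are not accessible from data on the hypersurface. Pair symmetry
replaces such a component by one that differentiates along `n` and, for tangential `a`, only along
the hypersurface. -/
theorem IsShearFreeNear.n_curv_rig (h : IsShearFreeNear G p L q κ Om Xi Q κ₀ z)
    (a b : EuclideanSpace ℝ (Fin 4)) :
    metricForm G (p z) (curvOp (christoffelMap G) (p z) (L z) b a) (fderiv ℝ p z nDir) =
      metricForm G (p z) (L z) (curvOp (christoffelMap G) (p z) (fderiv ℝ p z nDir) a b) := by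
  have hr := h.rigged.self_of_nhds
  rw [hr.metric.curvOp_pair_symm, curvOp_antisymm_left, map_neg, _root_.neg_apply,
    hr.metric.curvOp_antisymm_right, neg_neg, hr.metric.metricForm_comm]

/-- This is `Ric(e_i, e_j) = 0`: the two null terms are `-W_{ji}` and `-W_{ij}`, and the section
trace is the intrinsic Ricci tensor because `n` is orthogonal to the `e_j`. -/
theorem IsShearFreeNear.curvW_symm (h : IsShearFreeNear G p L q κ Om Xi Q κ₀ z)
    (hvac : ∀ m n, ricci G (p z) m n = 0) (i j : Fin 2) :
    curvW Q κ₀ Om Xi z i j + curvW Q κ₀ Om Xi z j i = ricci Q z.2 i j := by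
  have hr := h.rigged.self_of_nhds
  have h1 := hr.frame.ricci_eq hr.metric (fderiv ℝ p z (eDir j)) (fderiv ℝ p z (eDir i))
  have hen : ∀ j, metricForm G (p z) (fderiv ℝ p z (eDir j)) (fderiv ℝ p z nDir) = 0 := fun j => by
    rw [hr.metric.metricForm_comm, hr.frame.ne]
  have h5 : ∀ a b, metricForm G (p z) (fderiv ℝ p z (eDir b)) (curvOp (christoffelMap G) (p z)
      (fderiv ℝ p z (eDir a)) (fderiv ℝ p z (eDir j)) (fderiv ℝ p z (eDir i))) =
      ∑ m, q z b m * riemannUp Q z.2 m i a j := by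
    intro a b
    rw [h.curv_e_e_e, map_add, map_smul, hen, smul_zero, zero_add, map_sum]
    refine Finset.sum_congr rfl fun m _ => ?_
    rw [map_smul, hr.frame.ee, smul_eq_mul, mul_comm]
  have h6 : ∑ a, ∑ b, (q z)⁻¹ a b * ∑ m, q z b m * riemannUp Q z.2 m i a j = ricci Q z.2 i j := by
    refine Finset.sum_congr rfl fun a _ => ?_
    have h7 : (q z)⁻¹.mulVec ((q z).mulVec fun m => riemannUp Q z.2 m i a j) a =
        riemannUp Q z.2 a i a j := by
      rw [Matrix.mulVec_mulVec, Matrix.nonsing_inv_mul _ hr.frame.det, Matrix.one_mulVec]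
    exact h7
  rw [hr.metric.metricForm_comm (fderiv ℝ p z nDir), h.n_curv_rig, h.rig_curv_n_e_e,
    h.rig_curv_n_e_e] at h1
  simp only [hvac, zero_mul, Finset.sum_const_zero, h5, h6] at h1
  linarith

/-- This is `Ric(e_i, ℓ) = 0`. It trades the component with two entries `ℓ`, needed for `Ψ₃`, for
the trace of the Codazzi components, which involve tangential derivatives only. -/
theorem IsShearFreeNear.n_curv_e_rig_rig (h : IsShearFreeNear G p L q κ Om Xi Q κ₀ z)
    (hvac : ∀ m n, ricci G (p z) m n = 0) (i : Fin 2) :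
    metricForm G (p z) (curvOp (christoffelMap G) (p z) (fderiv ℝ p z (eDir i)) (L z) (L z))
      (fderiv ℝ p z nDir) = ∑ a, ∑ b, (q z)⁻¹ a b * curvC Q Om Xi z a i b := by
  have hr := h.rigged.self_of_nhds
  have h1 := hr.frame.ricci_eq hr.metric (fderiv ℝ p z (eDir i)) (L z)
  have h2 := hr.metric.curvOp_antisymm_right (fderiv ℝ p z nDir) (fderiv ℝ p z (eDir i)) (L z) (L z)
  have h3 : metricForm G (p z) (L z) (curvOp (christoffelMap G) (p z) (fderiv ℝ p z nDir)
      (fderiv ℝ p z (eDir i)) (L z)) = 0 := by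
    rw [hr.metric.metricForm_comm]; linarith
  have h4 : ∀ a b, metricForm G (p z) (fderiv ℝ p z (eDir b)) (curvOp (christoffelMap G) (p z)
      (fderiv ℝ p z (eDir a)) (fderiv ℝ p z (eDir i)) (L z)) = curvC Q Om Xi z a i b := by
    intro a b
    rw [hr.metric.metricForm_comm, hr.metric.curvOp_antisymm_right, hr.metric.metricForm_comm,
      h.rig_curv_e_e_e, neg_neg]
  rw [curvOp_antisymm_left, map_neg, _root_.neg_apply, hr.metric.metricForm_comm]
  simp only [hvac, zero_mul, Finset.sum_const_zero, h3, h4] at h1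
  linarith

end VacuumConsequences

/-! ### Contractions of the Weyl tensor with complex null vectors. -/

section ComplexContraction

/-- The contraction of a four-index array with complex vectors. -/
noncomputable def contract4 (C : Fin 4 → Fin 4 → Fin 4 → Fin 4 → ℝ) (a b c d : Fin 4 → ℂ) : ℂ :=
  ∑ s, ∑ r, ∑ m, ∑ n, (C s r m n : ℂ) * a s * b r * c m * d n

theorem sqrt_two_mul_sqrt_two : ((Real.sqrt 2 : ℝ) : ℂ) * ((Real.sqrt 2 : ℝ) : ℂ) = 2 := by
  rw [← Complex.ofReal_mul, Real.mul_self_sqrt (by norm_num)]; norm_num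

/-- The diagonal terms form the trace over the real frame and the cross terms its antisymmetric
part; for real arguments these become the real and imaginary parts of `Ψ₂`. -/
theorem contract4_null_pair (C : Fin 4 → Fin 4 → Fin 4 → Fin 4 → ℝ) (a c u v : Fin 4 → ℂ) :
    contract4 C a (fun k => (u k + Complex.I * v k) / (Real.sqrt 2 : ℂ)) c
      (fun k => (u k - Complex.I * v k) / (Real.sqrt 2 : ℂ)) =
    (1 / 2) * (contract4 C a u c u + contract4 C a v c v
      + Complex.I * (contract4 C a v c u - contract4 C a u c v)) := by
  have key : ∀ s r m n, (C s r m n : ℂ) * a s * ((u r + Complex.I * v r) / (Real.sqrt 2 : ℂ)) * c m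
      * ((u n - Complex.I * v n) / (Real.sqrt 2 : ℂ)) =
      (1 / 2) * ((C s r m n : ℂ) * a s * u r * c m * u n)
      + (1 / 2) * ((C s r m n : ℂ) * a s * v r * c m * v n)
      + Complex.I / 2 * ((C s r m n : ℂ) * a s * v r * c m * u n)
      - Complex.I / 2 * ((C s r m n : ℂ) * a s * u r * c m * v n) := by
    intro s r m n
    have h2 : ((Real.sqrt 2 : ℝ) : ℂ)⁻¹ * ((Real.sqrt 2 : ℝ) : ℂ)⁻¹ = 1 / 2 := by
      rw [← mul_inv, sqrt_two_mul_sqrt_two, one_div]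
    simp only [div_eq_mul_inv _ ((Real.sqrt 2 : ℝ) : ℂ)]
    linear_combination (C s r m n * a s * (u r + Complex.I * v r) * c m
      * (u n - Complex.I * v n)) * h2 - (1 / 2) * (C s r m n * a s * v r * c m * v n) * Complex.I_sq
  simp only [contract4, key, Finset.sum_add_distrib, Finset.sum_sub_distrib, ← Finset.mul_sum]
  ring

theorem contract4_conj (C : Fin 4 → Fin 4 → Fin 4 → Fin 4 → ℝ) (a b d u v : Fin 4 → ℂ) :
    contract4 C a b (fun k => (u k - Complex.I * v k) / (Real.sqrt 2 : ℂ)) d =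
      (1 / (Real.sqrt 2 : ℂ)) * (contract4 C a b u d - Complex.I * contract4 C a b v d) := by
  have key : ∀ s r m n, (C s r m n : ℂ) * a s * b r * ((u m - Complex.I * v m) / (Real.sqrt 2 : ℂ))
      * d n = (1 / (Real.sqrt 2 : ℂ)) * ((C s r m n : ℂ) * a s * b r * u m * d n)
      - (1 / (Real.sqrt 2 : ℂ)) * Complex.I * ((C s r m n : ℂ) * a s * b r * v m * d n) := by
    intro s r m n
    ring
  simp only [contract4, key, Finset.sum_sub_distrib, ← Finset.mul_sum]
  ring

theorem contract4_ofReal (C : Fin 4 → Fin 4 → Fin 4 → Fin 4 → ℝ) (a b c d : Fin 4 → ℝ) :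
    contract4 C (fun k => (a k : ℂ)) (fun k => (b k : ℂ)) (fun k => (c k : ℂ))
      (fun k => (d k : ℂ)) =
      ((∑ s, ∑ r, ∑ m, ∑ n, C s r m n * a s * b r * c m * d n : ℝ) : ℂ) := by
  simp only [contract4]
  push_cast
  rfl

theorem weyl_eq_riemannLow {G : EuclideanSpace ℝ (Fin 4) → Matrix (Fin 4) (Fin 4) ℝ}
    {x : EuclideanSpace ℝ (Fin 4)} (hvac : ∀ m n, ricci G x m n = 0) (s r m n : Fin 4) :
    weyl G x s r m n = riemannLow G x s r m n := by
  simp [weyl, schouten, scalarCurv, hvac]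

/-- Fixes the slots: in vacuum `C(a, b, c, d) = g(a, R(c, d) b)`, so the last two arguments are the
directions of differentiation. -/
theorem contract4_weyl {G : EuclideanSpace ℝ (Fin 4) → Matrix (Fin 4) (Fin 4) ℝ}
    {x : EuclideanSpace ℝ (Fin 4)} (h : IsSmoothMetricAt G x) (hvac : ∀ m n, ricci G x m n = 0)
    (a b c d : EuclideanSpace ℝ (Fin 4)) :
    contract4 (weyl G x) (fun k => (a k : ℂ)) (fun k => (b k : ℂ)) (fun k => (c k : ℂ))
      (fun k => (d k : ℂ)) =
      ((metricForm G x (curvOp (christoffelMap G) x c d b) a : ℝ) : ℂ) := by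
  rw [contract4_ofReal, h.metricForm_curvOp]
  simp only [weyl_eq_riemannLow hvac]

end ComplexContraction

/-! ## The metric in a chart -/

section MetricInChart

variable {M : Type*} [TopologicalSpace M] [ChartedSpace (EuclideanSpace ℝ (Fin 4)) M]

theorem LorentzMetric.eq_zero_of_orthogonal (g : LorentzMetric M) {p : M}
    {v : TangentSpace (𝓡 4) p} (h : ∀ w, g.val p w v = 0) : v = 0 := by
  obtain ⟨b, hb⟩ := g.signature p
  have h1 : ∀ i, b.repr v i = 0 := by
    intro i
    have h2 := h (b i)
    conv at h2 => lhs; rw [← b.sum_repr v]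
    simp only [map_sum, map_smul, hb, smul_eq_mul, mul_ite, mul_zero, Finset.sum_ite_eq,
      Finset.mem_univ, if_true] at h2
    split_ifs at h2 <;> linarith
  rw [← b.sum_repr v]
  simp [h1]

/-- The vector `n - ℓ` is timelike of square `-2` and orthogonal to `v`, and the orthogonal
complement of a timelike vector is positive definite. -/
theorem LorentzMetric.pos_of_orthogonal_null_pair (g : LorentzMetric M) {p : M}
    {n l v : TangentSpace (𝓡 4) p} (hnn : g.val p n n = 0) (hll : g.val p l l = 0)
    (hln : g.val p l n = 1) (hvn : g.val p n v = 0) (hvl : g.val p l v = 0) (hv : v ≠ 0) :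
    0 < g.val p v v := by
  by_contra hneg
  push Not at hneg
  obtain ⟨b, hb⟩ := g.signature p
  have hpos : ∀ w, b.repr w 0 = 0 → g.val p w w ≤ 0 → w = 0 := by
    intro w h0 hw
    have h2 : g.val p w w = ∑ i, b.repr w i * (b.repr w i * (if i = 0 then -1 else 1)) := by
      conv_lhs => rw [← b.sum_repr w]
      simp only [map_sum, map_smul, LinearMap.sum_apply, LinearMap.smul_apply, hb, smul_eq_mul]
      refine Finset.sum_congr rfl fun i _ => ?_
      rw [Finset.sum_eq_single i (fun j _ hj => by simp [hj]) (by simp)]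
      simp
    rw [h2, Fin.sum_univ_four, h0] at hw
    simp only [Fin.isValue, Fin.reduceEq, if_false, zero_mul, mul_one, zero_add] at hw
    have h1 : b.repr w 1 = 0 := by
      nlinarith [mul_self_nonneg (b.repr w 1), mul_self_nonneg (b.repr w 2),
        mul_self_nonneg (b.repr w 3)]
    have h2 : b.repr w 2 = 0 := by
      nlinarith [mul_self_nonneg (b.repr w 1), mul_self_nonneg (b.repr w 2),
        mul_self_nonneg (b.repr w 3)]
    have h3 : b.repr w 3 = 0 := by
      nlinarith [mul_self_nonneg (b.repr w 1), mul_self_nonneg (b.repr w 2),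
        mul_self_nonneg (b.repr w 3)]
    rw [← b.sum_repr w, Fin.sum_univ_four, h0, h1, h2, h3]
    simp
  have hnl : g.val p n l = 1 := by rw [g.symm, hln]
  set t := n - l with ht
  have htt : g.val p t t = -2 := by
    simp only [ht, map_sub, LinearMap.sub_apply, hnn, hll, hln, hnl]; norm_num
  have htv : g.val p t v = 0 := by simp [ht, hvn, hvl]
  have hvt : g.val p v t = 0 := by rw [g.symm, htv]
  -- This combination has no time component, yet its square is nonpositive if that of `v` is, so it
  -- vanishes. Pairing it with `t` gives `v⁰ = 0`, after which the same argument applies to `v`.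
  have key : (b.repr v 0) • t - (b.repr t 0) • v = 0 := by
    refine hpos _ (by simp [mul_comm]) ?_
    simp only [map_sub, map_smul, LinearMap.sub_apply, LinearMap.smul_apply, htt, htv, hvt,
      smul_eq_mul]
    nlinarith [mul_self_nonneg (b.repr v 0), mul_self_nonneg (b.repr t 0),
      mul_nonneg (mul_self_nonneg (b.repr t 0)) (neg_nonneg.2 hneg)]
  have h1 := congrArg (g.val p t) key
  simp only [map_sub, map_smul, htt, htv, smul_eq_mul, mul_zero, sub_zero, map_zero] at h1
  have h2 : b.repr v 0 = 0 := by linarith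
  exact hv (hpos v h2 hneg)

theorem LorentzMetric.val_congr (g : LorentzMetric M) {p p' : M} (h : p = p')
    (v w : EuclideanSpace ℝ (Fin 4)) :
    g.val p (v : TangentSpace (𝓡 4) p) (w : TangentSpace (𝓡 4) p) =
      g.val p' (v : TangentSpace (𝓡 4) p') (w : TangentSpace (𝓡 4) p') := by
  subst h; rfl

theorem LorentzMetric.inChart_eq_metricForm (g : LorentzMetric M)
    (φ : OpenPartialHomeomorph M (EuclideanSpace ℝ (Fin 4)))
    (x a b : EuclideanSpace ℝ (Fin 4)) : g.inChart φ x a b = metricForm (g.comp φ) x a b := by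
  have hs : ∀ v : EuclideanSpace ℝ (Fin 4), v = ∑ i, v i • EuclideanSpace.single i (1 : ℝ) := by
    intro v; ext k; simp [Pi.single_apply]
  let f : EuclideanSpace ℝ (Fin 4) →ₗ[ℝ] TangentSpace (𝓡 4) (φ.symm x) :=
    (mfderiv (𝓡 4) (𝓡 4) φ.symm x).toLinearMap
  have hf : ∀ a b, g.inChart φ x a b = g.val (φ.symm x) (f a) (f b) := fun _ _ => rfl
  rw [metricForm_apply]
  simp only [LorentzMetric.comp, Matrix.of_apply, hf]
  conv_lhs => rw [hs a, hs b]
  simp only [map_sum, map_smul, LinearMap.sum_apply, LinearMap.smul_apply, smul_eq_mul]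
  rw [Finset.sum_comm]
  refine Finset.sum_congr rfl fun i _ => ?_
  rw [Finset.mul_sum]
  exact Finset.sum_congr rfl fun j _ => by ring

variable [IsManifold (𝓡 4) ∞ M]

theorem vecInChart_symm (p₀ : M) {x : EuclideanSpace ℝ (Fin 4)}
    (hx : x ∈ (chartAt (EuclideanSpace ℝ (Fin 4)) p₀).target) (v : EuclideanSpace ℝ (Fin 4)) :
    vecInChart (chartAt (EuclideanSpace ℝ (Fin 4)) p₀)
      ((chartAt (EuclideanSpace ℝ (Fin 4)) p₀).symm x)
      (mfderiv (𝓡 4) (𝓡 4) (chartAt (EuclideanSpace ℝ (Fin 4)) p₀).symm x v) = v := by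
  have h := (mdifferentiable_chart (I := 𝓡 4) p₀).comp_symm_deriv hx
  exact congrArg (fun f => f v) h

theorem symm_vecInChart (p₀ : M) {p : M}
    (hp : p ∈ (chartAt (EuclideanSpace ℝ (Fin 4)) p₀).source) (v : TangentSpace (𝓡 4) p) :
    (mfderiv (𝓡 4) (𝓡 4) (chartAt (EuclideanSpace ℝ (Fin 4)) p₀).symm
      (chartAt (EuclideanSpace ℝ (Fin 4)) p₀ p)
      (vecInChart (chartAt (EuclideanSpace ℝ (Fin 4)) p₀) p v) : EuclideanSpace ℝ (Fin 4)) = v := by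
  have h := (mdifferentiable_chart (I := 𝓡 4) p₀).symm_comp_deriv hp
  exact congrArg (fun f => f v) h

theorem LorentzMetric.inChart_vecInChart (g : LorentzMetric M) (p₀ : M) {p : M}
    (hp : p ∈ (chartAt (EuclideanSpace ℝ (Fin 4)) p₀).source) (v w : TangentSpace (𝓡 4) p) :
    g.inChart (chartAt (EuclideanSpace ℝ (Fin 4)) p₀) (chartAt (EuclideanSpace ℝ (Fin 4)) p₀ p)
      (vecInChart (chartAt (EuclideanSpace ℝ (Fin 4)) p₀) p v)
      (vecInChart (chartAt (EuclideanSpace ℝ (Fin 4)) p₀) p w) = g.val p v w := by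
  have h1 := symm_vecInChart p₀ hp v
  have h2 := symm_vecInChart p₀ hp w
  have h3 := (chartAt (EuclideanSpace ℝ (Fin 4)) p₀).left_inv hp
  have h4 := g.val_congr h3 v w
  rw [← h4]
  exact congrArg₂ (fun a b => g.val ((chartAt (EuclideanSpace ℝ (Fin 4)) p₀).symm
      (chartAt (EuclideanSpace ℝ (Fin 4)) p₀ p)) a b) h1 h2

theorem LorentzMetric.isSmoothMetricAt_comp (g : LorentzMetric M) (p₀ : M)
    {x : EuclideanSpace ℝ (Fin 4)} (hx : x ∈ (chartAt (EuclideanSpace ℝ (Fin 4)) p₀).target) :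
    IsSmoothMetricAt (g.comp (chartAt (EuclideanSpace ℝ (Fin 4)) p₀)) x := by
  set φ := chartAt (EuclideanSpace ℝ (Fin 4)) p₀ with hφ
  filter_upwards [φ.open_target.mem_nhds hx] with y hy
  refine ⟨fun i j => ?_, ?_, ?_⟩
  · exact (g.smooth φ (IsManifold.chart_mem_maximalAtlas p₀) _ _).contDiffAt
      (φ.open_target.mem_nhds hy)
  · ext i j
    exact g.symm _ _ _
  · rw [isUnit_iff_ne_zero]
    intro hdet
    -- A kernel vector of the component matrix would be orthogonal to every tangent vector at the
    -- point, contradicting nondegeneracy of `g`.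
    obtain ⟨v, hv0, hv⟩ := Matrix.exists_mulVec_eq_zero_iff.2 hdet
    apply hv0
    have h1 : ∀ a, metricForm (g.comp φ) y a (WithLp.toLp 2 v) = 0 := by
      intro a
      rw [metricForm_apply]
      have : ∀ i, ∑ j, g.comp φ y i j * a i * v j = a i * (g.comp φ y).mulVec v i := by
        intro i
        simp only [Matrix.mulVec, dotProduct, Finset.mul_sum]
        exact Finset.sum_congr rfl fun j _ => by ring
      simp only [this, hv, Pi.zero_apply, mul_zero, Finset.sum_const_zero]
    have hsrc := φ.map_target hy
    have hr := φ.right_inv hy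
    have h2 : mfderiv (𝓡 4) (𝓡 4) φ.symm y (WithLp.toLp 2 v) = 0 := by
      refine g.eq_zero_of_orthogonal fun w => ?_
      have h3 := g.inChart_vecInChart p₀ hsrc w (mfderiv (𝓡 4) (𝓡 4) φ.symm y (WithLp.toLp 2 v))
      rw [← h3, ← hφ, vecInChart_symm p₀ hy, hr, g.inChart_eq_metricForm, h1]
    have h4 := vecInChart_symm p₀ hy (WithLp.toLp 2 v)
    rw [← hφ, h2] at h4
    have h5 : (0 : EuclideanSpace ℝ (Fin 4)) = WithLp.toLp 2 v := by
      rw [← h4]; exact (map_zero (mfderiv (𝓡 4) (𝓡 4) φ (φ.symm y))).symm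
    exact (congrArg WithLp.ofLp h5).symm

end MetricInChart

/-! ## The hypersurface in a chart -/

theorem contMDiffAt_sphereCoord {ψ : S2Chart} (hψ : IsSmoothChart ψ)
    {z : ℝ × EuclideanSpace ℝ (Fin 2)} (hz : z.2 ∈ ψ.target) :
    ContMDiffAt 𝓘(ℝ, ℝ × EuclideanSpace ℝ (Fin 2)) (𝓘(ℝ, ℝ).prod (𝓡 2)) ∞
      (fun z : ℝ × EuclideanSpace ℝ (Fin 2) => ((z.1, ψ.symm z.2) : ℝ × S2)) z := by
  have h1 : ContMDiffAt 𝓘(ℝ, ℝ × EuclideanSpace ℝ (Fin 2)) 𝓘(ℝ, ℝ) ∞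
      (fun z : ℝ × EuclideanSpace ℝ (Fin 2) => z.1) z := contDiffAt_fst.contMDiffAt
  have h2 : ContMDiffAt 𝓘(ℝ, ℝ × EuclideanSpace ℝ (Fin 2)) (𝓡 2) ∞
      (fun z : ℝ × EuclideanSpace ℝ (Fin 2) => z.2) z := contDiffAt_snd.contMDiffAt
  have h3 : ContMDiffAt (𝓡 2) (𝓡 2) ∞ ψ.symm z.2 :=
    (contMDiffOn_symm_of_mem_maximalAtlas hψ).contMDiffAt (ψ.open_target.mem_nhds hz)
  exact h1.prodMk (ContMDiffAt.comp z h3 h2)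

theorem mfderiv_sphereCoord {ψ : S2Chart} (hψ : IsSmoothChart ψ)
    {z : ℝ × EuclideanSpace ℝ (Fin 2)} (hz : z.2 ∈ ψ.target)
    (v : ℝ × EuclideanSpace ℝ (Fin 2)) :
    mfderiv 𝓘(ℝ, ℝ × EuclideanSpace ℝ (Fin 2)) (𝓘(ℝ, ℝ).prod (𝓡 2))
      (fun z : ℝ × EuclideanSpace ℝ (Fin 2) => ((z.1, ψ.symm z.2) : ℝ × S2)) z v =
      (v.1, mfderiv (𝓡 2) (𝓡 2) ψ.symm z.2 v.2) := by
  have h1 : HasMFDerivAt 𝓘(ℝ, ℝ × EuclideanSpace ℝ (Fin 2)) 𝓘(ℝ, ℝ)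
      (fun z : ℝ × EuclideanSpace ℝ (Fin 2) => z.1) z
      (ContinuousLinearMap.fst ℝ ℝ (EuclideanSpace ℝ (Fin 2))) :=
    hasFDerivAt_fst.hasMFDerivAt
  have h2 : HasMFDerivAt 𝓘(ℝ, ℝ × EuclideanSpace ℝ (Fin 2)) (𝓡 2)
      (fun z : ℝ × EuclideanSpace ℝ (Fin 2) => z.2) z
      (ContinuousLinearMap.snd ℝ ℝ (EuclideanSpace ℝ (Fin 2))) :=
    hasFDerivAt_snd.hasMFDerivAt
  have h3 : ContMDiffAt (𝓡 2) (𝓡 2) ∞ ψ.symm z.2 :=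
    (contMDiffOn_symm_of_mem_maximalAtlas hψ).contMDiffAt (ψ.open_target.mem_nhds hz)
  have h4 := (h3.mdifferentiableAt (by simp)).hasMFDerivAt
  have h5 := (h1.prodMk (HasMFDerivAt.comp z h4 h2)).mfderiv
  exact congrArg (fun f => f v) h5

theorem mfderiv_symm_injective {ψ : S2Chart} (hψ : IsSmoothChart ψ)
    {y : EuclideanSpace ℝ (Fin 2)} (hy : y ∈ ψ.target) {w : EuclideanSpace ℝ (Fin 2)}
    (hw : mfderiv (𝓡 2) (𝓡 2) ψ.symm y w = 0) : w = 0 := by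
  have h : ψ.MDifferentiable (𝓡 2) (𝓡 2) :=
    ⟨(contMDiffOn_of_mem_maximalAtlas hψ).mdifferentiableOn (by simp),
      (contMDiffOn_symm_of_mem_maximalAtlas hψ).mdifferentiableOn (by simp)⟩
  have h1 : mfderiv (𝓡 2) (𝓡 2) ψ (ψ.symm y) (mfderiv (𝓡 2) (𝓡 2) ψ.symm y w) = w :=
    congrArg (fun f => f w) (h.comp_symm_deriv hy)
  rw [hw] at h1
  rw [← h1]
  exact map_zero (mfderiv (𝓡 2) (𝓡 2) ψ (ψ.symm y))

namespace NullHypersurface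

variable {M : Type*} [TopologicalSpace M] [ChartedSpace (EuclideanSpace ℝ (Fin 4)) M]
  [IsManifold (𝓡 4) ∞ M] {g : LorentzMetric M} (𝓗 : NullHypersurface g)
  {ψ : S2Chart} {z : ℝ × EuclideanSpace ℝ (Fin 2)}

theorem param_smooth (hψ : IsSmoothChart ψ) (hz : z.2 ∈ ψ.target) :
    ContMDiffAt 𝓘(ℝ, ℝ × EuclideanSpace ℝ (Fin 2)) (𝓡 4) ∞ (𝓗.param ψ) z :=
  ContMDiffAt.comp z (𝓗.emb_smooth (z.1, ψ.symm z.2)) (contMDiffAt_sphereCoord hψ hz)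

theorem push_eq (hψ : IsSmoothChart ψ) (hz : z.2 ∈ ψ.target)
    (v : ℝ × EuclideanSpace ℝ (Fin 2)) :
    𝓗.push ψ z v = mfderiv (𝓘(ℝ, ℝ).prod (𝓡 2)) (𝓡 4) 𝓗.emb (z.1, ψ.symm z.2)
      ((v.1, mfderiv (𝓡 2) (𝓡 2) ψ.symm z.2 v.2) : ℝ × EuclideanSpace ℝ (Fin 2)) := by
  have h1 : mfderiv 𝓘(ℝ, ℝ × EuclideanSpace ℝ (Fin 2)) (𝓡 4) (𝓗.param ψ) z =
      (mfderiv (𝓘(ℝ, ℝ).prod (𝓡 2)) (𝓡 4) 𝓗.emb (z.1, ψ.symm z.2)).comp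
      (mfderiv 𝓘(ℝ, ℝ × EuclideanSpace ℝ (Fin 2)) (𝓘(ℝ, ℝ).prod (𝓡 2))
        (fun z : ℝ × EuclideanSpace ℝ (Fin 2) => ((z.1, ψ.symm z.2) : ℝ × S2)) z) :=
    mfderiv_comp z ((𝓗.emb_smooth (z.1, ψ.symm z.2)).mdifferentiableAt (by simp))
      ((contMDiffAt_sphereCoord hψ hz).mdifferentiableAt (by simp))
  have h2 := mfderiv_sphereCoord hψ hz v
  exact (congrArg (fun f => f v) h1).trans (congrArg
    (mfderiv (𝓘(ℝ, ℝ).prod (𝓡 2)) (𝓡 4) 𝓗.emb (z.1, ψ.symm z.2)) h2)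

theorem push_injective (hψ : IsSmoothChart ψ) (hz : z.2 ∈ ψ.target)
    {v : ℝ × EuclideanSpace ℝ (Fin 2)} (hv : 𝓗.push ψ z v = 0) : v = 0 := by
  rw [𝓗.push_eq hψ hz] at hv
  have h1 := 𝓗.emb_immersion (z.1, ψ.symm z.2) (hv.trans (map_zero _).symm)
  have h2 : v.1 = 0 := congrArg Prod.fst h1
  have h3 : mfderiv (𝓡 2) (𝓡 2) ψ.symm z.2 v.2 = 0 := congrArg Prod.snd h1
  exact Prod.ext h2 (mfderiv_symm_injective hψ hz h3)

theorem nVec_eq (hψ : IsSmoothChart ψ) (hz : z.2 ∈ ψ.target) :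
    𝓗.nVec ψ z = mfderiv (𝓘(ℝ, ℝ).prod (𝓡 2)) (𝓡 4) 𝓗.emb (z.1, ψ.symm z.2)
      ((1, 0) : ℝ × EuclideanSpace ℝ (Fin 2)) := by
  rw [nVec, 𝓗.push_eq hψ hz]
  have : mfderiv (𝓡 2) (𝓡 2) ψ.symm z.2 (0 : EuclideanSpace ℝ (Fin 2)) = 0 := map_zero _
  rw [this]
  rfl

theorem val_nVec_push (hψ : IsSmoothChart ψ) (hz : z.2 ∈ ψ.target)
    (v : ℝ × EuclideanSpace ℝ (Fin 2)) :
    g.val (𝓗.param ψ z) (𝓗.nVec ψ z) (𝓗.push ψ z v) = 0 := by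
  rw [𝓗.nVec_eq hψ hz, 𝓗.push_eq hψ hz]
  exact 𝓗.normal _ _

theorem val_rigAt_nVec (hψ : IsSmoothChart ψ) (hz : z.2 ∈ ψ.target) :
    g.val (𝓗.param ψ z) (𝓗.rigAt ψ z) (𝓗.nVec ψ z) = 1 := by
  rw [𝓗.nVec_eq hψ hz]
  exact 𝓗.rig_normal _

theorem val_rigAt_push (hψ : IsSmoothChart ψ) (hz : z.2 ∈ ψ.target)
    (w : EuclideanSpace ℝ (Fin 2)) :
    g.val (𝓗.param ψ z) (𝓗.rigAt ψ z) (𝓗.push ψ z (0, w)) = 0 := by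
  rw [𝓗.push_eq hψ hz]
  exact 𝓗.rig_section _ _

/-- The section metric is positive definite. -/
theorem val_push_pos (hψ : IsSmoothChart ψ) (hz : z.2 ∈ ψ.target)
    {w : EuclideanSpace ℝ (Fin 2)} (hw : w ≠ 0) :
    0 < g.val (𝓗.param ψ z) (𝓗.push ψ z (0, w)) (𝓗.push ψ z (0, w)) := by
  refine g.pos_of_orthogonal_null_pair (𝓗.val_nVec_push hψ hz _) (𝓗.rig_null _)
    (𝓗.val_rigAt_nVec hψ hz) (𝓗.val_nVec_push hψ hz _) (𝓗.val_rigAt_push hψ hz w) fun h => ?_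
  exact hw (congrArg Prod.snd (𝓗.push_injective hψ hz h))

theorem q_quadratic (w : EuclideanSpace ℝ (Fin 2)) :
    g.val (𝓗.param ψ z) (𝓗.push ψ z (0, w)) (𝓗.push ψ z (0, w)) =
      w 0 * w 0 * 𝓗.q ψ z 0 0 + 2 * (w 0 * w 1) * 𝓗.q ψ z 0 1 + w 1 * w 1 * 𝓗.q ψ z 1 1 := by
  have h1 : ((0, w) : ℝ × EuclideanSpace ℝ (Fin 2)) =
      w 0 • (0, EuclideanSpace.single 0 (1 : ℝ)) + w 1 • (0, EuclideanSpace.single 1 (1 : ℝ)) := by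
    ext i
    · simp
    · fin_cases i <;> simp
  have h2 : 𝓗.push ψ z (0, w) = w 0 • 𝓗.eVec ψ z 0 + w 1 • 𝓗.eVec ψ z 1 := by
    simp only [push, eVec]
    rw [h1]
    exact (map_add (mfderiv 𝓘(ℝ, ℝ × EuclideanSpace ℝ (Fin 2)) (𝓡 4) (𝓗.param ψ) z) _ _).trans
      (congrArg₂ (· + ·) (map_smul (mfderiv 𝓘(ℝ, ℝ × EuclideanSpace ℝ (Fin 2)) (𝓡 4)
        (𝓗.param ψ) z) _ _) (map_smul (mfderiv 𝓘(ℝ, ℝ × EuclideanSpace ℝ (Fin 2)) (𝓡 4)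
        (𝓗.param ψ) z) _ _))
  rw [h2]
  simp only [map_add, map_smul, LinearMap.add_apply, LinearMap.smul_apply, smul_eq_mul, q,
    Matrix.of_apply]
  rw [g.symm _ (𝓗.eVec ψ z 1) (𝓗.eVec ψ z 0)]
  ring

theorem q_symm (i j : Fin 2) : 𝓗.q ψ z i j = 𝓗.q ψ z j i := g.symm _ _ _

theorem q_zero_zero_pos (hψ : IsSmoothChart ψ) (hz : z.2 ∈ ψ.target) : 0 < 𝓗.q ψ z 0 0 := by
  have h1 : (EuclideanSpace.single 0 1 : EuclideanSpace ℝ (Fin 2)) ≠ 0 := by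
    intro h; simpa using congrArg (fun v => v 0) h
  have h := 𝓗.val_push_pos hψ hz h1
  rw [q_quadratic] at h
  simpa using h

theorem q_det_pos (hψ : IsSmoothChart ψ) (hz : z.2 ∈ ψ.target) : 0 < (𝓗.q ψ z).det := by
  have h0 := 𝓗.q_zero_zero_pos hψ hz
  -- The test vector `(-q₀₁, q₀₀)` has squared length `q₀₀ · det q`.
  have h1 : (!₂[-𝓗.q ψ z 0 1, 𝓗.q ψ z 0 0] : EuclideanSpace ℝ (Fin 2)) ≠ 0 := by
    intro h
    have := congrArg (fun v => v 1) h
    simp at this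
    exact h0.ne' this
  have h := 𝓗.val_push_pos hψ hz h1
  rw [q_quadratic] at h
  simp only [Matrix.cons_val_zero, Matrix.cons_val_one] at h
  rw [Matrix.det_fin_two, 𝓗.q_symm 1 0]
  have h2 : 0 < 𝓗.q ψ z 0 0 * (𝓗.q ψ z 0 0 * 𝓗.q ψ z 1 1 - 𝓗.q ψ z 0 1 * 𝓗.q ψ z 0 1) := by
    nlinarith
  exact (mul_pos_iff_of_pos_left h0).1 h2

/-- The hypersurface in the chart `φ`. -/
noncomputable def chartMap (ψ : S2Chart) (φ : OpenPartialHomeomorph M (EuclideanSpace ℝ (Fin 4)))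
    (z : ℝ × EuclideanSpace ℝ (Fin 2)) : EuclideanSpace ℝ (Fin 4) := φ (𝓗.param ψ z)

theorem chartMap_smooth (hψ : IsSmoothChart ψ) (hz : z.2 ∈ ψ.target) {p₀ : M}
    (hp : 𝓗.param ψ z ∈ (chartAt (EuclideanSpace ℝ (Fin 4)) p₀).source) :
    ContDiffAt ℝ ∞ (𝓗.chartMap ψ (chartAt (EuclideanSpace ℝ (Fin 4)) p₀)) z := by
  have h1 : ContMDiffAt (𝓡 4) (𝓡 4) ∞ (chartAt (EuclideanSpace ℝ (Fin 4)) p₀) (𝓗.param ψ z) :=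
    contMDiffAt_of_mem_maximalAtlas (IsManifold.chart_mem_maximalAtlas p₀) hp
  exact (ContMDiffAt.comp z h1 (𝓗.param_smooth hψ hz)).contDiffAt

theorem fderiv_chartMap (hψ : IsSmoothChart ψ) (hz : z.2 ∈ ψ.target) {p₀ : M}
    (hp : 𝓗.param ψ z ∈ (chartAt (EuclideanSpace ℝ (Fin 4)) p₀).source)
    (v : ℝ × EuclideanSpace ℝ (Fin 2)) :
    fderiv ℝ (𝓗.chartMap ψ (chartAt (EuclideanSpace ℝ (Fin 4)) p₀)) z v =
      vecInChart (chartAt (EuclideanSpace ℝ (Fin 4)) p₀) (𝓗.param ψ z) (𝓗.push ψ z v) := by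
  have h1 := (mdifferentiable_chart (I := 𝓡 4) p₀).mdifferentiableAt hp
  have h2 := mfderiv_comp z h1 ((𝓗.param_smooth hψ hz).mdifferentiableAt (by simp))
  rw [← mfderiv_eq_fderiv]
  exact congrArg (fun f => f v) h2

/-- Smoothness of the rigging in the tangent bundle is tested in the trivialization at `p₀`, whose
fibre map is the derivative of the chart at `p₀`, that is `vecInChart`. -/
theorem rigInChart_smooth (hψ : IsSmoothChart ψ) (hz : z.2 ∈ ψ.target) {p₀ : M}
    (hp : 𝓗.param ψ z ∈ (chartAt (EuclideanSpace ℝ (Fin 4)) p₀).source) :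
    ContDiffAt ℝ ∞ (𝓗.rigInChart ψ (chartAt (EuclideanSpace ℝ (Fin 4)) p₀)) z := by
  have h1 : ContMDiffAt 𝓘(ℝ, ℝ × EuclideanSpace ℝ (Fin 2)) (𝓡 4).tangent ∞
      (fun z => (⟨𝓗.param ψ z, 𝓗.rigAt ψ z⟩ : TangentBundle (𝓡 4) M)) z :=
    ContMDiffAt.comp z (𝓗.rig_smooth (z.1, ψ.symm z.2)) (contMDiffAt_sphereCoord hψ hz)
  have h2 := (Bundle.Trivialization.contMDiffAt_iff (IB := 𝓡 4)
    (e := trivializationAt (EuclideanSpace ℝ (Fin 4)) (TangentSpace (𝓡 4)) p₀)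
    (f := fun z => (⟨𝓗.param ψ z, 𝓗.rigAt ψ z⟩ : TangentBundle (𝓡 4) M)) (x₀ := z) (n := ∞)
    (by rw [Bundle.Trivialization.mem_source]; exact hp)).1 h1
  refine h2.2.contDiffAt.congr_of_eventuallyEq ?_
  have hc : ∀ᶠ x in nhds z,
      𝓗.param ψ x ∈ (chartAt (EuclideanSpace ℝ (Fin 4)) p₀).source :=
    (𝓗.param_smooth hψ hz).continuousAt.eventually
      ((chartAt (EuclideanSpace ℝ (Fin 4)) p₀).open_source.mem_nhds hp)
  filter_upwards [hc] with x hx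
  have h3 := TangentBundle.continuousLinearMapAt_trivializationAt (I := 𝓡 4) hx
  have h4 := Bundle.Trivialization.continuousLinearMapAt_apply_of_mem
    (trivializationAt (EuclideanSpace ℝ (Fin 4)) (TangentSpace (𝓡 4)) p₀) (R := ℝ)
    (b := 𝓗.param ψ x) hx (𝓗.rigAt ψ x)
  rw [← h4, h3]
  rfl

end NullHypersurface

/-! ## Lie derivatives along the rigging -/

theorem fderiv_form_const {E : Type*} [NormedAddCommGroup E] [NormedSpace ℝ E]
    {B : E → E →L[ℝ] E →L[ℝ] ℝ} {x : E} (hB : DifferentiableAt ℝ B x) (a b l : E) :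
    fderiv ℝ (fun x => B x a b) x l = fderiv ℝ B x l a b :=
  fderiv_clm_apply_apply hB (ContinuousLinearMap.id ℝ ℝ) l a b

section LieForm

variable {Z E : Type*} [NormedAddCommGroup Z] [NormedSpace ℝ Z]
  [NormedAddCommGroup E] [NormedSpace ℝ E]

/-- The Lie derivative `(ℒ_L B)(v, w)` of a bilinear form, for a vector field `L` along a map `P`. -/
noncomputable def lieForm (B : E → E →L[ℝ] E →L[ℝ] ℝ) (P L : Z → E) (z v w : Z) : ℝ :=
  fderiv ℝ (fun x => B x (fderiv ℝ P z v) (fderiv ℝ P z w)) (P z) (L z)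
    + B (P z) (fderiv ℝ L z v) (fderiv ℝ P z w) + B (P z) (fderiv ℝ P z v) (fderiv ℝ L z w)

variable {B B' : E → E →L[ℝ] E →L[ℝ] ℝ} {P L P' L' : Z → E} {T : E → E} {z : Z}


/-- Under a coordinate change `T` the second derivatives of `T` enter on one side through the
derivative of `B` along `L`, on the other through the derivatives of `L'`. They match because `D²T`
is symmetric. -/
theorem lieForm_eq_of_transition (hT : ContDiffAt ℝ ∞ T (P z)) (hP : DifferentiableAt ℝ P z)
    (hL : DifferentiableAt ℝ L z) (hB' : DifferentiableAt ℝ B' (T (P z)))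
    (hB : ∀ᶠ x in nhds (P z), ∀ a b, B x a b = B' (T x) (fderiv ℝ T x a) (fderiv ℝ T x b))
    (hP' : P' =ᶠ[nhds z] fun x => T (P x))
    (hL' : L' =ᶠ[nhds z] fun x => fderiv ℝ T (P x) (L x)) (v w : Z) :
    lieForm B P L z v w = lieForm B' P' L' z v w := by
  have hTd := hT.differentiableAt_infty
  have hdT : ContDiffAt ℝ ∞ (fderiv ℝ T) (P z) := hT.fderiv_right (m := ∞) (by simp)
  have hdTd := hdT.differentiableAt_infty
  have hsymm : ∀ a b, fderiv ℝ (fderiv ℝ T) (P z) a b = fderiv ℝ (fderiv ℝ T) (P z) b a := by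
    intro a b
    have hk : ∀ c d, fderiv ℝ (fun x => fderiv ℝ T x d) (P z) c
        = fderiv ℝ (fderiv ℝ T) (P z) c d := by
      intro c d
      rw [fderiv_clm_apply hdTd (differentiableAt_const d)]; simp
    rw [← hk, ← hk]
    exact hT.fderiv_fderiv_comm a b
  have eP : ∀ u, fderiv ℝ P' z u = fderiv ℝ T (P z) (fderiv ℝ P z u) := by
    intro u
    have h1 := fderiv_comp (g := T) z hTd hP
    rw [hP'.fderiv_eq]
    exact congrArg (fun f => f u) h1
  have eL : ∀ u, fderiv ℝ L' z u = fderiv ℝ (fderiv ℝ T) (P z) (fderiv ℝ P z u) (L z)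
      + fderiv ℝ T (P z) (fderiv ℝ L z u) := by
    intro u
    have h1 : fderiv ℝ (fun x => fderiv ℝ T (P x)) z
        = (fderiv ℝ (fderiv ℝ T) (P z)).comp (fderiv ℝ P z) :=
      fderiv_comp (g := fderiv ℝ T) z hdTd hP
    have h2 : DifferentiableAt ℝ (fun x => fderiv ℝ T (P x)) z :=
      DifferentiableAt.comp (g := fderiv ℝ T) z hdTd hP
    rw [hL'.fderiv_eq, fderiv_clm_apply h2 hL, h1]
    simp only [_root_.add_apply, ContinuousLinearMap.comp_apply, ContinuousLinearMap.flip_apply]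
    abel
  have e1 : ∀ a b l, fderiv ℝ (fun x => B x a b) (P z) l =
      fderiv ℝ B' (T (P z)) (fderiv ℝ T (P z) l) (fderiv ℝ T (P z) a) (fderiv ℝ T (P z) b)
      + B' (T (P z)) (fderiv ℝ (fderiv ℝ T) (P z) l a) (fderiv ℝ T (P z) b)
      + B' (T (P z)) (fderiv ℝ T (P z) a) (fderiv ℝ (fderiv ℝ T) (P z) l b) := by
    intro a b l
    have h1 : (fun x => B x a b) =ᶠ[nhds (P z)]
        fun x => B' (T x) (fderiv ℝ T x a) (fderiv ℝ T x b) := hB.mono fun x hx => hx a b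
    have h2 : fderiv ℝ (fun x => B' (T x)) (P z) = (fderiv ℝ B' (T (P z))).comp (fderiv ℝ T (P z)) :=
      fderiv_comp (g := B') (P z) hB' hTd
    have h3 : DifferentiableAt ℝ (fun x => B' (T x)) (P z) :=
      DifferentiableAt.comp (g := B') (P z) hB' hTd
    have h4 : ∀ c, DifferentiableAt ℝ (fun x => fderiv ℝ T x c) (P z) := fun c =>
      hdTd.clm_apply (differentiableAt_const c)
    have h5 : ∀ c u, fderiv ℝ (fun x => fderiv ℝ T x c) (P z) u
        = fderiv ℝ (fderiv ℝ T) (P z) u c := by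
      intro c u
      rw [fderiv_clm_apply hdTd (differentiableAt_const c)]; simp
    rw [h1.fderiv_eq, fderiv_clm_apply (h3.clm_apply (h4 a)) (h4 b), fderiv_clm_apply h3 (h4 a), h2]
    simp only [_root_.add_apply, ContinuousLinearMap.comp_apply, ContinuousLinearMap.flip_apply, h5]
    ring
  have hBz := hB.self_of_nhds
  have p1 : P' z = T (P z) := hP'.self_of_nhds
  have l1 : L' z = fderiv ℝ T (P z) (L z) := hL'.self_of_nhds
  unfold lieForm
  rw [fderiv_form_const (x := P' z) (by rw [p1]; exact hB'), e1, hBz, hBz, p1, l1]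
  simp only [eP, eL, map_add, _root_.add_apply]
  rw [hsymm (fderiv ℝ P z v), hsymm (fderiv ℝ P z w)]
  ring

end LieForm

/-- Metric compatibility replaces `∂_ℓ g` by Christoffel terms, and symmetry of `Γ` lets them
complete `∂ℓ` to `∇ℓ`. -/
theorem lieForm_eq_rigY {G : EuclideanSpace ℝ (Fin 4) → Matrix (Fin 4) (Fin 4) ℝ}
    {P L : ℝ × EuclideanSpace ℝ (Fin 2) → EuclideanSpace ℝ (Fin 4)}
    {z : ℝ × EuclideanSpace ℝ (Fin 2)} (h : IsSmoothMetricAt G (P z))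
    (v w : ℝ × EuclideanSpace ℝ (Fin 2)) :
    lieForm (metricForm G) P L z v w = rigY G P L z v w + rigY G P L z w v := by
  have hd : DifferentiableAt ℝ (metricForm G) (P z) := h.contDiffAt_metricForm.differentiableAt_infty
  rw [lieForm, fderiv_form_const hd, h.isMetricAt (L z), rigY, rigY, covAlong, covAlong,
    h.christoffelMap_comm (L z), h.christoffelMap_comm (L z),
    h.metricForm_comm (fderiv ℝ P z v) (fderiv ℝ L z w),
    h.metricForm_comm (fderiv ℝ P z v) (christoffelMap G (P z) _ _)]
  simp only [map_add, _root_.add_apply]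
  ring

/-! ### Change of spacetime chart. -/

section Transition

variable {M : Type*} [TopologicalSpace M] [ChartedSpace (EuclideanSpace ℝ (Fin 4)) M]

theorem vecInChart_congr (φ : OpenPartialHomeomorph M (EuclideanSpace ℝ (Fin 4))) {p p' : M}
    (h : p = p') (v : EuclideanSpace ℝ (Fin 4)) :
    vecInChart φ p (v : TangentSpace (𝓡 4) p) = vecInChart φ p' (v : TangentSpace (𝓡 4) p') := by
  subst h; rfl

variable [IsManifold (𝓡 4) ∞ M]

theorem contDiffAt_transition (p₀ p₁ : M) {x : EuclideanSpace ℝ (Fin 4)}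
    (hx : x ∈ (chartAt (EuclideanSpace ℝ (Fin 4)) p₀).target)
    (hx' : (chartAt (EuclideanSpace ℝ (Fin 4)) p₀).symm x ∈
      (chartAt (EuclideanSpace ℝ (Fin 4)) p₁).source) :
    ContDiffAt ℝ ∞ (fun x => chartAt (EuclideanSpace ℝ (Fin 4)) p₁
      ((chartAt (EuclideanSpace ℝ (Fin 4)) p₀).symm x)) x := by
  have h1 : ContMDiffAt (𝓡 4) (𝓡 4) ∞ (chartAt (EuclideanSpace ℝ (Fin 4)) p₁)
      ((chartAt (EuclideanSpace ℝ (Fin 4)) p₀).symm x) :=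
    contMDiffAt_of_mem_maximalAtlas (IsManifold.chart_mem_maximalAtlas p₁) hx'
  have h2 : ContMDiffAt (𝓡 4) (𝓡 4) ∞ (chartAt (EuclideanSpace ℝ (Fin 4)) p₀).symm x :=
    contMDiffAt_symm_of_mem_maximalAtlas (IsManifold.chart_mem_maximalAtlas p₀) hx
  exact (ContMDiffAt.comp x h1 h2).contDiffAt

theorem fderiv_transition (p₀ p₁ : M) {x : EuclideanSpace ℝ (Fin 4)}
    (hx : x ∈ (chartAt (EuclideanSpace ℝ (Fin 4)) p₀).target)
    (hx' : (chartAt (EuclideanSpace ℝ (Fin 4)) p₀).symm x ∈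
      (chartAt (EuclideanSpace ℝ (Fin 4)) p₁).source) (a : EuclideanSpace ℝ (Fin 4)) :
    fderiv ℝ (fun x => chartAt (EuclideanSpace ℝ (Fin 4)) p₁
      ((chartAt (EuclideanSpace ℝ (Fin 4)) p₀).symm x)) x a =
    vecInChart (chartAt (EuclideanSpace ℝ (Fin 4)) p₁)
      ((chartAt (EuclideanSpace ℝ (Fin 4)) p₀).symm x)
      (mfderiv (𝓡 4) (𝓡 4) (chartAt (EuclideanSpace ℝ (Fin 4)) p₀).symm x a) := by
  have h1 := (mdifferentiable_chart (I := 𝓡 4) p₁).mdifferentiableAt hx'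
  have h2 := (mdifferentiable_chart (I := 𝓡 4) p₀).mdifferentiableAt_symm hx
  have h3 := mfderiv_comp x h1 h2
  rw [← mfderiv_eq_fderiv]
  exact congrArg (fun f => f a) h3

theorem fderiv_transition_vecInChart (p₀ p₁ : M) {p : M}
    (hp : p ∈ (chartAt (EuclideanSpace ℝ (Fin 4)) p₀).source)
    (hp' : p ∈ (chartAt (EuclideanSpace ℝ (Fin 4)) p₁).source) (v : TangentSpace (𝓡 4) p) :
    fderiv ℝ (fun x => chartAt (EuclideanSpace ℝ (Fin 4)) p₁
      ((chartAt (EuclideanSpace ℝ (Fin 4)) p₀).symm x)) (chartAt (EuclideanSpace ℝ (Fin 4)) p₀ p)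
      (vecInChart (chartAt (EuclideanSpace ℝ (Fin 4)) p₀) p v) =
    vecInChart (chartAt (EuclideanSpace ℝ (Fin 4)) p₁) p v := by
  have hl := (chartAt (EuclideanSpace ℝ (Fin 4)) p₀).left_inv hp
  rw [fderiv_transition p₀ p₁ ((chartAt (EuclideanSpace ℝ (Fin 4)) p₀).map_source hp)
    (by rw [hl]; exact hp')]
  refine Eq.trans ?_ (vecInChart_congr _ hl v)
  exact congrArg (fun w => vecInChart (chartAt (EuclideanSpace ℝ (Fin 4)) p₁) _ w)
    (symm_vecInChart p₀ hp v)

theorem LorentzMetric.metricForm_transition (g : LorentzMetric M) (p₀ p₁ : M)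
    {x : EuclideanSpace ℝ (Fin 4)}
    (hx : x ∈ (chartAt (EuclideanSpace ℝ (Fin 4)) p₀).target)
    (hx' : (chartAt (EuclideanSpace ℝ (Fin 4)) p₀).symm x ∈
      (chartAt (EuclideanSpace ℝ (Fin 4)) p₁).source) (a b : EuclideanSpace ℝ (Fin 4)) :
    metricForm (g.comp (chartAt (EuclideanSpace ℝ (Fin 4)) p₀)) x a b =
      metricForm (g.comp (chartAt (EuclideanSpace ℝ (Fin 4)) p₁))
        (chartAt (EuclideanSpace ℝ (Fin 4)) p₁ ((chartAt (EuclideanSpace ℝ (Fin 4)) p₀).symm x))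
        (fderiv ℝ (fun x => chartAt (EuclideanSpace ℝ (Fin 4)) p₁
          ((chartAt (EuclideanSpace ℝ (Fin 4)) p₀).symm x)) x a)
        (fderiv ℝ (fun x => chartAt (EuclideanSpace ℝ (Fin 4)) p₁
          ((chartAt (EuclideanSpace ℝ (Fin 4)) p₀).symm x)) x b) := by
  rw [fderiv_transition p₀ p₁ hx hx', fderiv_transition p₀ p₁ hx hx', ← g.inChart_eq_metricForm,
    ← g.inChart_eq_metricForm, g.inChart_vecInChart p₁ hx']
  rfl

end Transition

/-! ### The horizon data in a fixed spacetime chart. -/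

namespace NullHypersurface

variable {M : Type*} [TopologicalSpace M] [ChartedSpace (EuclideanSpace ℝ (Fin 4)) M]
  [IsManifold (𝓡 4) ∞ M] {g : LorentzMetric M} (𝓗 : NullHypersurface g)
  {ψ : S2Chart} {z : ℝ × EuclideanSpace ℝ (Fin 2)}

theorem YInChart_eq_lieForm (hψ : IsSmoothChart ψ) (hz : z.2 ∈ ψ.target) {p₀ : M}
    (hp : 𝓗.param ψ z ∈ (chartAt (EuclideanSpace ℝ (Fin 4)) p₀).source)
    (v w : ℝ × EuclideanSpace ℝ (Fin 2)) :
    𝓗.YInChart ψ (chartAt (EuclideanSpace ℝ (Fin 4)) p₀) z v w =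
      (1 / 2) * lieForm (metricForm (g.comp (chartAt (EuclideanSpace ℝ (Fin 4)) p₀)))
        (𝓗.chartMap ψ (chartAt (EuclideanSpace ℝ (Fin 4)) p₀))
        (𝓗.rigInChart ψ (chartAt (EuclideanSpace ℝ (Fin 4)) p₀)) z v w := by
  rw [YInChart, lieForm, 𝓗.fderiv_chartMap hψ hz hp, 𝓗.fderiv_chartMap hψ hz hp]
  simp only [g.inChart_eq_metricForm]
  rfl

theorem eventually_param_mem (hψ : IsSmoothChart ψ) (hz : z.2 ∈ ψ.target) {p₀ : M}
    (hp : 𝓗.param ψ z ∈ (chartAt (EuclideanSpace ℝ (Fin 4)) p₀).source) :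
    ∀ᶠ x in nhds z, x.2 ∈ ψ.target ∧
      𝓗.param ψ x ∈ (chartAt (EuclideanSpace ℝ (Fin 4)) p₀).source :=
  (continuousAt_snd.eventually (ψ.open_target.mem_nhds hz)).and
    ((𝓗.param_smooth hψ hz).continuousAt.eventually
      ((chartAt (EuclideanSpace ℝ (Fin 4)) p₀).open_source.mem_nhds hp))

/-- The tensor `½ ℒ_ℓ g` does not depend on the chart. -/
theorem YInChart_eq (hψ : IsSmoothChart ψ) (hz : z.2 ∈ ψ.target) {p₀ p₁ : M}
    (hp : 𝓗.param ψ z ∈ (chartAt (EuclideanSpace ℝ (Fin 4)) p₀).source)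
    (hp' : 𝓗.param ψ z ∈ (chartAt (EuclideanSpace ℝ (Fin 4)) p₁).source)
    (v w : ℝ × EuclideanSpace ℝ (Fin 2)) :
    𝓗.YInChart ψ (chartAt (EuclideanSpace ℝ (Fin 4)) p₀) z v w =
      𝓗.YInChart ψ (chartAt (EuclideanSpace ℝ (Fin 4)) p₁) z v w := by
  rw [𝓗.YInChart_eq_lieForm hψ hz hp, 𝓗.YInChart_eq_lieForm hψ hz hp']
  congr 1
  set φ := chartAt (EuclideanSpace ℝ (Fin 4)) p₀ with hφ
  set φ' := chartAt (EuclideanSpace ℝ (Fin 4)) p₁ with hφ'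
  have hx : φ (𝓗.param ψ z) ∈ φ.target := φ.map_source hp
  have hl : φ.symm (φ (𝓗.param ψ z)) = 𝓗.param ψ z := φ.left_inv hp
  have hx' : φ.symm (φ (𝓗.param ψ z)) ∈ φ'.source := by rw [hl]; exact hp'
  have hB' : DifferentiableAt ℝ (metricForm (g.comp φ')) (φ' (φ.symm (φ (𝓗.param ψ z)))) :=
    ((g.isSmoothMetricAt_comp p₁ (φ'.map_source hx')).contDiffAt_metricForm).differentiableAt_infty
  refine lieForm_eq_of_transition (P := 𝓗.chartMap ψ φ) (T := fun x => φ' (φ.symm x))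
    (contDiffAt_transition p₀ p₁ hx hx') (𝓗.chartMap_smooth hψ hz hp).differentiableAt_infty
    (𝓗.rigInChart_smooth hψ hz hp).differentiableAt_infty hB' ?_ ?_ ?_ v w
  · have hc : ContinuousAt φ.symm (φ (𝓗.param ψ z)) := φ.continuousAt_symm hx
    filter_upwards [φ.open_target.mem_nhds hx,
      hc.eventually (φ'.open_source.mem_nhds hx')] with x h1 h2 a b
    exact g.metricForm_transition p₀ p₁ h1 h2 a b
  · filter_upwards [𝓗.eventually_param_mem hψ hz hp] with x h1
    simp only [chartMap, φ.left_inv h1.2]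
  · filter_upwards [𝓗.eventually_param_mem hψ hz hp,
      𝓗.eventually_param_mem hψ hz hp'] with x h1 h2
    exact (fderiv_transition_vecInChart p₀ p₁ h1.2 h2.2 _).symm

/-- `Y` is defined in the preferred chart of each point, which may change from point to point.
Expressing it in one chart around the point is what allows it to be differentiated. -/
theorem Y_eq_rigY (hψ : IsSmoothChart ψ) (hz : z.2 ∈ ψ.target) {p₀ : M}
    (hp : 𝓗.param ψ z ∈ (chartAt (EuclideanSpace ℝ (Fin 4)) p₀).source)
    (v w : ℝ × EuclideanSpace ℝ (Fin 2)) :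
    𝓗.Y ψ z v w = (1 / 2) *
      (rigY (g.comp (chartAt (EuclideanSpace ℝ (Fin 4)) p₀))
        (𝓗.chartMap ψ (chartAt (EuclideanSpace ℝ (Fin 4)) p₀))
        (𝓗.rigInChart ψ (chartAt (EuclideanSpace ℝ (Fin 4)) p₀)) z v w
      + rigY (g.comp (chartAt (EuclideanSpace ℝ (Fin 4)) p₀))
        (𝓗.chartMap ψ (chartAt (EuclideanSpace ℝ (Fin 4)) p₀))
        (𝓗.rigInChart ψ (chartAt (EuclideanSpace ℝ (Fin 4)) p₀)) z w v) := by
  have hm := g.isSmoothMetricAt_comp p₀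
    ((chartAt (EuclideanSpace ℝ (Fin 4)) p₀).map_source hp)
  rw [Y, 𝓗.YInChart_eq hψ hz (mem_chart_source _ _) hp, 𝓗.YInChart_eq_lieForm hψ hz hp,
    lieForm_eq_rigY hm]

theorem isAdaptedFrame (hψ : IsSmoothChart ψ) (hz : z.2 ∈ ψ.target) {p₀ : M}
    (hp : 𝓗.param ψ z ∈ (chartAt (EuclideanSpace ℝ (Fin 4)) p₀).source) :
    IsAdaptedFrame (g.comp (chartAt (EuclideanSpace ℝ (Fin 4)) p₀))
      (𝓗.chartMap ψ (chartAt (EuclideanSpace ℝ (Fin 4)) p₀) z)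
      (fderiv ℝ (𝓗.chartMap ψ (chartAt (EuclideanSpace ℝ (Fin 4)) p₀)) z nDir)
      (𝓗.rigInChart ψ (chartAt (EuclideanSpace ℝ (Fin 4)) p₀) z)
      (fun i => fderiv ℝ (𝓗.chartMap ψ (chartAt (EuclideanSpace ℝ (Fin 4)) p₀)) z (eDir i))
      (𝓗.q ψ z) := by
  have key := fun v w => (g.inChart_eq_metricForm _ _ _ _).symm.trans
    (g.inChart_vecInChart p₀ hp v w)
  constructor
  · rw [𝓗.fderiv_chartMap hψ hz hp]
    exact (key _ _).trans (𝓗.val_nVec_push hψ hz _)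
  · intro i
    rw [𝓗.fderiv_chartMap hψ hz hp, 𝓗.fderiv_chartMap hψ hz hp]
    exact (key _ _).trans (𝓗.val_nVec_push hψ hz _)
  · exact (key _ _).trans (𝓗.rig_null _)
  · rw [𝓗.fderiv_chartMap hψ hz hp]
    exact (key _ _).trans (𝓗.val_rigAt_nVec hψ hz)
  · intro i
    rw [𝓗.fderiv_chartMap hψ hz hp]
    exact (key _ _).trans (𝓗.val_rigAt_push hψ hz _)
  · intro i j
    rw [𝓗.fderiv_chartMap hψ hz hp, 𝓗.fderiv_chartMap hψ hz hp]
    exact key _ _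
  · exact isUnit_iff_ne_zero.2 (𝓗.q_det_pos hψ hz).ne'

theorem eventually_isRiggedAt (hψ : IsSmoothChart ψ) (hz : z.2 ∈ ψ.target) {p₀ : M}
    (hp : 𝓗.param ψ z ∈ (chartAt (EuclideanSpace ℝ (Fin 4)) p₀).source) :
    ∀ᶠ x in nhds z, IsRiggedAt (g.comp (chartAt (EuclideanSpace ℝ (Fin 4)) p₀))
      (𝓗.chartMap ψ (chartAt (EuclideanSpace ℝ (Fin 4)) p₀))
      (𝓗.rigInChart ψ (chartAt (EuclideanSpace ℝ (Fin 4)) p₀))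
      (𝓗.q ψ) (𝓗.kappa ψ) (𝓗.Omega ψ) (𝓗.Xi ψ) x := by
  set φ := chartAt (EuclideanSpace ℝ (Fin 4)) p₀ with hφ
  -- The structure is first set up with the data read off from `rigY` itself; this already yields
  -- the symmetry of `rigY`, which then identifies it with `Y = ½ ℒ_ℓ g`.
  have h0 : ∀ᶠ x in nhds z, IsRiggedAt (g.comp φ) (𝓗.chartMap ψ φ) (𝓗.rigInChart ψ φ) (𝓗.q ψ)
      (fun x => -rigY (g.comp φ) (𝓗.chartMap ψ φ) (𝓗.rigInChart ψ φ) x nDir nDir)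
      (fun x i => -rigY (g.comp φ) (𝓗.chartMap ψ φ) (𝓗.rigInChart ψ φ) x nDir (eDir i))
      (fun x i j => rigY (g.comp φ) (𝓗.chartMap ψ φ) (𝓗.rigInChart ψ φ) x (eDir i) (eDir j)) x := by
    filter_upwards [𝓗.eventually_param_mem hψ hz hp] with x hx
    exact ⟨g.isSmoothMetricAt_comp p₀ (φ.map_source hx.2), 𝓗.chartMap_smooth hψ hx.1 hx.2,
      𝓗.rigInChart_smooth hψ hx.1 hx.2, 𝓗.isAdaptedFrame hψ hx.1 hx.2, rfl, fun _ => rfl,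
      fun _ _ => rfl⟩
  filter_upwards [eventually_eventually_nhds.2 h0, 𝓗.eventually_param_mem hψ hz hp] with x h1 hx
  have h2 := h1.self_of_nhds
  have hY : ∀ v w, (v = nDir ∨ ∃ i, v = eDir i) → (w = nDir ∨ ∃ i, w = eDir i) →
      𝓗.Y ψ x v w = rigY (g.comp φ) (𝓗.chartMap ψ φ) (𝓗.rigInChart ψ φ) x v w := by
    intro v w hv hw
    rw [𝓗.Y_eq_rigY hψ hx.1 hx.2, ← hφ, rigged_rigY_comm h1 w v hw hv]
    ring
  exact ⟨h2.metric, h2.map_smooth, h2.rig_smooth, h2.frame,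
    congrArg Neg.neg (hY nDir nDir (Or.inl rfl) (Or.inl rfl)),
    fun i => congrArg Neg.neg (hY nDir (eDir i) (Or.inl rfl) (Or.inr ⟨i, rfl⟩)),
    fun i j => hY (eDir i) (eDir j) (Or.inr ⟨i, rfl⟩) (Or.inr ⟨j, rfl⟩)⟩

end NullHypersurface

/-! ## Non-expanding horizons are shear free -/

theorem matrix_inv_fin_two (A : Matrix (Fin 2) (Fin 2) ℝ) :
    A⁻¹ 0 0 = (A.det)⁻¹ * A 1 1 ∧ A⁻¹ 0 1 = -((A.det)⁻¹ * A 0 1) ∧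
      A⁻¹ 1 0 = -((A.det)⁻¹ * A 1 0) ∧ A⁻¹ 1 1 = (A.det)⁻¹ * A 0 0 := by
  rw [Matrix.inv_def, Ring.inverse_eq_inv', Matrix.adjugate_fin_two]
  simp

/-- Relative to a positive definite metric, a self-adjoint endomorphism of a plane with zero trace
and zero determinant has both eigenvalues zero, hence vanishes. -/
theorem eq_zero_of_det_eq_zero_of_trace_eq_zero {a b c a₁ b₁ c₁ : ℝ} (hd : 0 < a * c - b * b)
    (ha : 0 < a) (htr : c * a₁ - 2 * b * b₁ + a * c₁ = 0) (hdet : a₁ * c₁ - b₁ * b₁ = 0) :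
    a₁ = 0 ∧ b₁ = 0 ∧ c₁ = 0 := by
  have h1 : (c * a₁ + a * c₁) * (c * a₁ + a * c₁) = 4 * (b * b) * (b₁ * b₁) := by
    have : c * a₁ + a * c₁ = 2 * b * b₁ := by linarith
    rw [this]; ring
  -- From `(c a₁ + a c₁)² ≥ 4 (a c)(a₁ c₁)` with `a₁ c₁ = b₁²`; positivity of the determinant then
  -- forces `b₁ = 0`.
  have h2 : (a * c - b * b) * (b₁ * b₁) ≤ 0 := by
    have e : a * c * (b₁ * b₁) = a * c * (a₁ * c₁) := by
      rw [show a₁ * c₁ = b₁ * b₁ by linarith]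
    nlinarith [mul_self_nonneg (c * a₁ - a * c₁)]
  have h3 : b₁ * b₁ = 0 := le_antisymm (by
    by_contra h
    push Not at h
    nlinarith [mul_pos hd h]) (mul_self_nonneg _)
  have hb : b₁ = 0 := mul_self_eq_zero.1 h3
  have hac : a₁ * c₁ = 0 := by linarith
  have hc : 0 < c := by
    by_contra h
    push Not at h
    nlinarith [mul_self_nonneg b, mul_nonneg ha.le (neg_nonneg.2 h)]
  rw [hb] at htr
  rcases mul_eq_zero.1 hac with h | h
  · rw [h] at htr
    have : a * c₁ = 0 := by linarith
    exact ⟨h, hb, (mul_eq_zero.1 this).resolve_left ha.ne'⟩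
  · rw [h] at htr
    have : c * a₁ = 0 := by linarith
    exact ⟨(mul_eq_zero.1 this).resolve_left hc.ne', hb, h⟩

/-- The pointwise algebra of the Raychaudhuri equation for a section metric `A` with first and
second normal derivatives `A₁`, `A₂`. -/
theorem raychaudhuri_algebra {A A₁ A₂ : Matrix (Fin 2) (Fin 2) ℝ} {κ : ℝ} (hd : 0 < A.det)
    (ha : 0 < A 0 0) (hA : A 1 0 = A 0 1) (hA₁ : A₁ 1 0 = A₁ 0 1) (hA₂ : A₂ 1 0 = A₂ 0 1)
    (htr : A 1 1 * A₁ 0 0 - 2 * A 0 1 * A₁ 0 1 + A 0 0 * A₁ 1 1 = 0)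
    (htr' : 2 * A₁ 0 0 * A₁ 1 1 - 2 * A₁ 0 1 * A₁ 0 1
      + (A 1 1 * A₂ 0 0 - 2 * A 0 1 * A₂ 0 1 + A 0 0 * A₂ 1 1) = 0)
    (hR : ∑ i, ∑ j, A⁻¹ i j * (κ * ((1 / 2) * A₁ j i) - (1 / 2) * A₂ j i
      + ∑ k, ∑ l, A⁻¹ k l * ((1 / 2) * A₁ l j) * ((1 / 2) * A₁ k i)) = 0) :
    A₁ 0 0 = 0 ∧ A₁ 0 1 = 0 ∧ A₁ 1 1 = 0 := by
  obtain ⟨i00, i01, i10, i11⟩ := matrix_inv_fin_two A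
  have hdet : A.det = A 0 0 * A 1 1 - A 0 1 * A 0 1 := by rw [Matrix.det_fin_two, hA]
  simp only [Fin.sum_univ_two, i00, i01, i10, i11, hA, hA₁, hA₂] at hR
  have hne := hd.ne'
  -- After clearing the inverses, `htr'`, the derivative of the trace condition, eliminates the
  -- second derivatives `A₂`, and `htr` eliminates the `κ` term and the squared trace. Only `det A ·
  -- det A₁` is left.
  have hR2 : A.det * (A₁ 0 0 * A₁ 1 1 - A₁ 0 1 * A₁ 0 1) = 0 := by
    have h1 := congrArg (fun r => 2 * A.det * A.det * r) hR
    field_simp at h1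
    rw [hdet] at h1 ⊢
    generalize A 0 0 = a at *
    generalize A 0 1 = b at *
    generalize A 1 1 = c at *
    generalize A₁ 0 0 = a₁ at *
    generalize A₁ 0 1 = b₁ at *
    generalize A₁ 1 1 = c₁ at *
    generalize A₂ 0 0 = a₂ at *
    generalize A₂ 0 1 = b₂ at *
    generalize A₂ 1 1 = c₂ at *
    linear_combination (1 / 2) * h1 - (a * c - b * b) * κ * htr
      - (1 / 2) * (c * a₁ - 2 * b * b₁ + a * c₁) * htr + (a * c - b * b) * htr'
  rw [hdet] at hd
  exact eq_zero_of_det_eq_zero_of_trace_eq_zero hd ha htr ((mul_eq_zero.1 hR2).resolve_left hne)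

namespace NullHypersurface

variable {M : Type*} [TopologicalSpace M] [ChartedSpace (EuclideanSpace ℝ (Fin 4)) M]
  [IsManifold (𝓡 4) ∞ M] {g : LorentzMetric M} (𝓗 : NullHypersurface g)
  {ψ : S2Chart} {z : ℝ × EuclideanSpace ℝ (Fin 2)}

theorem eventually_isRiggedAt_self (hψ : IsSmoothChart ψ) (hz : z.2 ∈ ψ.target) :
    ∀ᶠ x in nhds z, IsRiggedAt (g.comp (chartAt (EuclideanSpace ℝ (Fin 4)) (𝓗.param ψ z)))
      (𝓗.chartMap ψ (chartAt (EuclideanSpace ℝ (Fin 4)) (𝓗.param ψ z)))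
      (𝓗.rigInChart ψ (chartAt (EuclideanSpace ℝ (Fin 4)) (𝓗.param ψ z)))
      (𝓗.q ψ) (𝓗.kappa ψ) (𝓗.Omega ψ) (𝓗.Xi ψ) x :=
  𝓗.eventually_isRiggedAt hψ hz (mem_chart_source _ _)

theorem q_smooth (hψ : IsSmoothChart ψ) (hz : z.2 ∈ ψ.target) (i j : Fin 2) :
    ContDiffAt ℝ ∞ (fun x => 𝓗.q ψ x i j) z :=
  rigged_q_smooth (𝓗.eventually_isRiggedAt_self hψ hz) i j

theorem Omega_smooth (hψ : IsSmoothChart ψ) (hz : z.2 ∈ ψ.target) (i : Fin 2) :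
    ContDiffAt ℝ ∞ (fun x => 𝓗.Omega ψ x i) z :=
  rigged_Om_smooth (𝓗.eventually_isRiggedAt_self hψ hz) i

theorem Xi_smooth (hψ : IsSmoothChart ψ) (hz : z.2 ∈ ψ.target) (i j : Fin 2) :
    ContDiffAt ℝ ∞ (fun x => 𝓗.Xi ψ x i j) z :=
  rigged_Xi_smooth (𝓗.eventually_isRiggedAt_self hψ hz) i j

theorem ricci_chart_eq_zero (hvac : 𝓗.IsVacuum) (ψ : S2Chart)
    (z : ℝ × EuclideanSpace ℝ (Fin 2)) (m n : Fin 4) :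
    ricci (g.comp (chartAt (EuclideanSpace ℝ (Fin 4)) (𝓗.param ψ z)))
      (𝓗.chartMap ψ (chartAt (EuclideanSpace ℝ (Fin 4)) (𝓗.param ψ z)) z) m n = 0 :=
  hvac (z.1, ψ.symm z.2) m n

/-- A non-expanding horizon in vacuum has vanishing second fundamental form. -/
theorem fderiv_q_nDir (hNEH : 𝓗.IsNonExpanding) (hvac : 𝓗.IsVacuum) (hψ : IsSmoothChart ψ)
    (hz : z.2 ∈ ψ.target) (i j : Fin 2) : fderiv ℝ (fun x => 𝓗.q ψ x i j) z nDir = 0 := by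
  have hs10 : (fun x => 𝓗.q ψ x 1 0) = fun x => 𝓗.q ψ x 0 1 := funext fun x => 𝓗.q_symm 1 0
  have htr : ∀ x : ℝ × EuclideanSpace ℝ (Fin 2), x.2 ∈ ψ.target →
      𝓗.q ψ x 1 1 * fderiv ℝ (fun x => 𝓗.q ψ x 0 0) x nDir
        - 2 * 𝓗.q ψ x 0 1 * fderiv ℝ (fun x => 𝓗.q ψ x 0 1) x nDir
        + 𝓗.q ψ x 0 0 * fderiv ℝ (fun x => 𝓗.q ψ x 1 1) x nDir = 0 := by
    intro x hx
    have h1 := hNEH ψ hψ x.1 x.2 hx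
    have h2 : ∀ i j, 𝓗.secondFF ψ (x.1, x.2) i j =
        (1 / 2) * fderiv ℝ (fun x => 𝓗.q ψ x i j) x nDir := fun i j => by
      rw [secondFF, (deriv_slice (𝓗.q_smooth hψ hx i j).differentiableAt_infty).deriv]
    obtain ⟨i00, i01, i10, i11⟩ := matrix_inv_fin_two (𝓗.q ψ x)
    have hd := (𝓗.q_det_pos hψ hx).ne'
    simp only [expansion, h2, Fin.sum_univ_two, i00, i01, i10, i11, 𝓗.q_symm 1 0] at h1
    have h3 := congrArg (fun r => 2 * (𝓗.q ψ x).det * r) h1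
    field_simp at h3
    linarith
  have hq := fun i j => (𝓗.q_smooth hψ hz i j)
  have hqd := fun i j => (hq i j).differentiableAt_infty
  have hqdd := fun i j => ((hq i j).fderiv_const_apply nDir).differentiableAt_infty
  have htr' := htr z hz
  -- The expansion, multiplied by `2 det q`, vanishes on a neighbourhood, so its derivative along
  -- `n` vanishes too; this supplies the second-order trace condition.
  have hev : (fun x => 𝓗.q ψ x 1 1 * fderiv ℝ (fun x => 𝓗.q ψ x 0 0) x nDir
        - 2 * 𝓗.q ψ x 0 1 * fderiv ℝ (fun x => 𝓗.q ψ x 0 1) x nDir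
        + 𝓗.q ψ x 0 0 * fderiv ℝ (fun x => 𝓗.q ψ x 1 1) x nDir) =ᶠ[nhds z] fun _ => 0 := by
    filter_upwards [continuousAt_snd.eventually (ψ.open_target.mem_nhds hz)] with x hx
    exact htr x hx
  have hdt := congrArg (fun f : (ℝ × EuclideanSpace ℝ (Fin 2)) →L[ℝ] ℝ => f nDir) hev.fderiv_eq
  simp only [fderiv_fun_const, Pi.zero_apply, _root_.zero_apply] at hdt
  rw [fderiv_fun_add (((hqd 1 1).fun_mul (hqdd 0 0)).fun_sub
      (((hqd 0 1).const_mul 2).fun_mul (hqdd 0 1))) ((hqd 0 0).fun_mul (hqdd 1 1)),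
    fderiv_fun_sub ((hqd 1 1).fun_mul (hqdd 0 0)) (((hqd 0 1).const_mul 2).fun_mul (hqdd 0 1)),
    fderiv_fun_mul (hqd 1 1) (hqdd 0 0), fderiv_fun_mul ((hqd 0 1).const_mul 2) (hqdd 0 1),
    fderiv_fun_mul (hqd 0 0) (hqdd 1 1), fderiv_const_mul (hqd 0 1)] at hdt
  simp only [_root_.add_apply, _root_.sub_apply, _root_.smul_apply, smul_eq_mul] at hdt
  have hR := rigged_raychaudhuri (𝓗.eventually_isRiggedAt_self hψ hz)
    (𝓗.ricci_chart_eq_zero hvac ψ z)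
  obtain ⟨r00, r01, r11⟩ := raychaudhuri_algebra (A := 𝓗.q ψ z)
    (A₁ := Matrix.of fun i j => fderiv ℝ (fun x => 𝓗.q ψ x i j) z nDir)
    (A₂ := Matrix.of fun i j => fderiv ℝ (fun x => fderiv ℝ (fun x' => 𝓗.q ψ x' i j) x nDir) z nDir)
    (𝓗.q_det_pos hψ hz) (𝓗.q_zero_zero_pos hψ hz) (𝓗.q_symm 1 0)
    (by simp only [Matrix.of_apply, hs10]) (by simp only [Matrix.of_apply, hs10])
    htr' (by simp only [Matrix.of_apply]; linarith) hR
  have r10 : fderiv ℝ (fun x => 𝓗.q ψ x 1 0) z nDir = 0 := by rw [hs10]; exact r01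
  fin_cases i <;> fin_cases j
  · exact r00
  · exact r01
  · exact r10
  · exact r11

/-- A function of the coordinates whose derivative along `n` vanishes does not depend on `ξ¹`. -/
theorem eq_of_fderiv_nDir_eq_zero {f : ℝ × EuclideanSpace ℝ (Fin 2) → ℝ} {y : EuclideanSpace ℝ (Fin 2)}
    (hf : ∀ u, DifferentiableAt ℝ f (u, y)) (h0 : ∀ u, fderiv ℝ f (u, y) nDir = 0) (u v : ℝ) :
    f (u, y) = f (v, y) := by
  have hd : ∀ u, HasDerivAt (fun t => f (t, y)) 0 u := fun u => by
    have := deriv_slice (hf u)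
    rwa [h0 u] at this
  exact is_const_of_deriv_eq_zero (fun u => (hd u).differentiableAt) (fun u => (hd u).deriv) u v

theorem q_eq (hNEH : 𝓗.IsNonExpanding) (hvac : 𝓗.IsVacuum) (hψ : IsSmoothChart ψ)
    {y : EuclideanSpace ℝ (Fin 2)} (hy : y ∈ ψ.target) (u v : ℝ) :
    𝓗.q ψ (u, y) = 𝓗.q ψ (v, y) := by
  ext i j
  exact eq_of_fderiv_nDir_eq_zero (f := fun x => 𝓗.q ψ x i j)
    (fun u => (𝓗.q_smooth (z := (u, y)) hψ hy i j).differentiableAt_infty)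
    (fun u => 𝓗.fderiv_q_nDir (z := (u, y)) hNEH hvac hψ hy i j) u v

/-- The metric of the section `ξ¹ = 0`. -/
noncomputable def sliceMetric (ψ : S2Chart) (y : EuclideanSpace ℝ (Fin 2)) :
    Matrix (Fin 2) (Fin 2) ℝ := 𝓗.q ψ (0, y)

theorem isSmoothMetricAt_sliceMetric (hψ : IsSmoothChart ψ) {y : EuclideanSpace ℝ (Fin 2)}
    (hy : y ∈ ψ.target) : IsSmoothMetricAt (𝓗.sliceMetric ψ) y := by
  filter_upwards [ψ.open_target.mem_nhds hy] with x hx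
  refine ⟨fun i j => ?_, ?_, isUnit_iff_ne_zero.2 (𝓗.q_det_pos (z := (0, x)) hψ hx).ne'⟩
  · have h1 : ContDiffAt ℝ ∞ (fun y : EuclideanSpace ℝ (Fin 2) => ((0 : ℝ), y)) x :=
      contDiffAt_const.prodMk contDiffAt_id
    exact ContDiffAt.comp (g := fun x => 𝓗.q ψ x i j) x (𝓗.q_smooth (z := (0, x)) hψ hx i j) h1
  · ext i j
    exact 𝓗.q_symm j i

theorem isShearFreeNear (hNEH : 𝓗.IsNonExpanding) (hvac : 𝓗.IsVacuum) {κ₀ : ℝ}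
    (hκ : 𝓗.GaugeKappa κ₀) (hψ : IsSmoothChart ψ) (hz : z.2 ∈ ψ.target) :
    IsShearFreeNear (g.comp (chartAt (EuclideanSpace ℝ (Fin 4)) (𝓗.param ψ z)))
      (𝓗.chartMap ψ (chartAt (EuclideanSpace ℝ (Fin 4)) (𝓗.param ψ z)))
      (𝓗.rigInChart ψ (chartAt (EuclideanSpace ℝ (Fin 4)) (𝓗.param ψ z)))
      (𝓗.q ψ) (𝓗.kappa ψ) (𝓗.Omega ψ) (𝓗.Xi ψ) (𝓗.sliceMetric ψ) κ₀ z := by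
  have ht : ∀ᶠ x : ℝ × EuclideanSpace ℝ (Fin 2) in nhds z, x.2 ∈ ψ.target :=
    continuousAt_snd.eventually (ψ.open_target.mem_nhds hz)
  refine ⟨𝓗.eventually_isRiggedAt_self hψ hz, ?_, ?_, 𝓗.isSmoothMetricAt_sliceMetric hψ hz⟩
  · filter_upwards [ht] with x hx
    exact 𝓗.q_eq hNEH hvac hψ hx x.1 0
  · filter_upwards [ht] with x hx
    exact hκ.2 ψ hψ x.1 x.2 hx

theorem fderiv_Omega_nDir (hNEH : 𝓗.IsNonExpanding) (hvac : 𝓗.IsVacuum) {κ₀ : ℝ}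
    (hκ : 𝓗.GaugeKappa κ₀) (hψ : IsSmoothChart ψ) (hz : z.2 ∈ ψ.target) (i : Fin 2) :
    fderiv ℝ (fun x => 𝓗.Omega ψ x i) z nDir = 0 :=
  (𝓗.isShearFreeNear hNEH hvac hκ hψ hz).deriv_Om (𝓗.ricci_chart_eq_zero hvac ψ z) i

theorem Omega_eq (hNEH : 𝓗.IsNonExpanding) (hvac : 𝓗.IsVacuum) {κ₀ : ℝ}
    (hκ : 𝓗.GaugeKappa κ₀) (hψ : IsSmoothChart ψ) {y : EuclideanSpace ℝ (Fin 2)}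
    (hy : y ∈ ψ.target) (u v : ℝ) (i : Fin 2) :
    𝓗.Omega ψ (u, y) i = 𝓗.Omega ψ (v, y) i :=
  eq_of_fderiv_nDir_eq_zero (f := fun x => 𝓗.Omega ψ x i)
    (fun u => (𝓗.Omega_smooth (z := (u, y)) hψ hy i).differentiableAt_infty)
    (fun u => 𝓗.fderiv_Omega_nDir (z := (u, y)) hNEH hvac hκ hψ hy i) u v

end NullHypersurface

/-! ## The Weyl scalars of the horizon -/

theorem curvOp_comb {E : Type*} [NormedAddCommGroup E] [NormedSpace ℝ E]
    (Γ : E → E →L[ℝ] E →L[ℝ] E) (x a u v : E) (s t s' t' : ℝ) :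
    curvOp Γ x a (s • u + t • v) (s' • u + t' • v) =
      (s * s') • curvOp Γ x a u u + (s * t') • curvOp Γ x a u v + (t * s') • curvOp Γ x a v u
        + (t * t') • curvOp Γ x a v v := by
  simp only [curvOp, map_add, map_smul, _root_.add_apply, _root_.smul_apply]
  module

/-- The algebra of the Gram-Schmidt frame of a metric `A`. -/
theorem gramSchmidt_trace {A W : Matrix (Fin 2) (Fin 2) ℝ} (hd : 0 < A.det) (ha : 0 < A 0 0)
    (hA : A 1 0 = A 0 1) {a b c : ℝ} (ha' : a = (Real.sqrt (A 0 0))⁻¹)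
    (hb : b = (Real.sqrt (A.det / A 0 0))⁻¹) (hc : c = A 0 1 / A 0 0) :
    a * a * W 0 0 + (b * b * W 1 1 - b * b * c * W 0 1 - b * b * c * W 1 0
      + b * b * c * c * W 0 0) = ∑ i, ∑ j, A⁻¹ i j * W i j ∧ a * b = (Real.sqrt A.det)⁻¹ := by
  have h1 : a * a = (A 0 0)⁻¹ := by rw [ha', ← mul_inv, Real.mul_self_sqrt ha.le]
  have h2 : b * b = A 0 0 / A.det := by
    rw [hb, ← mul_inv, Real.mul_self_sqrt (div_pos hd ha).le, inv_div]
  obtain ⟨i00, i01, i10, i11⟩ := matrix_inv_fin_two A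
  constructor
  · simp only [Fin.sum_univ_two, i00, i01, i10, i11, hA, h1, h2, hc]
    have hdet : A 1 1 = (A.det + A 0 1 * A 0 1) / A 0 0 := by
      rw [Matrix.det_fin_two, hA]; field_simp; ring
    rw [hdet]
    have hd' := hd.ne'
    have ha' := ha.ne'
    generalize A.det = D at *
    field_simp
    ring
  · rw [ha', hb, ← mul_inv, ← Real.sqrt_mul ha.le, mul_div_cancel₀ _ ha.ne']

namespace NullHypersurface

variable {M : Type*} [TopologicalSpace M] [ChartedSpace (EuclideanSpace ℝ (Fin 4)) M]
  [IsManifold (𝓡 4) ∞ M] {g : LorentzMetric M} (𝓗 : NullHypersurface g)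
  {ψ : S2Chart} {z : ℝ × EuclideanSpace ℝ (Fin 2)}

theorem Y_symm (hψ : IsSmoothChart ψ) (hz : z.2 ∈ ψ.target) (v w : ℝ × EuclideanSpace ℝ (Fin 2)) :
    𝓗.Y ψ z v w = 𝓗.Y ψ z w v := by
  rw [𝓗.Y_eq_rigY hψ hz (mem_chart_source _ _), 𝓗.Y_eq_rigY hψ hz (mem_chart_source _ _), add_comm]

theorem Xi_symm (hψ : IsSmoothChart ψ) (hz : z.2 ∈ ψ.target) (i j : Fin 2) :
    𝓗.Xi ψ z i j = 𝓗.Xi ψ z j i := 𝓗.Y_symm hψ hz _ _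

theorem fderiv_Xi_symm (hψ : IsSmoothChart ψ) (hz : z.2 ∈ ψ.target) (i j : Fin 2)
    (v : ℝ × EuclideanSpace ℝ (Fin 2)) :
    fderiv ℝ (fun x => 𝓗.Xi ψ x i j) z v = fderiv ℝ (fun x => 𝓗.Xi ψ x j i) z v := by
  have : (fun x => 𝓗.Xi ψ x i j) =ᶠ[nhds z] fun x => 𝓗.Xi ψ x j i := by
    filter_upwards [continuousAt_snd.eventually (ψ.open_target.mem_nhds hz)] with x hx
    exact 𝓗.Xi_symm hψ hx i j
  rw [this.fderiv_eq]

/-- `vecInChart` of the tangent vector with components `a, b` in the frame `e₀, e₁`. -/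
theorem vecInChart_comb (hψ : IsSmoothChart ψ) (hz : z.2 ∈ ψ.target) (a b : ℝ) :
    vecInChart (chartAt (EuclideanSpace ℝ (Fin 4)) (𝓗.param ψ z)) (𝓗.param ψ z)
      (a • 𝓗.eVec ψ z 0 + b • 𝓗.eVec ψ z 1) =
    a • fderiv ℝ (𝓗.chartMap ψ (chartAt (EuclideanSpace ℝ (Fin 4)) (𝓗.param ψ z))) z (eDir 0)
      + b • fderiv ℝ (𝓗.chartMap ψ (chartAt (EuclideanSpace ℝ (Fin 4)) (𝓗.param ψ z))) z (eDir 1) := by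
  rw [𝓗.fderiv_chartMap hψ hz (mem_chart_source _ _), 𝓗.fderiv_chartMap hψ hz (mem_chart_source _ _)]
  let f : TangentSpace (𝓡 4) (𝓗.param ψ z) →L[ℝ] EuclideanSpace ℝ (Fin 4) :=
    mfderiv (𝓡 4) (𝓡 4) (chartAt (EuclideanSpace ℝ (Fin 4)) (𝓗.param ψ z)) (𝓗.param ψ z)
  have hf : ∀ v, vecInChart (chartAt (EuclideanSpace ℝ (Fin 4)) (𝓗.param ψ z)) (𝓗.param ψ z) v
    = f v := fun _ => rfl
  rw [hf, hf, hf, map_add, map_smul, map_smul]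
  rfl

/-- `C(n, u, ℓ, v) = g(n, R(ℓ, v) u) = g(ℓ, R(n, u) v) = -W(u, v)` for `u` and `v` tangent to the
section, expanded bilinearly. -/
theorem contract4_weyl_n_rig (hNEH : 𝓗.IsNonExpanding) (hvac : 𝓗.IsVacuum) {κ₀ : ℝ}
    (hκ : 𝓗.GaugeKappa κ₀) (hψ : IsSmoothChart ψ) (hz : z.2 ∈ ψ.target)
    (u v : TangentSpace (𝓡 4) (𝓗.param ψ z)) (s t s' t' : ℝ)
    (hu : u = s • 𝓗.eVec ψ z 0 + t • 𝓗.eVec ψ z 1)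
    (hv : v = s' • 𝓗.eVec ψ z 0 + t' • 𝓗.eVec ψ z 1) :
    g.weylAt (𝓗.param ψ z) (complexComp _ (𝓗.nVec ψ z)) (complexComp _ u)
      (complexComp _ (𝓗.rigAt ψ z)) (complexComp _ v) =
    ((-(s * s' * curvW (𝓗.sliceMetric ψ) κ₀ (𝓗.Omega ψ) (𝓗.Xi ψ) z 0 0
      + s * t' * curvW (𝓗.sliceMetric ψ) κ₀ (𝓗.Omega ψ) (𝓗.Xi ψ) z 0 1
      + t * s' * curvW (𝓗.sliceMetric ψ) κ₀ (𝓗.Omega ψ) (𝓗.Xi ψ) z 1 0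
      + t * t' * curvW (𝓗.sliceMetric ψ) κ₀ (𝓗.Omega ψ) (𝓗.Xi ψ) z 1 1) : ℝ) : ℂ) := by
  have hsf := 𝓗.isShearFreeNear hNEH hvac hκ hψ hz
  have h1 := contract4_weyl hsf.rigged.self_of_nhds.metric (𝓗.ricci_chart_eq_zero hvac ψ z)
    (vecInChart (chartAt (EuclideanSpace ℝ (Fin 4)) (𝓗.param ψ z)) (𝓗.param ψ z) (𝓗.nVec ψ z))
    (vecInChart (chartAt (EuclideanSpace ℝ (Fin 4)) (𝓗.param ψ z)) (𝓗.param ψ z) u)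
    (𝓗.rigInChart ψ (chartAt (EuclideanSpace ℝ (Fin 4)) (𝓗.param ψ z)) z)
    (vecInChart (chartAt (EuclideanSpace ℝ (Fin 4)) (𝓗.param ψ z)) (𝓗.param ψ z) v)
  refine Eq.trans h1 (congrArg _ ?_)
  have hn : vecInChart (chartAt (EuclideanSpace ℝ (Fin 4)) (𝓗.param ψ z)) (𝓗.param ψ z)
      (𝓗.nVec ψ z) = fderiv ℝ (𝓗.chartMap ψ (chartAt (EuclideanSpace ℝ (Fin 4)) (𝓗.param ψ z))) z
        nDir := (𝓗.fderiv_chartMap hψ hz (mem_chart_source _ _) nDir).symm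
  rw [hn, hsf.n_curv_rig, hu, hv, 𝓗.vecInChart_comb hψ hz, 𝓗.vecInChart_comb hψ hz, curvOp_comb]
  simp only [map_add, map_smul, hsf.rig_curv_n_e_e, smul_eq_mul]
  ring

/-- The twist `∂₂ Ω₃ - ∂₃ Ω₂` of the Hajicek one-form. -/
noncomputable def twist (ψ : S2Chart) (z : ℝ × EuclideanSpace ℝ (Fin 2)) : ℝ :=
  fderiv ℝ (fun x => 𝓗.Omega ψ x 1) z (eDir 0) - fderiv ℝ (fun x => 𝓗.Omega ψ x 0) z (eDir 1)

theorem frame_zero : 𝓗.frame ψ z 0 = (Real.sqrt (𝓗.q ψ z 0 0))⁻¹ • 𝓗.eVec ψ z 0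
    + (0 : ℝ) • 𝓗.eVec ψ z 1 := by
  rw [frame, if_pos rfl, zero_smul, add_zero]

theorem frame_one : 𝓗.frame ψ z 1 =
    (-((Real.sqrt ((𝓗.q ψ z).det / 𝓗.q ψ z 0 0))⁻¹ * (𝓗.q ψ z 0 1 / 𝓗.q ψ z 0 0)))
      • 𝓗.eVec ψ z 0 + (Real.sqrt ((𝓗.q ψ z).det / 𝓗.q ψ z 0 0))⁻¹ • 𝓗.eVec ψ z 1 := by
  rw [frame, if_neg (by simp)]
  module

/-- The real part is `-½ tr W`, and symmetrised `W` is half the intrinsic Ricci tensor. The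
imaginary part comes from the antisymmetric part of `W`, rescaled by the area factor of the
orthonormal frame. -/
theorem Psi2_eq (hNEH : 𝓗.IsNonExpanding) (hvac : 𝓗.IsVacuum) {κ₀ : ℝ}
    (hκ : 𝓗.GaugeKappa κ₀) (hψ : IsSmoothChart ψ) (hz : z.2 ∈ ψ.target) :
    𝓗.Psi2 ψ z = ((-(1 / 4) * ∑ i, ∑ j, (𝓗.q ψ z)⁻¹ i j * ricci (𝓗.sliceMetric ψ) z.2 i j : ℝ) : ℂ)
      + Complex.I / 2 * ((𝓗.twist ψ z * (Real.sqrt (𝓗.q ψ z).det)⁻¹ : ℝ) : ℂ) := by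
  have hsf := 𝓗.isShearFreeNear hNEH hvac hκ hψ hz
  have h1 : 𝓗.Psi2 ψ z = _ := contract4_null_pair (weyl (g.comp (chartAt (EuclideanSpace ℝ (Fin 4))
      (𝓗.param ψ z))) (𝓗.chartMap ψ (chartAt (EuclideanSpace ℝ (Fin 4)) (𝓗.param ψ z)) z))
    (complexComp _ (𝓗.nVec ψ z)) (complexComp _ (𝓗.rigAt ψ z))
    (complexComp _ (𝓗.frame ψ z 0)) (complexComp _ (𝓗.frame ψ z 1))
  have key := fun u v s t s' t' hu hv => 𝓗.contract4_weyl_n_rig hNEH hvac hκ hψ hz u v s t s' t' hu hv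
  have k00 := key _ _ _ _ _ _ 𝓗.frame_zero 𝓗.frame_zero
  have k01 := key _ _ _ _ _ _ 𝓗.frame_zero 𝓗.frame_one
  have k10 := key _ _ _ _ _ _ 𝓗.frame_one 𝓗.frame_zero
  have k11 := key _ _ _ _ _ _ 𝓗.frame_one 𝓗.frame_one
  rw [h1]
  refine Eq.trans (congrArg₂ (fun r s => (1 / 2) * (r + s)) (congrArg₂ (· + ·) k00 k11)
    (congrArg (Complex.I * ·) (congrArg₂ (· - ·) k10 k01))) ?_
  set W : Matrix (Fin 2) (Fin 2) ℝ :=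
    Matrix.of (curvW (𝓗.sliceMetric ψ) κ₀ (𝓗.Omega ψ) (𝓗.Xi ψ) z) with hW
  have hWs : ∀ i j, curvW (𝓗.sliceMetric ψ) κ₀ (𝓗.Omega ψ) (𝓗.Xi ψ) z i j = W i j := fun _ _ => rfl
  obtain ⟨g1, g2⟩ := gramSchmidt_trace (W := W) (𝓗.q_det_pos hψ hz) (𝓗.q_zero_zero_pos hψ hz)
    (𝓗.q_symm 1 0) rfl rfl rfl
  simp only [hWs]
  set a := (Real.sqrt (𝓗.q ψ z 0 0))⁻¹
  set b := (Real.sqrt ((𝓗.q ψ z).det / 𝓗.q ψ z 0 0))⁻¹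
  set c := 𝓗.q ψ z 0 1 / 𝓗.q ψ z 0 0
  have hric : ∑ i, ∑ j, (𝓗.q ψ z)⁻¹ i j * ricci (𝓗.sliceMetric ψ) z.2 i j =
      2 * ∑ i, ∑ j, (𝓗.q ψ z)⁻¹ i j * W i j := by
    have hv := 𝓗.ricci_chart_eq_zero hvac ψ z
    obtain ⟨i00, i01, i10, i11⟩ := matrix_inv_fin_two (𝓗.q ψ z)
    simp only [← hsf.curvW_symm hv, hWs, Fin.sum_univ_two, i01, i10, 𝓗.q_symm 1 0]
    ring
  -- `Ξ` and the Christoffel symbols are symmetric, so only `dΩ` survives antisymmetrisation.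
  have htw : W 0 1 - W 1 0 = 𝓗.twist ψ z := by
    have hc := fun k => (𝓗.isSmoothMetricAt_sliceMetric hψ hz).christoffel_comm k 0 1
    simp only [hW, Matrix.of_apply, curvW, twist, hc, 𝓗.Xi_symm hψ hz 0 1,
      𝓗.fderiv_Xi_symm hψ hz 0 1]
    ring
  rw [hric, ← htw, ← g1, ← g2]
  push_cast
  ring

/-- `Ψ₃ = g(n, R(m̄, ℓ) ℓ)`, evaluated with the mixed Ricci equation. At a point with `q = 1` the
orthonormal frame is the coordinate frame and the trace is an ordinary sum. -/
theorem Psi3_eq (hNEH : 𝓗.IsNonExpanding) (hvac : 𝓗.IsVacuum) {κ₀ : ℝ}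
    (hκ : 𝓗.GaugeKappa κ₀) (hψ : IsSmoothChart ψ) (hz : z.2 ∈ ψ.target) (hq : 𝓗.q ψ z = 1) :
    𝓗.Psi3 ψ z = (1 / (Real.sqrt 2 : ℂ)) *
      hat (fun i => ∑ a, curvC (𝓗.sliceMetric ψ) (𝓗.Omega ψ) (𝓗.Xi ψ) z a i a) := by
  have hsf := 𝓗.isShearFreeNear hNEH hvac hκ hψ hz
  have f0 : 𝓗.frame ψ z 0 = 𝓗.eVec ψ z 0 := by rw [frame_zero, hq]; simp
  have f1 : 𝓗.frame ψ z 1 = 𝓗.eVec ψ z 1 := by rw [frame_one, hq]; simp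
  have h1 : 𝓗.Psi3 ψ z = _ := contract4_conj (weyl (g.comp (chartAt (EuclideanSpace ℝ (Fin 4))
      (𝓗.param ψ z))) (𝓗.chartMap ψ (chartAt (EuclideanSpace ℝ (Fin 4)) (𝓗.param ψ z)) z))
    (complexComp _ (𝓗.nVec ψ z)) (complexComp _ (𝓗.rigAt ψ z)) (complexComp _ (𝓗.rigAt ψ z))
    (complexComp _ (𝓗.frame ψ z 0)) (complexComp _ (𝓗.frame ψ z 1))
  rw [f0, f1] at h1
  have key : ∀ i, contract4 (weyl (g.comp (chartAt (EuclideanSpace ℝ (Fin 4))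
      (𝓗.param ψ z))) (𝓗.chartMap ψ (chartAt (EuclideanSpace ℝ (Fin 4)) (𝓗.param ψ z)) z))
      (complexComp _ (𝓗.nVec ψ z)) (complexComp _ (𝓗.rigAt ψ z)) (complexComp _ (𝓗.eVec ψ z i))
      (complexComp _ (𝓗.rigAt ψ z)) =
      ((∑ a, curvC (𝓗.sliceMetric ψ) (𝓗.Omega ψ) (𝓗.Xi ψ) z a i a : ℝ) : ℂ) := by
    intro i
    refine Eq.trans (contract4_weyl hsf.rigged.self_of_nhds.metric (𝓗.ricci_chart_eq_zero hvac ψ z)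
      (vecInChart (chartAt (EuclideanSpace ℝ (Fin 4)) (𝓗.param ψ z)) (𝓗.param ψ z) (𝓗.nVec ψ z))
      (𝓗.rigInChart ψ (chartAt (EuclideanSpace ℝ (Fin 4)) (𝓗.param ψ z)) z)
      (vecInChart (chartAt (EuclideanSpace ℝ (Fin 4)) (𝓗.param ψ z)) (𝓗.param ψ z) (𝓗.eVec ψ z i))
      (𝓗.rigInChart ψ (chartAt (EuclideanSpace ℝ (Fin 4)) (𝓗.param ψ z)) z)) (congrArg _ ?_)
    have h2 := hsf.n_curv_e_rig_rig (𝓗.ricci_chart_eq_zero hvac ψ z) i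
    have hn : vecInChart (chartAt (EuclideanSpace ℝ (Fin 4)) (𝓗.param ψ z)) (𝓗.param ψ z)
        (𝓗.nVec ψ z) = fderiv ℝ (𝓗.chartMap ψ (chartAt (EuclideanSpace ℝ (Fin 4))
        (𝓗.param ψ z))) z nDir := (𝓗.fderiv_chartMap hψ hz (mem_chart_source _ _) nDir).symm
    have he : vecInChart (chartAt (EuclideanSpace ℝ (Fin 4)) (𝓗.param ψ z)) (𝓗.param ψ z)
        (𝓗.eVec ψ z i) = fderiv ℝ (𝓗.chartMap ψ (chartAt (EuclideanSpace ℝ (Fin 4))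
        (𝓗.param ψ z))) z (eDir i) := (𝓗.fderiv_chartMap hψ hz (mem_chart_source _ _) (eDir i)).symm
    rw [hn, he, h2, hq]
    simp [Matrix.one_apply]
  rw [h1, key, key, hat]

end NullHypersurface

/-! ## Curvature in two dimensions -/

section RiemannSymmetries

variable {d : ℕ} {G : EuclideanSpace ℝ (Fin d) → Matrix (Fin d) (Fin d) ℝ}
  {x : EuclideanSpace ℝ (Fin d)}

theorem IsSmoothMetricAt.metricForm_curvOp_single (h : IsSmoothMetricAt G x) (s r m n : Fin d) :
    metricForm G x (curvOp (christoffelMap G) x (EuclideanSpace.single m 1)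
      (EuclideanSpace.single n 1) (EuclideanSpace.single r 1)) (EuclideanSpace.single s 1) =
      riemannLow G x s r m n := by
  rw [h.metricForm_curvOp]
  simp only [PiLp.single_apply, mul_ite, mul_one, mul_zero, Finset.sum_ite_eq',
    Finset.mem_univ, if_true]

theorem IsSmoothMetricAt.riemannLow_antisymm_left (h : IsSmoothMetricAt G x) (s r m n : Fin d) :
    riemannLow G x s r m n = -riemannLow G x r s m n := by
  rw [← h.metricForm_curvOp_single, h.curvOp_antisymm_right, h.metricForm_curvOp_single]

theorem riemannUp_antisymm_right (G : EuclideanSpace ℝ (Fin d) → Matrix (Fin d) (Fin d) ℝ)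
    (x : EuclideanSpace ℝ (Fin d)) (s r m n : Fin d) :
    riemannUp G x s r m n = -riemannUp G x s r n m := by
  simp only [riemannUp, Finset.sum_sub_distrib]
  ring

theorem riemannLow_antisymm_right (G : EuclideanSpace ℝ (Fin d) → Matrix (Fin d) (Fin d) ℝ)
    (x : EuclideanSpace ℝ (Fin d)) (s r m n : Fin d) :
    riemannLow G x s r m n = -riemannLow G x s r n m := by
  simp only [riemannLow, riemannUp_antisymm_right G x _ r m n, mul_neg, Finset.sum_neg_distrib]

theorem IsSmoothMetricAt.riemannUp_eq (h : IsSmoothMetricAt G x) (s r m n : Fin d) :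
    riemannUp G x s r m n = ∑ a, (G x)⁻¹ s a * riemannLow G x a r m n := by
  have h1 : (fun a => riemannLow G x a r m n) = (G x).mulVec (fun a => riemannUp G x a r m n) := rfl
  have h2 := congrFun (congrArg (G x)⁻¹.mulVec h1) s
  rw [Matrix.mulVec_mulVec, Matrix.nonsing_inv_mul _ h.self_of_nhds.2.2, Matrix.one_mulVec] at h2
  exact h2.symm

end RiemannSymmetries

section TwoDimensions

variable {Q : EuclideanSpace ℝ (Fin 2) → Matrix (Fin 2) (Fin 2) ℝ} {y : EuclideanSpace ℝ (Fin 2)}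

/-- The Ricci tensor of a surface is a multiple of the metric. -/
theorem IsSmoothMetricAt.ricci_fin_two (h : IsSmoothMetricAt Q y) (i j : Fin 2) :
    ricci Q y i j = ((Q y).det)⁻¹ * riemannLow Q y 0 1 0 1 * Q y i j := by
  have hs : Q y 1 0 = Q y 0 1 := h.self_of_nhds.2.1.apply 0 1
  have a1 : ∀ s m n, riemannLow Q y s s m n = 0 := fun s m n => by
    have := h.riemannLow_antisymm_left s s m n; linarith
  have a2 : ∀ s r m, riemannLow Q y s r m m = 0 := fun s r m => by
    have := riemannLow_antisymm_right Q y s r m m; linarith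
  have a3 := h.riemannLow_antisymm_left 1 0 0 1
  have a4 := h.riemannLow_antisymm_left 1 0 1 0
  have a5 := riemannLow_antisymm_right Q y 0 1 1 0
  obtain ⟨i00, i01, i10, i11⟩ := matrix_inv_fin_two (Q y)
  fin_cases i <;> fin_cases j <;>
    simp [ricci, h.riemannUp_eq, Fin.sum_univ_two, i00, i01, i10, i11, a1, a2, a3, a4, a5, hs] <;>
    ring

theorem pd_congr {n : ℕ} {F : Type*} [NormedAddCommGroup F] [NormedSpace ℝ F]
    {f f' : EuclideanSpace ℝ (Fin n) → F} {x : EuclideanSpace ℝ (Fin n)} (h : f =ᶠ[nhds x] f')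
    (i : Fin n) : pd f i x = pd f' i x := by rw [pd, h.fderiv_eq, pd]

theorem pd_add {n : ℕ} {f f' : EuclideanSpace ℝ (Fin n) → ℝ} {x : EuclideanSpace ℝ (Fin n)}
    (hf : DifferentiableAt ℝ f x) (hf' : DifferentiableAt ℝ f' x) (i : Fin n) :
    pd (fun y => f y + f' y) i x = pd f i x + pd f' i x := by
  rw [pd, fderiv_fun_add hf hf', _root_.add_apply]; rfl

theorem pd_sub {n : ℕ} {f f' : EuclideanSpace ℝ (Fin n) → ℝ} {x : EuclideanSpace ℝ (Fin n)}
    (hf : DifferentiableAt ℝ f x) (hf' : DifferentiableAt ℝ f' x) (i : Fin n) :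
    pd (fun y => f y - f' y) i x = pd f i x - pd f' i x := by
  rw [pd, fderiv_fun_sub hf hf', _root_.sub_apply]; rfl

theorem pd_mul {n : ℕ} {f f' : EuclideanSpace ℝ (Fin n) → ℝ} {x : EuclideanSpace ℝ (Fin n)}
    (hf : DifferentiableAt ℝ f x) (hf' : DifferentiableAt ℝ f' x) (i : Fin n) :
    pd (fun y => f y * f' y) i x = f x * pd f' i x + f' x * pd f i x := by
  rw [pd, fderiv_fun_mul hf hf', _root_.add_apply, _root_.smul_apply, _root_.smul_apply]; rfl

theorem pd_const_mul {n : ℕ} {f : EuclideanSpace ℝ (Fin n) → ℝ} {x : EuclideanSpace ℝ (Fin n)}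
    (hf : DifferentiableAt ℝ f x) (c : ℝ) (i : Fin n) :
    pd (fun y => c * f y) i x = c * pd f i x := by
  rw [pd, fderiv_const_mul hf c, _root_.smul_apply]; rfl

theorem ContDiffAt.pd {n : ℕ} {f : EuclideanSpace ℝ (Fin n) → ℝ} {x : EuclideanSpace ℝ (Fin n)}
    (hf : ContDiffAt ℝ ∞ f x) (i : Fin n) : ContDiffAt ℝ ∞ (fun y => pd f i y) x :=
  hf.fderiv_const_apply _

theorem christoffel_eq_of_eq_one (hQ : Q y = 1) (k i j : Fin 2) :
    christoffel Q y k i j = (1 / 2) * (pd (fun x => Q x j k) i y + pd (fun x => Q x i k) j y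
      - pd (fun x => Q x i j) k y) := by
  rw [christoffel, hQ, inv_one]
  congr 1
  simp [Matrix.one_apply]

/-- The trace with respect to a metric. -/
theorem sum_inv_mul_fin_two {A B : Matrix (Fin 2) (Fin 2) ℝ} (hd : A.det ≠ 0)
    (hA : A 1 0 = A 0 1) {t : ℝ} (h : ∑ i, ∑ j, A⁻¹ i j * B i j = t) :
    A 1 1 * B 0 0 - A 0 1 * (B 0 1 + B 1 0) + A 0 0 * B 1 1 =
      t * (A 0 0 * A 1 1 - A 0 1 * A 0 1) := by
  obtain ⟨i00, i01, i10, i11⟩ := matrix_inv_fin_two A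
  have hdet : A.det = A 0 0 * A 1 1 - A 0 1 * A 0 1 := by rw [Matrix.det_fin_two, hA]
  rw [← hdet, ← h]
  simp only [Fin.sum_univ_two, i00, i01, i10, i11, hA]
  field_simp
  ring

/-- The derivative of the density `F / √det Q` at a point where `Q` is the unit matrix. -/
theorem pd_mul_inv_sqrt_det (h : IsSmoothMetricAt Q y) (hQ : Q y = 1)
    {f : EuclideanSpace ℝ (Fin 2) → ℝ} (hf : DifferentiableAt ℝ f y) (b : Fin 2) :
    pd (fun x => f x * (Real.sqrt (Q x).det)⁻¹) b y =
      pd f b y - (1 / 2) * (pd (fun x => Q x 0 0) b y + pd (fun x => Q x 1 1) b y) * f y := by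
  have hq := fun i j => (h.self_of_nhds.1 i j).differentiableAt_infty
  -- At the identity matrix the derivative of the determinant is the trace of the derivative.
  have h1 : HasFDerivAt (fun x => (Q x).det) (fderiv ℝ (fun x => Q x 0 0) y
      + fderiv ℝ (fun x => Q x 1 1) y) y := by
    have := ((hq 0 0).hasFDerivAt.mul (hq 1 1).hasFDerivAt).sub
      ((hq 0 1).hasFDerivAt.mul (hq 1 0).hasFDerivAt)
    simp only [hQ, Matrix.one_apply_eq, ne_eq, zero_ne_one, one_ne_zero, not_false_eq_true,
      Matrix.one_apply_ne, one_smul, zero_smul, sub_zero, add_zero] at this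
    rw [add_comm] at this
    refine this.congr_of_eventuallyEq (Filter.Eventually.of_forall fun x => ?_)
    simp [Matrix.det_fin_two]
  have hd1 : (Q y).det = 1 := by rw [hQ, Matrix.det_one]
  have h2 := h1.sqrt (by rw [hd1]; norm_num)
  have h3 := (hasDerivAt_inv (by rw [hd1]; norm_num : Real.sqrt (Q y).det ≠ 0)).comp_hasFDerivAt y h2
  have h4 := (hf.hasFDerivAt.mul h3).fderiv
  refine (congrArg (fun L : EuclideanSpace ℝ (Fin 2) →L[ℝ] ℝ => L (EuclideanSpace.single b 1))
    h4).trans ?_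
  simp [hd1, pd]
  ring

end TwoDimensions

/-! ### The divergence of the traceless source. -/

section DivergenceIdentity

variable {Q : EuclideanSpace ℝ (Fin 2) → Matrix (Fin 2) (Fin 2) ℝ} {y : EuclideanSpace ℝ (Fin 2)}
  {w : EuclideanSpace ℝ (Fin 2) → Fin 2 → ℝ} {X : EuclideanSpace ℝ (Fin 2) → Fin 2 → Fin 2 → ℝ}
  {S : EuclideanSpace ℝ (Fin 2) → Matrix (Fin 2) (Fin 2) ℝ} {θ : EuclideanSpace ℝ (Fin 2) → ℝ}
  {κ : ℝ}

theorem pd_pd_comm {f : EuclideanSpace ℝ (Fin 2) → ℝ} (hf : ContDiffAt ℝ ∞ f y) (i j : Fin 2) :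
    pd (fun x => pd f i x) j y = pd (fun x => pd f j x) i y :=
  hf.fderiv_fderiv_comm _ _

theorem symmCov_eq (h : IsSmoothMetricAt Q y) (i j : Fin 2) :
    (1 / 2) * (covOneForm Q w y i j + covOneForm Q w y j i) =
      (1 / 2) * (pd (fun x => w x j) i y + pd (fun x => w x i) j y)
        - (christoffel Q y 0 i j * w y 0 + christoffel Q y 1 i j * w y 1) := by
  simp only [covOneForm, Fin.sum_univ_two, h.christoffel_comm _ j i]
  ring

theorem pd_symmCov (h : IsSmoothMetricAt Q y) (hw : ∀ i, ContDiffAt ℝ ∞ (fun x => w x i) y)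
    (k i j : Fin 2) :
    pd (fun x => (1 / 2) * (covOneForm Q w x i j + covOneForm Q w x j i)) k y =
      (1 / 2) * (pd (fun x => pd (fun x' => w x' j) i x) k y
        + pd (fun x => pd (fun x' => w x' i) j x) k y)
      - (pd (fun x => christoffel Q x 0 i j) k y * w y 0
        + christoffel Q y 0 i j * pd (fun x => w x 0) k y
        + pd (fun x => christoffel Q x 1 i j) k y * w y 1
        + christoffel Q y 1 i j * pd (fun x => w x 1) k y) := by
  have h1 : (fun x => (1 / 2) * (covOneForm Q w x i j + covOneForm Q w x j i)) =ᶠ[nhds y]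
      fun x => (1 / 2) * (pd (fun x' => w x' j) i x + pd (fun x' => w x' i) j x)
        - (christoffel Q x 0 i j * w x 0 + christoffel Q x 1 i j * w x 1) :=
    h.eventually.mono fun x hx => symmCov_eq hx i j
  have hwd := fun i => (hw i).differentiableAt_infty
  have hwp := fun i j => ((hw i).pd j).differentiableAt_infty
  have hc := fun k i j => (h.contDiffAt_christoffel k i j).differentiableAt_infty
  rw [pd_congr h1, pd_sub (((hwp j i).fun_add (hwp i j)).const_mul _)
      (((hc 0 i j).fun_mul (hwd 0)).fun_add ((hc 1 i j).fun_mul (hwd 1))),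
    pd_const_mul ((hwp j i).fun_add (hwp i j)), pd_add (hwp j i) (hwp i j),
    pd_add ((hc 0 i j).fun_mul (hwd 0)) ((hc 1 i j).fun_mul (hwd 1)),
    pd_mul (hc 0 i j) (hwd 0), pd_mul (hc 1 i j) (hwd 1)]
  ring

variable (h : IsSmoothMetricAt Q y) (hQ : Q y = 1) (hw : ∀ i, ContDiffAt ℝ ∞ (fun x => w x i) y)
  (hX : ∀ i j, DifferentiableAt ℝ (fun x => X x i j) y)
  (hXs : ∀ᶠ x in nhds y, X x 1 0 = X x 0 1)
  (hS : ∀ᶠ x in nhds y, ∀ i j, S x i j =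
    (1 / 2) * (covOneForm Q w x i j + covOneForm Q w x j i) + w x i * w x j + κ * X x i j)
  (hθ : DifferentiableAt ℝ θ y)
  (hSθ : ∀ᶠ x in nhds y, ∑ i, ∑ j, (Q x)⁻¹ i j * S x i j = θ x)
  (hric : ∀ i j, ricci Q y i j = θ y * Q y i j)

include h hw in
theorem differentiableAt_symmCov (i j : Fin 2) : DifferentiableAt ℝ
    (fun x => (1 / 2) * (covOneForm Q w x i j + covOneForm Q w x j i)) y := by
  have h1 : (fun x => (1 / 2) * (covOneForm Q w x i j + covOneForm Q w x j i)) =ᶠ[nhds y]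
      fun x => (1 / 2) * (pd (fun x' => w x' j) i x + pd (fun x' => w x' i) j x)
        - (christoffel Q x 0 i j * w x 0 + christoffel Q x 1 i j * w x 1) :=
    h.eventually.mono fun x hx => symmCov_eq hx i j
  have hwd := fun i => (hw i).differentiableAt_infty
  have hwp := fun i j => ((hw i).pd j).differentiableAt_infty
  have hc := fun k i j => (h.contDiffAt_christoffel k i j).differentiableAt_infty
  refine DifferentiableAt.congr_of_eventuallyEq ?_ h1
  exact (((hwp j i).fun_add (hwp i j)).const_mul _).fun_sub
      (((hc 0 i j).fun_mul (hwd 0)).fun_add ((hc 1 i j).fun_mul (hwd 1)))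

include h hw hX hS in
theorem differentiableAt_source (i j : Fin 2) : DifferentiableAt ℝ (fun x => S x i j) y := by
  have h1 : (fun x => S x i j) =ᶠ[nhds y] fun x =>
      (1 / 2) * (covOneForm Q w x i j + covOneForm Q w x j i) + w x i * w x j + κ * X x i j :=
    hS.mono fun x hx => hx i j
  have hwd := fun i => (hw i).differentiableAt_infty
  exact (((differentiableAt_symmCov h hw i j).fun_add ((hwd i).fun_mul (hwd j))).fun_add
    ((hX i j).const_mul κ)).congr_of_eventuallyEq h1

include h hw hX hS in
theorem pd_source (k i j : Fin 2) : pd (fun x => S x i j) k y =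
    (1 / 2) * (pd (fun x => pd (fun x' => w x' j) i x) k y
        + pd (fun x => pd (fun x' => w x' i) j x) k y)
      - (pd (fun x => christoffel Q x 0 i j) k y * w y 0
        + christoffel Q y 0 i j * pd (fun x => w x 0) k y
        + pd (fun x => christoffel Q x 1 i j) k y * w y 1
        + christoffel Q y 1 i j * pd (fun x => w x 1) k y)
      + (w y i * pd (fun x => w x j) k y + w y j * pd (fun x => w x i) k y)
      + κ * pd (fun x => X x i j) k y := by
  have h1 : (fun x => S x i j) =ᶠ[nhds y] fun x =>
      (1 / 2) * (covOneForm Q w x i j + covOneForm Q w x j i) + w x i * w x j + κ * X x i j :=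
    hS.mono fun x hx => hx i j
  have hwd := fun i => (hw i).differentiableAt_infty
  have hc := differentiableAt_symmCov h hw i j
  rw [pd_congr h1, pd_add (hc.fun_add ((hwd i).fun_mul (hwd j))) ((hX i j).const_mul κ),
    pd_add hc ((hwd i).fun_mul (hwd j)), pd_const_mul (hX i j), pd_mul (hwd i) (hwd j),
    pd_symmCov h hw]

include h hQ hSθ in
-- The trace relation is multiplied by `det Q` before differentiating. Only `Q y = 1` is known, not
-- the vanishing of first derivatives, so the derivatives of `Q` stay in the formula.
theorem pd_trace (hSd : ∀ i j, DifferentiableAt ℝ (fun x => S x i j) y)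
    (hθ : DifferentiableAt ℝ θ y) (k : Fin 2) :
    pd (fun x => S x 0 0) k y + pd (fun x => S x 1 1) k y
      + pd (fun x => Q x 1 1) k y * S y 0 0 - pd (fun x => Q x 0 1) k y * (S y 0 1 + S y 1 0)
      + pd (fun x => Q x 0 0) k y * S y 1 1 =
    pd θ k y + θ y * (pd (fun x => Q x 0 0) k y + pd (fun x => Q x 1 1) k y) := by
  have hq := fun i j => (h.self_of_nhds.1 i j).differentiableAt_infty
  have h1 : (fun x => Q x 1 1 * S x 0 0 - Q x 0 1 * (S x 0 1 + S x 1 0) + Q x 0 0 * S x 1 1)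
      =ᶠ[nhds y] fun x => θ x * (Q x 0 0 * Q x 1 1 - Q x 0 1 * Q x 0 1) := by
    filter_upwards [h.eventually, hSθ] with x hx hx'
    exact sum_inv_mul_fin_two hx.self_of_nhds.2.2.ne_zero (hx.self_of_nhds.2.1.apply 0 1) hx'
  have h2 := pd_congr h1 k
  rw [pd_add (((hq 1 1).fun_mul (hSd 0 0)).fun_sub ((hq 0 1).fun_mul ((hSd 0 1).fun_add (hSd 1 0))))
      ((hq 0 0).fun_mul (hSd 1 1)),
    pd_sub ((hq 1 1).fun_mul (hSd 0 0)) ((hq 0 1).fun_mul ((hSd 0 1).fun_add (hSd 1 0))),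
    pd_mul (hq 1 1) (hSd 0 0), pd_mul (hq 0 0) (hSd 1 1),
    pd_mul (hq 0 1) ((hSd 0 1).fun_add (hSd 1 0)), pd_add (hSd 0 1) (hSd 1 0),
    pd_mul hθ (((hq 0 0).fun_mul (hq 1 1)).fun_sub ((hq 0 1).fun_mul (hq 0 1))),
    pd_sub ((hq 0 0).fun_mul (hq 1 1)) ((hq 0 1).fun_mul (hq 0 1)),
    pd_mul (hq 0 0) (hq 1 1), pd_mul (hq 0 1) (hq 0 1), hQ] at h2
  simp only [Matrix.one_apply_eq, ne_eq, zero_ne_one, not_false_eq_true, Matrix.one_apply_ne] at h2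
  linarith

include h hQ hw hX hXs hS hSθ hθ hric in
/-- The divergence of the traceless part of `S = Sym(Dw) + w ⊗ w + κ X`, at a point where the
metric is the unit matrix. -/
theorem div_traceless_source (b c : Fin 2) (hbc : (b = 0 ∧ c = 1) ∨ (b = 1 ∧ c = 0)) :
    κ * (pd (fun x => X x b c) c y - pd (fun x => X x c c) b y
      + (christoffel Q y 0 b c * X y c 0 + christoffel Q y 1 b c * X y c 1)
      - (christoffel Q y 0 c c * X y b 0 + christoffel Q y 1 c c * X y b 1)
      + w y c * X y b c - w y b * X y c c) =
    divTwoTensor Q (fun x => S x - ((1 / 2) * θ x) • Q x) y b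
      + ∑ i, w y i * (S y - ((1 / 2) * θ y) • Q y) i b
      - (1 / 2) * pd θ b y - (3 / 2) * θ y * w y b
      - (1 / 2) * (pd (fun x => pd (fun x' => w x' b) c x - pd (fun x' => w x' c) b x) c y
        - (1 / 2) * (pd (fun x => Q x 0 0) c y + pd (fun x => Q x 1 1) c y)
          * (pd (fun x' => w x' b) c y - pd (fun x' => w x' c) b y))
      - (3 / 2) * w y c * (pd (fun x' => w x' b) c y - pd (fun x' => w x' c) b y) := by
  have hq := fun i j => (h.self_of_nhds.1 i j).differentiableAt_infty
  have hwd := fun i => (hw i).differentiableAt_infty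
  have hwp := fun i j => ((hw i).pd j).differentiableAt_infty
  have hSd := differentiableAt_source h hw hX hS
  have hSv := hS.self_of_nhds
  have hSp := pd_source h hw hX hS
  have htr := pd_trace h hQ hSθ hSd hθ
  have htv := sum_inv_mul_fin_two h.self_of_nhds.2.2.ne_zero (h.self_of_nhds.2.1.apply 0 1)
    hSθ.self_of_nhds
  have hX10 := hXs.self_of_nhds
  have hX10d : ∀ k, pd (fun x => X x 1 0) k y = pd (fun x => X x 0 1) k y := fun k =>
    pd_congr hXs k
  have hσ : ∀ i j k, pd (fun x => (S x - ((1 / 2) * θ x) • Q x) i j) k y =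
      pd (fun x => S x i j) k y - (1 / 2) * (θ y * pd (fun x => Q x i j) k y
        + Q y i j * pd θ k y) := by
    intro i j k
    have e : (fun x => (S x - ((1 / 2) * θ x) • Q x) i j) =
        fun x => S x i j - (1 / 2) * (θ x * Q x i j) := by
      funext x; simp only [Matrix.sub_apply, Matrix.smul_apply, smul_eq_mul]; ring
    rw [e, pd_sub (hSd i j) ((hθ.fun_mul (hq i j)).const_mul _),
      pd_const_mul (hθ.fun_mul (hq i j)), pd_mul hθ (hq i j)]
  have hΓ := christoffel_eq_of_eq_one hQ
  have hQs : ∀ k, pd (fun x => Q x 1 0) k y = pd (fun x => Q x 0 1) k y := fun k => h.pd_comm 1 0 k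
  have hΓd : ∀ l k, pd (fun x => christoffel Q x l 1 0) k y
      = pd (fun x => christoffel Q x l 0 1) k y := fun l k =>
    pd_congr (h.eventually.mono fun x hx => hx.christoffel_comm l 1 0) k
  have hRup : ∀ s r m n, riemannUp Q y s r m n = riemannLow Q y s r m n := by
    intro s r m n
    rw [h.riemannUp_eq, hQ, inv_one]
    simp [Matrix.one_apply]
  have hR0 : ∀ s m n, riemannUp Q y s s m n = 0 := fun s m n => by
    have := h.riemannLow_antisymm_left s s m n
    rw [hRup]; linarith
  -- In dimension two `Ric = θ q` determines the single curvature component, which enters when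
  -- second derivatives of `w` are commuted.
  have hR1 : riemannUp Q y 0 1 0 1 = θ y := by
    have h1 := hric 1 1
    rw [ricci, Fin.sum_univ_two, hR0, hQ] at h1
    simpa using h1
  have hR2 : riemannUp Q y 1 0 0 1 = -θ y := by
    rw [← hR1, hRup, hRup, h.riemannLow_antisymm_left]
  have r1 := hR0 0 0 1
  have r2 := hR0 1 0 1
  simp only [riemannUp, Fin.sum_univ_two] at hR1 hR2 r1 r2
  have hcomm := fun i => pd_pd_comm (hw i) 1 0
  rw [pd_sub (hwp b c) (hwp c b)]
  simp only [divTwoTensor, covTwoTensor, Fin.sum_univ_two, hσ, hQ, inv_one]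
  simp only [hQ, Matrix.one_apply_eq, ne_eq, zero_ne_one, not_false_eq_true,
    Matrix.one_apply_ne] at htv
  -- `ht` replaces the derivative of the trace of `S` by that of `θ`, and `htv` replaces the trace
  -- itself. The curvature components give the extra `-θ w_b`; together with the trace part of `S`
  -- it makes up `-(3/2) θ w_b`.
  rcases hbc with ⟨rfl, rfl⟩ | ⟨rfl, rfl⟩
  · have ht := htr 0
    simp only [hSp, hSv, symmCov_eq h, hX10, hX10d, hΓd, hQs, hcomm, hΓ, Matrix.sub_apply,
      Matrix.smul_apply, Matrix.one_apply_eq, ne_eq, zero_ne_one, one_ne_zero,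
      not_false_eq_true, Matrix.one_apply_ne, smul_eq_mul] at ht htv hR1 hR2 r1 r2 ⊢
    linear_combination -ht + (pd (fun x => Q x 0 0) 0 y + pd (fun x => Q x 1 1) 0 y - w y 0) * htv
      - w y 0 * hR1 - w y 1 * r2
  · have ht := htr 1
    simp only [hSp, hSv, symmCov_eq h, hX10, hX10d, hΓd, hQs, hcomm, hΓ, Matrix.sub_apply,
      Matrix.smul_apply, Matrix.one_apply_eq, ne_eq, zero_ne_one, one_ne_zero,
      not_false_eq_true, Matrix.one_apply_ne, smul_eq_mul] at ht htv hR1 hR2 r1 r2 ⊢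
    linear_combination -ht + (pd (fun x => Q x 0 0) 1 y + pd (fun x => Q x 1 1) 1 y - w y 1) * htv
      + w y 1 * hR2 + w y 0 * r1

end DivergenceIdentity

/-! ## Evolution along the generators -/

/-- Integrating factor: `exp (k x) * f x` has zero derivative. -/
theorem eq_exp_mul_of_hasDerivAt {f : ℝ → ℝ} {k : ℝ} (hf : ∀ t, HasDerivAt f (-(k * f t)) t)
    (s t : ℝ) : f s = Real.exp (-(k * (s - t))) * f t := by
  have h1 : ∀ x, HasDerivAt (fun x => Real.exp (k * x) * f x) 0 x := fun x => by
    have h2 := ((((hasDerivAt_id x).const_mul k).exp).mul (hf x))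
    refine h2.congr_deriv ?_
    simp only [id_eq]
    ring
  have h3 := is_const_of_deriv_eq_zero (fun x => (h1 x).differentiableAt) (fun x => (h1 x).deriv) s t
  have h4 : Real.exp (-(k * (s - t))) = Real.exp (k * t) * (Real.exp (k * s))⁻¹ := by
    rw [← Real.exp_neg, ← Real.exp_add]; ring_nf
  have h5 := (Real.exp_pos (k * s)).ne'
  rw [h4]
  field_simp
  rw [mul_comm]
  exact h3

theorem covOneForm_congr {A B : EuclideanSpace ℝ (Fin 2) → Matrix (Fin 2) (Fin 2) ℝ}
    {v w : EuclideanSpace ℝ (Fin 2) → Fin 2 → ℝ} {y : EuclideanSpace ℝ (Fin 2)}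
    (h : A =ᶠ[nhds y] B) (hv : v =ᶠ[nhds y] w) (i j : Fin 2) :
    covOneForm A v y i j = covOneForm B w y i j := by
  have h1 : (fun x => v x j) =ᶠ[nhds y] fun x => w x j := hv.mono fun x hx => by simp only [hx]
  simp only [covOneForm, pd_congr h1, christoffel_congr h, hv.eq_of_nhds]

theorem divTwoTensor_congr {A B : EuclideanSpace ℝ (Fin 2) → Matrix (Fin 2) (Fin 2) ℝ}
    {s t : EuclideanSpace ℝ (Fin 2) → Matrix (Fin 2) (Fin 2) ℝ} {y : EuclideanSpace ℝ (Fin 2)}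
    (h : A =ᶠ[nhds y] B) (hs : s =ᶠ[nhds y] t) (j : Fin 2) :
    divTwoTensor A s y j = divTwoTensor B t y j := by
  have h1 : ∀ a b, (fun x => s x a b) =ᶠ[nhds y] fun x => t x a b := fun a b =>
    hs.mono fun x hx => by simp only [hx]
  simp only [divTwoTensor, covTwoTensor, pd_congr (h1 _ _), christoffel_congr h, hs.eq_of_nhds,
    h.eq_of_nhds]

theorem divTwoTensor_smul {A t : EuclideanSpace ℝ (Fin 2) → Matrix (Fin 2) (Fin 2) ℝ}
    {f : EuclideanSpace ℝ (Fin 2) → ℝ} {y : EuclideanSpace ℝ (Fin 2)} (hf : DifferentiableAt ℝ f y)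
    (ht : ∀ i j, DifferentiableAt ℝ (fun x => t x i j) y) (j : Fin 2) :
    divTwoTensor A (fun x => f x • t x) y j =
      f y * divTwoTensor A t y j + ∑ k, ∑ i, (A y)⁻¹ k i * pd f k y * t y i j := by
  have h1 : ∀ a b c, pd (fun x => f x * t x a b) c y =
      f y * pd (fun x => t x a b) c y + t y a b * pd f c y := fun a b c => pd_mul hf (ht a b) c
  simp only [divTwoTensor, covTwoTensor, h1, Matrix.smul_apply, smul_eq_mul, Fin.sum_univ_two]
  ring

theorem pd_ofReal_add_ofReal {a b : EuclideanSpace ℝ (Fin 2) → ℝ}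
    {y : EuclideanSpace ℝ (Fin 2)} (ha : DifferentiableAt ℝ a y) (hb : DifferentiableAt ℝ b y)
    (c : ℂ) : DifferentiableAt ℝ (fun x => (a x : ℂ) + c * (b x : ℂ)) y ∧
      ∀ i, pd (fun x => (a x : ℂ) + c * (b x : ℂ)) i y =
        ((pd a i y : ℝ) : ℂ) + c * ((pd b i y : ℝ) : ℂ) := by
  have h1 := (Complex.ofRealCLM.hasFDerivAt.comp y ha.hasFDerivAt).add
    ((Complex.ofRealCLM.hasFDerivAt.comp y hb.hasFDerivAt).const_mul c)
  refine ⟨h1.differentiableAt, fun i => ?_⟩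
  have h2 := congrArg (fun L : EuclideanSpace ℝ (Fin 2) →L[ℝ] ℂ => L (EuclideanSpace.single i 1))
    h1.fderiv
  exact h2

namespace NullHypersurface

variable {M : Type*} [TopologicalSpace M] [ChartedSpace (EuclideanSpace ℝ (Fin 4)) M]
  [IsManifold (𝓡 4) ∞ M] {g : LorentzMetric M} (𝓗 : NullHypersurface g)
  {ψ : S2Chart} {y : EuclideanSpace ℝ (Fin 2)} {κ₀ : ℝ}

/-- The function `v` is arbitrary, so the sections `η = τ`, which are graphs over the sphere, carry
the same metric in the coordinates `y` as `ξ¹ = 0`. -/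
theorem q_eq_sliceMetric (hNEH : 𝓗.IsNonExpanding) (hvac : 𝓗.IsVacuum) (hψ : IsSmoothChart ψ)
    (hy : y ∈ ψ.target) (v : EuclideanSpace ℝ (Fin 2) → ℝ) :
    (fun x => 𝓗.q ψ (v x, x)) =ᶠ[nhds y] 𝓗.sliceMetric ψ := by
  filter_upwards [ψ.open_target.mem_nhds hy] with x hx
  exact 𝓗.q_eq hNEH hvac hψ hx _ _

theorem contDiffAt_slice {f : ℝ × EuclideanSpace ℝ (Fin 2) → ℝ} {u : ℝ}
    (hf : ContDiffAt ℝ ∞ f (u, y)) : ContDiffAt ℝ ∞ (fun x => f (u, x)) y := by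
  have h1 : ContDiffAt ℝ ∞ (fun x : EuclideanSpace ℝ (Fin 2) => (u, x)) y :=
    contDiffAt_const.prodMk contDiffAt_id
  exact ContDiffAt.comp (g := f) y hf h1

/-- `q`, `Ω` and `κ` do not change along the generators, so all `ξ¹` dependence of `Σ⁰` sits in `Ξ`.
-/
theorem Sigma0_eq (hNEH : 𝓗.IsNonExpanding) (hvac : 𝓗.IsVacuum) (hκ : 𝓗.GaugeKappa κ₀)
    (hψ : IsSmoothChart ψ) (hy : y ∈ ψ.target) (u : ℝ) (i j : Fin 2) :
    𝓗.Sigma0 ψ (u, y) i j =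
      (1 / 2) * (covOneForm (𝓗.sliceMetric ψ) (fun x => 𝓗.Omega ψ (0, x)) y i j
        + covOneForm (𝓗.sliceMetric ψ) (fun x => 𝓗.Omega ψ (0, x)) y j i)
      + 𝓗.Omega ψ (0, y) i * 𝓗.Omega ψ (0, y) j + κ₀ * 𝓗.Xi ψ (u, y) i j := by
  have h1 : (fun x => 𝓗.Omega ψ (u, x)) =ᶠ[nhds y] fun x => 𝓗.Omega ψ (0, x) := by
    filter_upwards [ψ.open_target.mem_nhds hy] with x hx
    exact funext fun k => 𝓗.Omega_eq hNEH hvac hκ hψ hx u 0 k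
  have h2 := 𝓗.q_eq_sliceMetric hNEH hvac hψ hy fun _ => u
  rw [Sigma0]
  simp only
  rw [covOneForm_congr h2 h1, covOneForm_congr h2 h1, hκ.2 ψ hψ u y hy,
    𝓗.Omega_eq hNEH hvac hκ hψ hy u 0, 𝓗.Omega_eq hNEH hvac hκ hψ hy u 0 j]

/-- The tangential Ricci equation: symmetrising `curvW` gives `∂_n Ξ + Σ⁰`, which must equal half
the intrinsic Ricci tensor. -/
theorem fderiv_Xi_nDir (hNEH : 𝓗.IsNonExpanding) (hvac : 𝓗.IsVacuum) (hκ : 𝓗.GaugeKappa κ₀)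
    (hψ : IsSmoothChart ψ) (hy : y ∈ ψ.target) (u : ℝ) (i j : Fin 2) :
    fderiv ℝ (fun x => 𝓗.Xi ψ x i j) (u, y) nDir =
      (1 / 2) * ricci (𝓗.sliceMetric ψ) y i j - 𝓗.Sigma0 ψ (u, y) i j := by
  have hsf := 𝓗.isShearFreeNear (z := (u, y)) hNEH hvac hκ hψ hy
  have h1 := hsf.curvW_symm (𝓗.ricci_chart_eq_zero hvac ψ (u, y)) i j
  have h2 : ∀ k l, fderiv ℝ (fun x => 𝓗.Omega ψ x k) (u, y) (eDir l) =
      pd (fun x => 𝓗.Omega ψ (0, x) k) l y := fun k l => by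
    rw [← pd_slice (𝓗.Omega_smooth (z := (u, y)) hψ hy k).differentiableAt_infty]
    refine pd_congr ?_ l
    filter_upwards [ψ.open_target.mem_nhds hy] with x hx
    exact 𝓗.Omega_eq hNEH hvac hκ hψ hx u 0 k
  have h3 := 𝓗.Xi_symm (z := (u, y)) hψ hy j i
  have h4 := 𝓗.fderiv_Xi_symm (z := (u, y)) hψ hy j i nDir
  simp only [curvW, h2, 𝓗.Omega_eq hNEH hvac hκ hψ hy u 0, h3, h4] at h1
  rw [𝓗.Sigma0_eq hNEH hvac hκ hψ hy]
  simp only [covOneForm]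
  simp only [Fin.sum_univ_two] at h1 ⊢
  linarith

theorem hasDerivAt_Sigma0 (hNEH : 𝓗.IsNonExpanding) (hvac : 𝓗.IsVacuum) (hκ : 𝓗.GaugeKappa κ₀)
    (hψ : IsSmoothChart ψ) (hy : y ∈ ψ.target) (u : ℝ) (i j : Fin 2) :
    HasDerivAt (fun t => 𝓗.Sigma0 ψ (t, y) i j)
      (κ₀ * ((1 / 2) * ricci (𝓗.sliceMetric ψ) y i j - 𝓗.Sigma0 ψ (u, y) i j)) u := by
  have h1 := deriv_slice (𝓗.Xi_smooth (z := (u, y)) hψ hy i j).differentiableAt_infty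
  rw [𝓗.fderiv_Xi_nDir hNEH hvac hκ hψ hy] at h1
  have h2 := (h1.const_mul κ₀).const_add
    ((1 / 2) * (covOneForm (𝓗.sliceMetric ψ) (fun x => 𝓗.Omega ψ (0, x)) y i j
        + covOneForm (𝓗.sliceMetric ψ) (fun x => 𝓗.Omega ψ (0, x)) y j i)
      + 𝓗.Omega ψ (0, y) i * 𝓗.Omega ψ (0, y) j)
  exact h2.congr_of_eventuallyEq (Filter.Eventually.of_forall fun t =>
    𝓗.Sigma0_eq hNEH hvac hκ hψ hy t i j)

theorem hasDerivAt_theta0 (hNEH : 𝓗.IsNonExpanding) (hvac : 𝓗.IsVacuum) (hκ : 𝓗.GaugeKappa κ₀)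
    (hψ : IsSmoothChart ψ) (hy : y ∈ ψ.target) (u : ℝ) :
    HasDerivAt (fun t => 𝓗.theta0 ψ (t, y))
      (κ₀ * ((1 / 2) * (∑ i, ∑ j, (𝓗.sliceMetric ψ y)⁻¹ i j * ricci (𝓗.sliceMetric ψ) y i j)
        - 𝓗.theta0 ψ (u, y))) u := by
  have hq : ∀ t, 𝓗.q ψ (t, y) = 𝓗.sliceMetric ψ y := fun t => 𝓗.q_eq hNEH hvac hψ hy _ _
  have h1 : HasDerivAt (fun t => ∑ i, ∑ j, (𝓗.sliceMetric ψ y)⁻¹ i j * 𝓗.Sigma0 ψ (t, y) i j) _ u :=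
    HasDerivAt.fun_sum fun i _ => HasDerivAt.fun_sum fun j _ =>
      (𝓗.hasDerivAt_Sigma0 hNEH hvac hκ hψ hy u i j).const_mul _
  simp only [theta0, hq]
  refine h1.congr_deriv ?_
  simp only [Fin.sum_univ_two]
  ring

/-- The traced evolution is `∂_n θ⁰ = κ₀ (½ R - θ⁰)`. The gauge makes the left side zero and `κ₀` is
nonzero. -/
theorem sum_inv_mul_ricci (hNEH : 𝓗.IsNonExpanding) (hvac : 𝓗.IsVacuum) (hκ : 𝓗.GaugeKappa κ₀)
    (hθ : 𝓗.GaugeTheta) (hψ : IsSmoothChart ψ) (hy : y ∈ ψ.target) (u : ℝ) :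
    ∑ i, ∑ j, (𝓗.sliceMetric ψ y)⁻¹ i j * ricci (𝓗.sliceMetric ψ) y i j =
      2 * 𝓗.theta0 ψ (u, y) := by
  have h1 := (𝓗.hasDerivAt_theta0 hNEH hvac hκ hψ hy u).deriv
  rw [hθ ψ hψ u y hy] at h1
  have h2 := (mul_eq_zero.1 h1.symm).resolve_left hκ.1.ne'
  linarith

theorem theta0_eq (hNEH : 𝓗.IsNonExpanding) (hvac : 𝓗.IsVacuum) (hκ : 𝓗.GaugeKappa κ₀)
    (hθ : 𝓗.GaugeTheta) (hψ : IsSmoothChart ψ) (hy : y ∈ ψ.target) (u v : ℝ) :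
    𝓗.theta0 ψ (u, y) = 𝓗.theta0 ψ (v, y) := by
  have h1 := 𝓗.sum_inv_mul_ricci hNEH hvac hκ hθ hψ hy u
  have h2 := 𝓗.sum_inv_mul_ricci hNEH hvac hκ hθ hψ hy v
  linarith

theorem ricci_sliceMetric (hNEH : 𝓗.IsNonExpanding) (hvac : 𝓗.IsVacuum) (hκ : 𝓗.GaugeKappa κ₀)
    (hθ : 𝓗.GaugeTheta) (hψ : IsSmoothChart ψ) (hy : y ∈ ψ.target) (u : ℝ) (i j : Fin 2) :
    ricci (𝓗.sliceMetric ψ) y i j = 𝓗.theta0 ψ (u, y) * 𝓗.sliceMetric ψ y i j := by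
  have hQ := 𝓗.isSmoothMetricAt_sliceMetric hψ hy
  have h1 := 𝓗.sum_inv_mul_ricci hNEH hvac hκ hθ hψ hy u
  have hd := hQ.self_of_nhds.2.2.ne_zero
  have h2 := sum_inv_mul_fin_two hd (hQ.self_of_nhds.2.1.apply 0 1)
    (B := Matrix.of (ricci (𝓗.sliceMetric ψ) y)) h1
  have hdet : (𝓗.sliceMetric ψ y).det = 𝓗.sliceMetric ψ y 0 0 * 𝓗.sliceMetric ψ y 1 1
      - 𝓗.sliceMetric ψ y 0 1 * 𝓗.sliceMetric ψ y 0 1 := by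
    rw [Matrix.det_fin_two, hQ.self_of_nhds.2.1.apply 0 1]
  have h3 := hQ.self_of_nhds.2.1.apply 0 1
  rw [← hdet] at h2
  simp only [Matrix.of_apply, hQ.ricci_fin_two, h3] at h2
  rw [hQ.ricci_fin_two]
  congr 1
  refine mul_left_cancel₀ hd ?_
  linear_combination (1 / 2) * h2 + (𝓗.sliceMetric ψ y).det⁻¹
    * riemannLow (𝓗.sliceMetric ψ) y 0 1 0 1 * hdet

/-- The inhomogeneous term `½ Ric(q) = ½ θ⁰ q` is pure trace and cancels against the trace part of
`Σ⁰`, leaving the homogeneous equation `∂_n σ⁰ = -κ₀ σ⁰`. -/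
theorem sigma0_eq_exp (hNEH : 𝓗.IsNonExpanding) (hvac : 𝓗.IsVacuum) (hκ : 𝓗.GaugeKappa κ₀)
    (hθ : 𝓗.GaugeTheta) (hψ : IsSmoothChart ψ) (hy : y ∈ ψ.target) (s t : ℝ) :
    𝓗.sigma0 ψ (s, y) = Real.exp (-(κ₀ * (s - t))) • 𝓗.sigma0 ψ (t, y) := by
  ext i j
  have hq : ∀ t, 𝓗.q ψ (t, y) = 𝓗.sliceMetric ψ y := fun t => 𝓗.q_eq hNEH hvac hψ hy _ _
  refine eq_exp_mul_of_hasDerivAt (f := fun t => 𝓗.sigma0 ψ (t, y) i j) (fun u => ?_) s t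
  simp only [sigma0, Matrix.of_apply, hq, 𝓗.theta0_eq hNEH hvac hκ hθ hψ hy _ 0]
  have h1 := (𝓗.hasDerivAt_Sigma0 hNEH hvac hκ hψ hy u i j).sub_const
    ((1 / 2) * 𝓗.theta0 ψ (0, y) * 𝓗.sliceMetric ψ y i j)
  refine h1.congr_deriv ?_
  rw [𝓗.ricci_sliceMetric hNEH hvac hκ hθ hψ hy 0]
  ring

theorem differentiableAt_Sigma0 (hNEH : 𝓗.IsNonExpanding) (hvac : 𝓗.IsVacuum)
    (hκ : 𝓗.GaugeKappa κ₀) (hψ : IsSmoothChart ψ) (hy : y ∈ ψ.target) (u : ℝ) (i j : Fin 2) :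
    DifferentiableAt ℝ (fun x => 𝓗.Sigma0 ψ (u, x) i j) y := by
  refine differentiableAt_source (S := fun x => Matrix.of (𝓗.Sigma0 ψ (u, x)))
    (X := fun x => 𝓗.Xi ψ (u, x)) (κ := κ₀) (w := fun x => 𝓗.Omega ψ (0, x))
    (𝓗.isSmoothMetricAt_sliceMetric hψ hy)
    (fun k => contDiffAt_slice (𝓗.Omega_smooth (z := (0, y)) hψ hy k))
    (fun k l => (contDiffAt_slice (𝓗.Xi_smooth (z := (u, y)) hψ hy k l)).differentiableAt_infty)
    ?_ i j
  filter_upwards [ψ.open_target.mem_nhds hy] with x hx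
  exact fun k l => 𝓗.Sigma0_eq hNEH hvac hκ hψ hx u k l

theorem differentiableAt_theta0 (hNEH : 𝓗.IsNonExpanding) (hvac : 𝓗.IsVacuum)
    (hκ : 𝓗.GaugeKappa κ₀) (hψ : IsSmoothChart ψ) (hy : y ∈ ψ.target) (u : ℝ) :
    DifferentiableAt ℝ (fun x => 𝓗.theta0 ψ (u, x)) y := by
  have h1 := fun i j => ContDiffAt.matrix_inv (A := fun x => 𝓗.q ψ (u, x))
    (fun i j => contDiffAt_slice (𝓗.q_smooth (z := (u, y)) hψ hy i j))
    (isUnit_iff_ne_zero.2 (𝓗.q_det_pos (z := (u, y)) hψ hy).ne') i j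
  exact DifferentiableAt.fun_sum fun i _ => DifferentiableAt.fun_sum fun j _ =>
    (h1 i j).differentiableAt_infty.fun_mul (𝓗.differentiableAt_Sigma0 hNEH hvac hκ hψ hy u i j)

theorem differentiableAt_sigma0 (hNEH : 𝓗.IsNonExpanding) (hvac : 𝓗.IsVacuum)
    (hκ : 𝓗.GaugeKappa κ₀) (hψ : IsSmoothChart ψ) (hy : y ∈ ψ.target) (u : ℝ) (i j : Fin 2) :
    DifferentiableAt ℝ (fun x => 𝓗.sigma0 ψ (u, x) i j) y :=
  (𝓗.differentiableAt_Sigma0 hNEH hvac hκ hψ hy u i j).fun_sub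
    (((𝓗.differentiableAt_theta0 hNEH hvac hκ hψ hy u).const_mul _).fun_mul
      (contDiffAt_slice (𝓗.q_smooth (z := (u, y)) hψ hy i j)).differentiableAt_infty)

end NullHypersurface

/-! ### Gauge-corrected fields on the sections of constant potential. -/

namespace NullHypersurface

variable {M : Type*} [TopologicalSpace M] [ChartedSpace (EuclideanSpace ℝ (Fin 4)) M]
  [IsManifold (𝓡 4) ∞ M] {g : LorentzMetric M} (𝓗 : NullHypersurface g)
  {ψ : S2Chart} {y : EuclideanSpace ℝ (Fin 2)} {κ₀ : ℝ} {η : ℝ × S2 → ℝ}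

variable {𝓗} in
theorem IsPotential.contDiffAt (hη : 𝓗.IsPotential η) (hψ : IsSmoothChart ψ) (hy : y ∈ ψ.target)
    (u : ℝ) : ContDiffAt ℝ ∞ (fun z : ℝ × EuclideanSpace ℝ (Fin 2) => η (z.1, ψ.symm z.2)) (u, y) :=
  (ContMDiffAt.comp (u, y) (hη.smooth.contMDiffAt)
    (contMDiffAt_sphereCoord (z := (u, y)) hψ hy)).contDiffAt

variable {𝓗} in
theorem IsPotential.eq_add (hη : 𝓗.IsPotential η) (hκ : 𝓗.GaugeKappa κ₀) (hψ : IsSmoothChart ψ)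
    (hy : y ∈ ψ.target) (u : ℝ) : η (u, ψ.symm y) = κ₀ * u + η (0, ψ.symm y) := by
  have h1 : ∀ t, HasDerivAt (fun t => η (t, ψ.symm y) - κ₀ * t) 0 t := fun t => by
    have h2 := (deriv_slice (hη.contDiffAt hψ hy t).differentiableAt_infty).differentiableAt.hasDerivAt
    simp only [hη.null_deriv ψ hψ t y hy, hκ.2 ψ hψ t y hy] at h2
    refine (h2.sub ((hasDerivAt_id t).const_mul κ₀)).congr_deriv ?_
    simp
  have h3 := is_const_of_deriv_eq_zero (fun x => (h1 x).differentiableAt) (fun x => (h1 x).deriv) u 0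
  simp only [mul_zero, sub_zero] at h3
  linarith

variable {𝓗} in
-- Since `η = κ₀ ξ¹ + h`, the derivative of `η` within a section is `∂h`, whatever the section.
theorem IsPotential.OmegaE_eq (hη : 𝓗.IsPotential η) (hκ : 𝓗.GaugeKappa κ₀) (hψ : IsSmoothChart ψ)
    (hy : y ∈ ψ.target) (u : ℝ) (i : Fin 2) :
    OmegaE η ψ (u, y) i = pd (fun x => η (0, ψ.symm x)) i y := by
  have h1 : (fun x => η (u, ψ.symm x)) =ᶠ[nhds y] fun x => κ₀ * u + η (0, ψ.symm x) := by
    filter_upwards [ψ.open_target.mem_nhds hy] with x hx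
    exact hη.eq_add hκ hψ hx u
  rw [OmegaE, pd_congr h1, pd, fderiv_const_add, pd]

/-- `κ₀ (H(τ, ·) - u) = τ - h - κ₀ u`, inserted into the exponential decay of `σ⁰`. All dependence
on the shape of the section `η = τ` is now in the scalar factor `exp h`. -/
theorem sTensor_eq (hNEH : 𝓗.IsNonExpanding) (hvac : 𝓗.IsVacuum) (hκ : 𝓗.GaugeKappa κ₀)
    (hθ : 𝓗.GaugeTheta) (hψ : IsSmoothChart ψ) (hy : y ∈ ψ.target) (τ u : ℝ) :
    𝓗.sTensor κ₀ η ψ τ y =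
      Real.exp (η (0, ψ.symm y) + (κ₀ * u - τ)) • 𝓗.sigma0 ψ (u, y) := by
  rw [sTensor, sectionPt, nullCoord, 𝓗.sigma0_eq_exp hNEH hvac hκ hθ hψ hy _ u]
  congr 2
  have := hκ.1.ne'
  field_simp
  ring

/-- The field `Ds` on the section `η = τ`, in terms of the traceless tensor of the section
`ξ¹ = u`. -/
theorem DsComp_eq (hNEH : 𝓗.IsNonExpanding) (hvac : 𝓗.IsVacuum) (hκ : 𝓗.GaugeKappa κ₀)
    (hθ : 𝓗.GaugeTheta) (hη : 𝓗.IsPotential η) (hψ : IsSmoothChart ψ) (hy : y ∈ ψ.target)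
    (hq : 𝓗.sliceMetric ψ y = 1) (τ u : ℝ) (a : Fin 2) :
    𝓗.DsComp κ₀ η ψ τ y a = Real.exp (η (0, ψ.symm y) + (κ₀ * u - τ)) *
      (divTwoTensor (𝓗.sliceMetric ψ) (fun x => 𝓗.sigma0 ψ (u, x)) y a
        + ∑ i, 𝓗.Omega ψ (0, y) i * 𝓗.sigma0 ψ (u, y) i a) := by
  have hh : DifferentiableAt ℝ (fun x => η (0, ψ.symm x)) y :=
    (contDiffAt_slice (hη.contDiffAt hψ hy 0)).differentiableAt_infty
  have hf : HasFDerivAt (fun x => Real.exp (η (0, ψ.symm x) + (κ₀ * u - τ))) _ y :=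
    (hh.hasFDerivAt.add_const (κ₀ * u - τ)).exp
  -- Differentiating the factor brings down `∂h = Ωᵉ`; in the divergence this adds to the explicit
  -- `Ω⁰` term and yields the full `Ω`.
  have hpd : ∀ i, pd (fun x => Real.exp (η (0, ψ.symm x) + (κ₀ * u - τ))) i y =
      Real.exp (η (0, ψ.symm y) + (κ₀ * u - τ)) * pd (fun x => η (0, ψ.symm x)) i y := fun i => by
    rw [pd, hf.fderiv]; rfl
  have hs : 𝓗.sTensor κ₀ η ψ τ =ᶠ[nhds y] fun x =>
      Real.exp (η (0, ψ.symm x) + (κ₀ * u - τ)) • 𝓗.sigma0 ψ (u, x) := by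
    filter_upwards [ψ.open_target.mem_nhds hy] with x hx
    exact 𝓗.sTensor_eq hNEH hvac hκ hθ hψ hx τ u
  have hQ := 𝓗.q_eq_sliceMetric hNEH hvac hψ hy fun x => nullCoord κ₀ η τ (ψ.symm x)
  have hQy : 𝓗.q ψ (nullCoord κ₀ η τ (ψ.symm y), y) = 1 := hQ.eq_of_nhds.trans hq
  rw [DsComp]
  simp only [sectionPt]
  rw [divTwoTensor_congr hQ hs, divTwoTensor_smul hf.differentiableAt
    (𝓗.differentiableAt_sigma0 hNEH hvac hκ hψ hy u), hs.eq_of_nhds, hQy, hq]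
  simp only [hpd, Omega0, hη.OmegaE_eq hκ hψ hy, 𝓗.Omega_eq hNEH hvac hκ hψ hy _ 0,
    Matrix.smul_apply, smul_eq_mul, Fin.sum_univ_two, inv_one, Matrix.one_apply_eq, ne_eq,
    zero_ne_one, one_ne_zero, not_false_eq_true, Matrix.one_apply_ne]
  ring

theorem twist_eq (hNEH : 𝓗.IsNonExpanding) (hvac : 𝓗.IsVacuum) (hκ : 𝓗.GaugeKappa κ₀)
    (hψ : IsSmoothChart ψ) (hy : y ∈ ψ.target) (u : ℝ) :
    𝓗.twist ψ (u, y) = pd (fun x => 𝓗.Omega ψ (0, x) 1) 0 y - pd (fun x => 𝓗.Omega ψ (0, x) 0) 1 y := by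
  have h2 : ∀ k l, fderiv ℝ (fun x => 𝓗.Omega ψ x k) (u, y) (eDir l) =
      pd (fun x => 𝓗.Omega ψ (0, x) k) l y := fun k l => by
    rw [← pd_slice (𝓗.Omega_smooth (z := (u, y)) hψ hy k).differentiableAt_infty]
    refine pd_congr ?_ l
    filter_upwards [ψ.open_target.mem_nhds hy] with x hx
    exact 𝓗.Omega_eq hNEH hvac hκ hψ hx u 0 k
  rw [twist, h2, h2]

/-- The scalar `Ψ₂` is constant along the generators. -/
theorem Psi2_eq_theta0 (hNEH : 𝓗.IsNonExpanding) (hvac : 𝓗.IsVacuum) (hκ : 𝓗.GaugeKappa κ₀)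
    (hθ : 𝓗.GaugeTheta) (hψ : IsSmoothChart ψ) (hy : y ∈ ψ.target) (u : ℝ) :
    𝓗.Psi2 ψ (u, y) = ((-(1 / 2) * 𝓗.theta0 ψ (0, y) : ℝ) : ℂ) + Complex.I / 2 *
      (((pd (fun x => 𝓗.Omega ψ (0, x) 1) 0 y - pd (fun x => 𝓗.Omega ψ (0, x) 0) 1 y)
        * (Real.sqrt (𝓗.sliceMetric ψ y).det)⁻¹ : ℝ) : ℂ) := by
  have hq : 𝓗.q ψ (u, y) = 𝓗.sliceMetric ψ y := 𝓗.q_eq hNEH hvac hψ hy _ _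
  rw [𝓗.Psi2_eq (z := (u, y)) hNEH hvac hκ hψ hy, 𝓗.twist_eq hNEH hvac hκ hψ hy, hq]
  simp only
  rw [𝓗.sum_inv_mul_ricci hNEH hvac hκ hθ hψ hy 0]
  congr 2
  ring

/-- `Ψ₂` is constant along the generators, so `H(τ, ·)` drops out and only the derivative within `ξ¹
= 0` is taken. The factor `1/√det q` is differentiated too: its derivative need not vanish where `q
= 1`. -/
theorem Psi2c_deriv (hNEH : 𝓗.IsNonExpanding) (hvac : 𝓗.IsVacuum) (hκ : 𝓗.GaugeKappa κ₀)
    (hθ : 𝓗.GaugeTheta) (hψ : IsSmoothChart ψ) (hy : y ∈ ψ.target)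
    (hq : 𝓗.sliceMetric ψ y = 1) (τ : ℝ) :
    DifferentiableAt ℝ (𝓗.Psi2c κ₀ η ψ τ) y ∧ ∀ i, pd (𝓗.Psi2c κ₀ η ψ τ) i y =
      ((-(1 / 2) * pd (fun x => 𝓗.theta0 ψ (0, x)) i y : ℝ) : ℂ) + Complex.I / 2 *
        ((pd (fun x => pd (fun x' => 𝓗.Omega ψ (0, x') 1) 0 x
            - pd (fun x' => 𝓗.Omega ψ (0, x') 0) 1 x) i y
          - (1 / 2) * (pd (fun x => 𝓗.sliceMetric ψ x 0 0) i y
            + pd (fun x => 𝓗.sliceMetric ψ x 1 1) i y)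
            * (pd (fun x' => 𝓗.Omega ψ (0, x') 1) 0 y
              - pd (fun x' => 𝓗.Omega ψ (0, x') 0) 1 y) : ℝ) : ℂ) := by
  have h1 : 𝓗.Psi2c κ₀ η ψ τ =ᶠ[nhds y] fun y =>
      ((-(1 / 2) * 𝓗.theta0 ψ (0, y) : ℝ) : ℂ) + Complex.I / 2 *
      (((pd (fun x => 𝓗.Omega ψ (0, x) 1) 0 y - pd (fun x => 𝓗.Omega ψ (0, x) 0) 1 y)
        * (Real.sqrt (𝓗.sliceMetric ψ y).det)⁻¹ : ℝ) : ℂ) := by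
    filter_upwards [ψ.open_target.mem_nhds hy] with x hx
    exact 𝓗.Psi2_eq_theta0 hNEH hvac hκ hθ hψ hx _
  have hw := fun i => contDiffAt_slice (𝓗.Omega_smooth (z := (0, y)) hψ hy i)
  have hwp := fun i j => ((hw i).pd j).differentiableAt_infty
  have hQ := 𝓗.isSmoothMetricAt_sliceMetric hψ hy
  have hth := 𝓗.differentiableAt_theta0 hNEH hvac hκ hψ hy 0
  have hdet := ContDiffAt.matrix_det hQ.self_of_nhds.1
  have hd1 : (𝓗.sliceMetric ψ y).det = 1 := by rw [hq, Matrix.det_one]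
  have hs : DifferentiableAt ℝ (fun x => (Real.sqrt (𝓗.sliceMetric ψ x).det)⁻¹) y :=
    (hdet.differentiableAt_infty.sqrt (by rw [hd1]; norm_num)).inv (by rw [hd1]; norm_num)
  obtain ⟨h2, h3⟩ := pd_ofReal_add_ofReal (hth.const_mul (-(1 / 2)))
    (((hwp 1 0).fun_sub (hwp 0 1)).fun_mul hs) (Complex.I / 2)
  refine ⟨h2.congr_of_eventuallyEq h1, fun i => ?_⟩
  rw [pd_congr h1, h3, pd_const_mul hth, pd_mul_inv_sqrt_det hQ hq ((hwp 1 0).fun_sub (hwp 0 1))]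

/-- The transverse curvature of the horizon in terms of the traceless source. -/
theorem sum_curvC (hNEH : 𝓗.IsNonExpanding) (hvac : 𝓗.IsVacuum) (hκ : 𝓗.GaugeKappa κ₀)
    (hθ : 𝓗.GaugeTheta) (hψ : IsSmoothChart ψ) (hy : y ∈ ψ.target)
    (hq : 𝓗.sliceMetric ψ y = 1) (u : ℝ) (b c : Fin 2)
    (hbc : (b = 0 ∧ c = 1) ∨ (b = 1 ∧ c = 0)) :
    κ₀ * ∑ a, curvC (𝓗.sliceMetric ψ) (𝓗.Omega ψ) (𝓗.Xi ψ) (u, y) a b a =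
    divTwoTensor (𝓗.sliceMetric ψ) (fun x => 𝓗.sigma0 ψ (u, x)) y b
      + ∑ i, 𝓗.Omega ψ (0, y) i * 𝓗.sigma0 ψ (u, y) i b
      - (1 / 2) * pd (fun x => 𝓗.theta0 ψ (0, x)) b y
      - (3 / 2) * 𝓗.theta0 ψ (0, y) * 𝓗.Omega ψ (0, y) b
      - (1 / 2) * (pd (fun x => pd (fun x' => 𝓗.Omega ψ (0, x') b) c x
          - pd (fun x' => 𝓗.Omega ψ (0, x') c) b x) c y
        - (1 / 2) * (pd (fun x => 𝓗.sliceMetric ψ x 0 0) c y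
            + pd (fun x => 𝓗.sliceMetric ψ x 1 1) c y)
          * (pd (fun x' => 𝓗.Omega ψ (0, x') b) c y - pd (fun x' => 𝓗.Omega ψ (0, x') c) b y))
      - (3 / 2) * 𝓗.Omega ψ (0, y) c
        * (pd (fun x' => 𝓗.Omega ψ (0, x') b) c y - pd (fun x' => 𝓗.Omega ψ (0, x') c) b y) := by
  have hX := fun i j => (𝓗.Xi_smooth (z := (u, y)) hψ hy i j)
  have hqv : ∀ x ∈ ψ.target, 𝓗.q ψ (u, x) = 𝓗.sliceMetric ψ x := fun x hx =>
    𝓗.q_eq hNEH hvac hψ hx _ _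
  have hσ : (fun x => 𝓗.sigma0 ψ (u, x)) =ᶠ[nhds y] fun x => Matrix.of (𝓗.Sigma0 ψ (u, x))
      - ((1 / 2) * 𝓗.theta0 ψ (0, x)) • 𝓗.sliceMetric ψ x := by
    filter_upwards [ψ.open_target.mem_nhds hy] with x hx
    ext i j
    rw [sigma0, Matrix.of_apply, hqv x hx, 𝓗.theta0_eq hNEH hvac hκ hθ hψ hx u 0]
    rfl
  -- `Ω` and `θ⁰` may be taken on `ξ¹ = 0` while `Ξ` and `Σ⁰` stay on `ξ¹ = u`, because the former
  -- do not vary along the generators.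
  have key := div_traceless_source (𝓗.isSmoothMetricAt_sliceMetric hψ hy) hq
    (w := fun x => 𝓗.Omega ψ (0, x)) (X := fun x => 𝓗.Xi ψ (u, x))
    (S := fun x => Matrix.of (𝓗.Sigma0 ψ (u, x))) (θ := fun x => 𝓗.theta0 ψ (0, x)) (κ := κ₀)
    (fun i => contDiffAt_slice (𝓗.Omega_smooth (z := (0, y)) hψ hy i))
    (fun i j => (contDiffAt_slice (hX i j)).differentiableAt_infty)
    (by filter_upwards [ψ.open_target.mem_nhds hy] with x hx
        exact 𝓗.Xi_symm (z := (u, x)) hψ hx 1 0)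
    (by filter_upwards [ψ.open_target.mem_nhds hy] with x hx
        exact fun i j => 𝓗.Sigma0_eq hNEH hvac hκ hψ hx u i j)
    (𝓗.differentiableAt_theta0 hNEH hvac hκ hψ hy 0)
    (by filter_upwards [ψ.open_target.mem_nhds hy] with x hx
        rw [← 𝓗.theta0_eq hNEH hvac hκ hθ hψ hx u 0, theta0, hqv x hx]
        rfl)
    (𝓗.ricci_sliceMetric hNEH hvac hκ hθ hψ hy 0) b c hbc
  rw [divTwoTensor_congr (Filter.EventuallyEq.refl _ _) hσ, hσ.eq_of_nhds, ← key]
  have hp := fun i j k => pd_slice (hX i j).differentiableAt_infty k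
  simp only at hp
  -- The summand `a = b` vanishes by antisymmetry of `curvC` in its first two indices.
  rcases hbc with ⟨rfl, rfl⟩ | ⟨rfl, rfl⟩ <;>
  · simp only [curvC, Fin.sum_univ_two, hp, 𝓗.Omega_eq hNEH hvac hκ hψ hy u 0]
    ring

end NullHypersurface

theorem mainTheorem6 {M : Type*} [TopologicalSpace M]
    [ChartedSpace (EuclideanSpace ℝ (Fin 4)) M] [IsManifold (𝓡 4) ∞ M]
    (g : LorentzMetric M) (𝓗 : NullHypersurface g)
    (hNEH : 𝓗.IsNonExpanding) (hvac : 𝓗.IsVacuum)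
    (κ₀ : ℝ) (hgauge₁ : 𝓗.GaugeKappa κ₀) (hgauge₂ : 𝓗.GaugeTheta)
    (η : ℝ × S2 → ℝ) (hη : 𝓗.IsPotential η)
    (ψ : S2Chart) (hψ : IsSmoothChart ψ) (y : EuclideanSpace ℝ (Fin 2)) (hy : y ∈ ψ.target)
    (u₀ : ℝ) (hq : 𝓗.q ψ (u₀, y) = 1) (τ τ₀ : ℝ) :
    DifferentiableAt ℝ (𝓗.Psi2c κ₀ η ψ τ) y ∧
    𝓗.Psi3c κ₀ η ψ τ y =
      1 / ((κ₀ : ℂ) * (Real.sqrt 2 : ℂ)) *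
        (𝓗.Ds κ₀ η ψ τ₀ y * (Real.exp (-(τ - τ₀)) : ℂ)
          + DHat (𝓗.Psi2c κ₀ η ψ τ) y
          + 3 * hat (𝓗.Omega0 η ψ (NullHypersurface.sectionPt κ₀ η ψ τ y)) * 𝓗.Psi2c κ₀ η ψ τ y
          + 3 * hat (NullHypersurface.OmegaE η ψ (NullHypersurface.sectionPt κ₀ η ψ τ y))
            * 𝓗.Psi2c κ₀ η ψ τ y) := by
  have hQ : 𝓗.sliceMetric ψ y = 1 := (𝓗.q_eq hNEH hvac hψ hy 0 u₀).trans hq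
  obtain ⟨hd, hp⟩ := 𝓗.Psi2c_deriv (η := η) hNEH hvac hgauge₁ hgauge₂ hψ hy hQ τ
  refine ⟨hd, ?_⟩
  have hκ : (κ₀ : ℂ) ≠ 0 := Complex.ofReal_ne_zero.2 hgauge₁.1.ne'
  have h2 : ((Real.sqrt 2 : ℝ) : ℂ) ≠ 0 := Complex.ofReal_ne_zero.2 (by positivity)
  -- `u = H(τ, y)` is the position on the generator at which `Ψ₃ᶜ` is evaluated; `Ds` at `τ₀` is
  -- also referred to the section `ξ¹ = u`.
  set u := NullHypersurface.nullCoord κ₀ η τ (ψ.symm y) with hu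
  have hqu : 𝓗.q ψ (u, y) = 1 := (𝓗.q_eq hNEH hvac hψ hy u u₀).trans hq
  have hDs := 𝓗.DsComp_eq hNEH hvac hgauge₁ hgauge₂ hη hψ hy hQ τ₀ u
  -- With this choice of `u` the factor in `Ds` at `τ₀` is `exp (τ - τ₀)`, which cancels the
  -- exponential of the statement.
  have hexp : η (0, ψ.symm y) + (κ₀ * u - τ₀) = τ - τ₀ := by
    rw [hu, NullHypersurface.nullCoord]
    have := hgauge₁.1.ne'
    field_simp
    ring
  have hE : ((Real.exp (τ - τ₀) : ℝ) : ℂ) * ((Real.exp (-(τ - τ₀)) : ℝ) : ℂ) = 1 := by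
    rw [← Complex.ofReal_mul, ← Real.exp_add, add_neg_cancel, Real.exp_zero, Complex.ofReal_one]
  have c0 := 𝓗.sum_curvC hNEH hvac hgauge₁ hgauge₂ hψ hy hQ u 0 1 (Or.inl ⟨rfl, rfl⟩)
  have c1 := 𝓗.sum_curvC hNEH hvac hgauge₁ hgauge₂ hψ hy hQ u 1 0 (Or.inr ⟨rfl, rfl⟩)
  have hO : hat (𝓗.Omega0 η ψ (u, y)) + hat (NullHypersurface.OmegaE η ψ (u, y)) =
      hat (𝓗.Omega ψ (0, y)) := by
    simp only [hat, NullHypersurface.Omega0, 𝓗.Omega_eq hNEH hvac hgauge₁ hψ hy u 0]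
    push_cast
    ring
  -- For `b = 0`, `c = 1` the identity contains the twist with the opposite sign.
  have hneg : pd (fun x => pd (fun x' => 𝓗.Omega ψ (0, x') 0) 1 x
      - pd (fun x' => 𝓗.Omega ψ (0, x') 1) 0 x) 1 y =
      -pd (fun x => pd (fun x' => 𝓗.Omega ψ (0, x') 1) 0 x
        - pd (fun x' => 𝓗.Omega ψ (0, x') 0) 1 x) 1 y := by
    have hw := fun i j => ((NullHypersurface.contDiffAt_slice
      (𝓗.Omega_smooth (z := (0, y)) hψ hy i)).pd j).differentiableAt_infty
    rw [pd_sub (hw 0 1) (hw 1 0), pd_sub (hw 1 0) (hw 0 1), neg_sub]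
  rw [hneg] at c0
  have hP := 𝓗.Psi2_eq_theta0 hNEH hvac hgauge₁ hgauge₂ hψ hy u
  rw [hQ, Matrix.det_one, Real.sqrt_one, inv_one, mul_one] at hP
  have hP2 : 𝓗.Psi2c κ₀ η ψ τ y = _ := hP
  have hP3 : 𝓗.Psi3c κ₀ η ψ τ y = _ :=
    𝓗.Psi3_eq (z := (u, y)) hNEH hvac hgauge₁ hψ hy hqu
  have hsp : NullHypersurface.sectionPt κ₀ η ψ τ y = (u, y) := rfl
  rw [hsp, hP3, DHat, hp 0, hp 1, NullHypersurface.Ds, hDs 0, hDs 1, hexp, hP2, add_assoc, ← add_mul,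
    ← mul_add, hO]
  have hC : ∀ {A B s k : ℂ}, k ≠ 0 → s ≠ 0 → k * A = B → 1 / s * A = 1 / (k * s) * B := by
    rintro A B s k hk hs rfl
    field_simp
  refine hC hκ h2 ?_
  have c0' := congrArg (fun r : ℝ => (r : ℂ)) c0
  have c1' := congrArg (fun r : ℝ => (r : ℂ)) c1
  simp only [hat]
  push_cast at c0' c1' hE ⊢
  set F : ℂ := ((pd (fun x' => 𝓗.Omega ψ (0, x') 1) 0 y : ℝ) : ℂ)
    - ((pd (fun x' => 𝓗.Omega ψ (0, x') 0) 1 y : ℝ) : ℂ) with hF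
  -- The combination `c0 - i c1` forms the hatted equation, `hE` cancels the exponentials, and
  -- `I_sq` is used where the `-i` of a hat meets the `i/2` in `Ψ₂`.
  linear_combination c0' - Complex.I * c1'
    - ((divTwoTensor (𝓗.sliceMetric ψ) (fun x => 𝓗.sigma0 ψ (u, x)) y 0 : ℂ)
        + ∑ i, (𝓗.Omega ψ (0, y) i : ℂ) * (𝓗.sigma0 ψ (u, y) i 0 : ℂ)
      - Complex.I * ((divTwoTensor (𝓗.sliceMetric ψ) (fun x => 𝓗.sigma0 ψ (u, x)) y 1 : ℂ)
        + ∑ i, (𝓗.Omega ψ (0, y) i : ℂ) * (𝓗.sigma0 ψ (u, y) i 1 : ℂ))) * hE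
    + ((1 / 2) * (((pd (fun x => pd (fun x' => 𝓗.Omega ψ (0, x') 1) 0 x
          - pd (fun x' => 𝓗.Omega ψ (0, x') 0) 1 x) 1 y : ℝ) : ℂ)
        - (1 / 2) * (((pd (fun x => 𝓗.sliceMetric ψ x 0 0) 1 y : ℝ) : ℂ)
          + ((pd (fun x => 𝓗.sliceMetric ψ x 1 1) 1 y : ℝ) : ℂ)) * F)
      + (3 / 2) * (𝓗.Omega ψ (0, y) 1 : ℂ) * F) * Complex.I_sq
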